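/- **Setting.** Let $G=\prod_{\mu=1}^D \mathbb Z/L_\mu$ be a $D$-dimensional lattice with periodic boundary conditions, $n=|G|$, with one qubit at each site, and let ${\rm dist}(a,b)=\sum_\mu |a_\mu-b_\mu|$, each difference being measured around the circle of length $L_\mu$. An $n$-qubit state $\rho$ is *translationally symmetric* if $T_\mu\rho T_\mu^\dagger=\rho$ for the unit translations $T_\mu$, $\mu=1,\dots,D$. It has *correlation length at most $\xi$* if $|\langle O_AO_B\rangle-\langle O_A\rangle\langle O_B\rangle|\le\|O_A\|\,\|O_B\|\,e^{-{\rm dist}(A,B)/\xi}$ for all observables $O_A,O_B$ acting on subsystems $A,B\subseteq G$, where $\langle O\rangle={\rm tr}(O\rho)$ and $\|\cdot\|$ is the spectral norm. Let $m,p\ge1$ and let $g(\rho)=\sum_i c_i\prod_{j=1}^p{\rm tr}[P_{ij}\rho]$ be an $m$-body, degree-$p$ polynomial: a finite sum with $c_i\in\mathbb R$ and Pauli strings $P_{ij}$ of weight at most $m$; put $\|g\|_1=\sum_i|c_i|$. For $\delta>0$ decompose each $P_{ij}=P_{ij1}\otimes\cdots\otimes P_{ijd_{ij}}$ along the connected components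 of the graph on ${\rm supp}(P_{ij})$ in which two sites are joined if their distance is at most $\delta$. The *local-factor count* is ${\rm LFC}(g;\delta)=\max(p,\min_i b_i)$ with $b_i=\sum_j d_{ij}$. *Shadows.* A classical shadow $S_T(\rho)$ of size $T$ consists of $T$ independent rounds, in each of which every qubit of a fresh copy of $\rho$ is measured in an independent uniformly random Pauli basis $W_v^{(t)}\in\{X,Y,Z\}$ with outcome $o_v^{(t)}=\pm1$; put $\sigma_v^{(t)}=(3o_v^{(t)}W_v^{(t)}+I)/2$. For $\tau,\gamma>0$ the shadow kernel is $$k_{\rm SK}(S,\tilde S)=\exp\Big[\frac{\tau}{T^2}\sum_{t,t'=1}^T\exp\Big(\frac{\gamma}{n}\sum_{v\in G}{\rm tr}\big(\sigma_v^{(t)}\tilde\sigma_v^{(t')}\big)\Big)\Big]=\langle\phi_{\rm SK}(S),\phi_{\rm SK}(\tilde S)\rangle,$$ with feature vector, in a real $\ell^2$ space, $$\phi_{\rm SK}(S)=\bigoplus_{d\ge0}\sqrt{\tfrac{\tau^d}{d!}}\Big(\bigoplus_{r\ge0}\sqrt{\tfrac1{r!}\big(\tfrac\gamma n\big)^r}\bigoplus_{v_1,\dots,v_r\in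 G}{\rm vec}\Big(\tfrac1T\sum_t\sigma_{v_1}^{(t)}\otimes\cdots\otimes\sigma_{v_r}^{(t)}\Big)\Big)^{\otimes d},$$ where ${\rm vec}(\sigma)_P={\rm tr}(P\sigma)/\sqrt{2^r}$ for $P\in\{I,X,Y,Z\}^{\otimes r}$. *Learning.* Let $\mathcal D$ be a probability distribution on states such that almost every state is translationally symmetric with correlation length at most $\xi>0$, and let $\mathcal D_S$ be the law of $(S_T(\rho),g(\rho))$ with $\rho\sim\mathcal D$. Put $L_{\mathcal D_S}(w)=\mathbb E_{(S,y)\sim\mathcal D_S}\big[(y-\langle w,\phi_{\rm SK}(S)\rangle)^2/2\big]$, and for a dataset $Z=\{(S_i,y_i)\}_{i=1}^N$ put $L_Z(w)=\frac1N\sum_i(y_i-\langle w,\phi_{\rm SK}(S_i)\rangle)^2/2$. Kernel ridge regression with hyperparameters $B^2,\lambda$ outputs $w_Z^\ast={\rm argmin}_{\|w\|^2\le B^2}\big(L_Z(w)+\lambda\|w\|^2\big)$. **Theorem.** Assume $2/\gamma\ge1$ and $mp/\tau\ge1$. Let $\epsilon\in(0,\|g\|_1)$, $\delta=\xi\log(2\|g\|_1mp/\epsilon)$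 and $\beta_g={\rm LFC}(g;\delta)$. Then $p\le\beta_g\le mp$. Let the integers $N,T$ satisfy $$N\ge\frac{600}{\epsilon^4}\|g\|_1^4\exp(\tau\exp(5\gamma))\Big(\frac{2m^2p^2}{\tau\gamma}\Big)^{mp}n^{mp-\beta_g},$$ $$T\ge\frac{256}{3\epsilon^2}\|g\|_1^2\,12^m(mp)^2\log\Big[\frac{\|g\|_1^2\,2^{m+5}mp\,(3^{m^2p}+1)^2}{\epsilon^2}\Big],$$ and set $B^2=\|g\|_1^2\big(2m^2p^2/\tau\gamma\big)^{mp}n^{mp-\beta_g}$ and $\lambda=\epsilon^2/6B^2$. Then $w_Z^\ast$ exists and is unique for every dataset $Z$, the expectations below are well defined, and $$\mathbb E_{Z\sim\mathcal D_S^N}\big[L_{\mathcal D_S}(w_Z^\ast)\big]\le\epsilon^2 .$$ -/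

import Mathlib

open MeasureTheory ProbabilityTheory
open scoped BigOperators ENNReal ComplexOrder

noncomputable section

namespace ShadowLearning

/-! ### The lattice -/

/-- Sites of the `D`-dimensional rectangular lattice with side lengths `L μ` and periodic
boundary conditions. -/
abbrev Site {D : ℕ} (L : Fin D → ℕ) : Type := (μ : Fin D) → ZMod (L μ)

instance siteFintype {D : ℕ} (L : Fin D → ℕ) [∀ μ, NeZero (L μ)] : Fintype (Site L) :=
  Pi.instFintype

/-- The distance on the periodic lattice: the `ℓ¹` distance `∑ |a_μ - b_μ|`, where each difference
is taken around the circle of length `L μ` (the length of a shortest lattice path). -/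
def siteDist {D : ℕ} {L : Fin D → ℕ} (a b : Site L) : ℕ :=
  ∑ μ, (ZMod.valMinAbs (a μ - b μ)).natAbs

lemma siteDist_comm {D : ℕ} {L : Fin D → ℕ} (a b : Site L) : siteDist a b = siteDist b a :=
  Finset.sum_congr rfl fun μ _ => by
    rw [← neg_sub (b μ) (a μ), ZMod.natAbs_valMinAbs_neg]

/-- The distance between two sets of sites. -/
def setDist {D : ℕ} {L : Fin D → ℕ} (A B : Finset (Site L)) : ℕ :=
  sInf {d | ∃ a ∈ A, ∃ b ∈ B, d = siteDist a b}

/-! ### Qubits, Pauli strings and states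

A system of qubits labelled by a finite type `V` has the computational basis `V → Fin 2`. -/

/-- Operators on the qubits labelled by `V`. -/
abbrev Op (V : Type) : Type := Matrix (V → Fin 2) (V → Fin 2) ℂ

/-- The tensor product of one-qubit operators. -/
def tensorOp {V : Type} [Fintype V] [DecidableEq V] (A : V → Matrix (Fin 2) (Fin 2) ℂ) : Op V :=
  Matrix.of fun x y => ∏ v, A v (x v) (y v)

/-- Labels of the one-qubit Pauli matrices (including the identity). -/
inductive Pauli : Type
  | I | X | Y | Z
  deriving DecidableEq

instance pauliFintype : Fintype Pauli :=
  ⟨{.I, .X, .Y, .Z}, fun x => by cases x <;> decide⟩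

/-- The one-qubit Pauli matrices. -/
def Pauli.mat : Pauli → Matrix (Fin 2) (Fin 2) ℂ
  | .I => !![1, 0; 0, 1]
  | .X => !![0, 1; 1, 0]
  | .Y => !![0, -Complex.I; Complex.I, 0]
  | .Z => !![1, 0; 0, -1]

/-- Pauli strings on the qubits labelled by `V`. -/
abbrev PauliString (V : Type) : Type := V → Pauli

/-- The operator of a Pauli string. -/
def PauliString.op {V : Type} [Fintype V] [DecidableEq V] (P : PauliString V) : Op V :=
  tensorOp fun v => (P v).mat

/-- The set of qubits on which a Pauli string acts nontrivially; its cardinality is the weight. -/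
def PauliString.supp {V : Type} [Fintype V] [DecidableEq V] (P : PauliString V) : Finset V :=
  Finset.univ.filter fun v => P v ≠ Pauli.I

/-- Quantum states (density matrices) of the qubits labelled by `V`. -/
structure DensityMatrix (V : Type) [Fintype V] [DecidableEq V] : Type where
  /-- the matrix -/
  mat : Op V
  posSemidef : mat.PosSemidef
  trace_eq_one : mat.trace = 1

/-- The `σ`-algebra on states generated by the matrix entries (the Borel `σ`-algebra). -/
instance densityMatrixMeasurableSpace (V : Type) [Fintype V] [DecidableEq V] :
    MeasurableSpace (DensityMatrix V) :=
  MeasurableSpace.comap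
    (fun ρ : DensityMatrix V => fun xy : (V → Fin 2) × (V → Fin 2) => ρ.mat xy.1 xy.2)
    inferInstance

/-- The expectation value `⟨O⟩ = tr(O ρ)`. -/
def expVal {V : Type} [Fintype V] [DecidableEq V] (ρ : DensityMatrix V) (O : Op V) : ℂ := (O * ρ.mat).trace

/-- The (real) expectation value `tr(P ρ)` of a Pauli string. -/
def pauliExp {V : Type} [Fintype V] [DecidableEq V] (ρ : DensityMatrix V) (P : PauliString V) : ℝ :=
  (expVal ρ P.op).re

/-- The operator `O` acts on the subsystem `A`, i.e. `O = M ⊗ 1` with `M` an operator on `A`. -/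
def ActsOn {V : Type} (A : Finset V) (O : Op V) : Prop :=
  ∃ M : Op A,
    (∀ x y : V → Fin 2, (∀ v, v ∉ A → x v = y v) → O x y = M (fun v => x v) (fun v => y v)) ∧
    (∀ x y : V → Fin 2, ¬ (∀ v, v ∉ A → x v = y v) → O x y = 0)

/-- The spectral norm of an operator (the operator norm on the Euclidean space). -/
def specNorm {V : Type} [Fintype V] [DecidableEq V] (O : Op V) : ℝ :=
  ‖Matrix.toEuclideanCLM (n := V → Fin 2) (𝕜 := ℂ) O‖

/-- The exponential clustering property with correlation length at most `ξ`. -/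
def ExpClustering {D : ℕ} {L : Fin D → ℕ} [∀ μ, NeZero (L μ)] (ξ : ℝ)
    (ρ : DensityMatrix (Site L)) : Prop :=
  ∀ (A B : Finset (Site L)) (OA OB : Op (Site L)),
    OA.IsHermitian → OB.IsHermitian → ActsOn A OA → ActsOn B OB →
      ‖expVal ρ (OA * OB) - expVal ρ OA * expVal ρ OB‖ ≤
        specNorm OA * specNorm OB * Real.exp (-(setDist A B : ℝ) / ξ)

/-- The translation operator by one site in the direction `μ`: it maps the basis state `y` to the
basis state whose value at the site `a` is the value of `y` at `a - e_μ`. -/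
def translationOp {D : ℕ} {L : Fin D → ℕ} [∀ μ, NeZero (L μ)] (μ : Fin D) : Op (Site L) :=
  Matrix.of fun x y => if x = fun a => y (a - Pi.single μ 1) then 1 else 0

/-- Translation symmetry `T_μ ρ T_μ† = ρ` in all directions. -/
def TranslationSymmetric {D : ℕ} {L : Fin D → ℕ} [∀ μ, NeZero (L μ)]
    (ρ : DensityMatrix (Site L)) : Prop :=
  ∀ μ : Fin D, translationOp μ * ρ.mat * (translationOp μ).conjTranspose = ρ.mat

/-! ### Polynomials in the state -/

/-- An expression `g(ρ) = ∑_i c_i ∏_{j=1}^p tr(P_{ij} ρ)`. -/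
structure PauliPolynomial (V : Type) (p : ℕ) : Type where
  /-- the number of terms -/
  numTerms : ℕ
  /-- the coefficients `c_i` -/
  coeff : Fin numTerms → ℝ
  /-- the Pauli strings `P_{ij}` -/
  str : Fin numTerms → Fin p → PauliString V

namespace PauliPolynomial

variable {V : Type} {p : ℕ}

/-- The value `g(ρ)`. -/
def eval [Fintype V] [DecidableEq V] (g : PauliPolynomial V p) (ρ : DensityMatrix V) : ℝ :=
  ∑ i, g.coeff i * ∏ j, pauliExp ρ (g.str i j)

/-- The norm `‖g‖₁ = ∑_i |c_i|`. -/
def norm1 (g : PauliPolynomial V p) : ℝ := ∑ i, |g.coeff i|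

/-- All Pauli strings of `g` have weight at most `m`. -/
def IsBody [Fintype V] [DecidableEq V] (m : ℕ) (g : PauliPolynomial V p) : Prop :=
  ∀ i j, (g.str i j).supp.card ≤ m

end PauliPolynomial

/-- The graph on the support of `P` joining two sites when their distance is at most `δ`. -/
def clusterGraph {D : ℕ} {L : Fin D → ℕ} [∀ μ, NeZero (L μ)] (δ : ℝ)
    (P : PauliString (Site L)) : SimpleGraph P.supp where
  Adj a b := a ≠ b ∧ (siteDist a.1 b.1 : ℝ) ≤ δ
  symm := ⟨fun a b h => ⟨h.1.symm, by rw [siteDist_comm]; exact h.2⟩⟩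
  loopless := ⟨fun _ h => h.1 rfl⟩

open Classical in
/-- The partial Pauli string of `P` acting on the cluster `Q` (a connected component). -/
def clusterString {D : ℕ} {L : Fin D → ℕ} [∀ μ, NeZero (L μ)] (δ : ℝ)
    (P : PauliString (Site L)) (Q : (clusterGraph δ P).ConnectedComponent) :
    PauliString (Site L) :=
  fun a => if ∃ h : a ∈ P.supp, (clusterGraph δ P).connectedComponentMk ⟨a, h⟩ = Q
    then P a else Pauli.I

open Classical in
/-- The multiset `𝒫_i = {P_{ijk}}_{j,k}` of the Pauli strings in the `i`-th term
`c_i ∏_j ∏_k tr(P_{ijk} ρ)` of the `δ`-cluster approximation of `g`. -/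
def clusterFactors {D : ℕ} {L : Fin D → ℕ} [∀ μ, NeZero (L μ)] {p : ℕ} (δ : ℝ)
    (g : PauliPolynomial (Site L) p) (i : Fin g.numTerms) : Multiset (PauliString (Site L)) :=
  ∑ j, (Finset.univ : Finset (clusterGraph δ (g.str i j)).ConnectedComponent).val.map
    (clusterString δ (g.str i j))

/-- The local-factor count `LFC(g; δ) = max(p, min_i |𝒫_i|)`. -/
def localFactorCount {D : ℕ} {L : Fin D → ℕ} [∀ μ, NeZero (L μ)] {p : ℕ} (δ : ℝ)
    (g : PauliPolynomial (Site L) p) : ℕ :=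
  max p (⨅ i, (clusterFactors δ g i).card)

/-! ### Classical shadows -/

/-- The measurement bases of a qubit. -/
inductive MeasBasis : Type
  | X | Y | Z
  deriving DecidableEq

instance measBasisFintype : Fintype MeasBasis :=
  ⟨{.X, .Y, .Z}, fun x => by cases x <;> decide⟩

/-- The observable of a measurement basis. -/
def MeasBasis.mat : MeasBasis → Matrix (Fin 2) (Fin 2) ℂ
  | .X => Pauli.mat .X
  | .Y => Pauli.mat .Y
  | .Z => Pauli.mat .Z

/-- The record of one measurement round: for every qubit, the basis `W` and the outcome `±1`. -/
abbrev Round (V : Type) : Type := V → MeasBasis × ℤˣ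

/-- A classical shadow of size `T`: the records of `T` rounds. -/
def Shadow (V : Type) (T : ℕ) : Type := Fin T → Round V

instance shadowFintype (V : Type) [Fintype V] [DecidableEq V] (T : ℕ) : Fintype (Shadow V T) :=
  inferInstanceAs (Fintype (Fin T → Round V))

instance shadowMeasurableSpace (V : Type) (T : ℕ) : MeasurableSpace (Shadow V T) := ⊤

instance shadowDiscrete (V : Type) (T : ℕ) : DiscreteMeasurableSpace (Shadow V T) := ⟨fun _ => trivial⟩

/-- The projector `(1 + o W)/2` of the outcome `o` of a measurement in the basis `W`. -/
def outcomeProj (c : MeasBasis × ℤˣ) : Matrix (Fin 2) (Fin 2) ℂ :=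
  (1 / 2 : ℂ) • (1 + ((c.2 : ℤ) : ℂ) • c.1.mat)

/-- The probability of the record `r` in one round: the bases are independent and uniform, the
outcomes follow the Born rule. -/
def roundProb {V : Type} [Fintype V] [DecidableEq V] (ρ : DensityMatrix V) (r : Round V) : ℝ :=
  (1 / 3 : ℝ) ^ Fintype.card V * (expVal ρ (tensorOp fun v => outcomeProj (r v))).re

/-- The probability of a classical shadow: the rounds are independent. -/
def shadowProb {V : Type} [Fintype V] [DecidableEq V] {T : ℕ} (ρ : DensityMatrix V) (S : Shadow V T) : ℝ :=
  ∏ t, roundProb ρ (S t)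

/-- The one-qubit snapshot `σ = (3 o W + 1)/2`. -/
def snapshot (c : MeasBasis × ℤˣ) : Matrix (Fin 2) (Fin 2) ℂ :=
  (1 / 2 : ℂ) • ((3 * ((c.2 : ℤ) : ℂ)) • c.1.mat + 1)

lemma outcomeProj_conjTranspose (c : MeasBasis × ℤˣ) :
    (outcomeProj c).conjTranspose = outcomeProj c := by
  obtain ⟨W, o⟩ := c
  rcases Int.units_eq_one_or o with rfl | rfl <;> cases W <;> ext i j <;> fin_cases i <;>
    fin_cases j <;> simp [outcomeProj, MeasBasis.mat, Pauli.mat, Matrix.conjTranspose_apply] <;> ring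

lemma measBasis_mat_sq (W : MeasBasis) : W.mat * W.mat = 1 := by
  cases W <;> ext i j <;> fin_cases i <;> fin_cases j <;>
    simp [MeasBasis.mat, Pauli.mat, Matrix.mul_apply, Fin.sum_univ_two]

lemma outcomeProj_mul_self (c : MeasBasis × ℤˣ) :
    outcomeProj c * outcomeProj c = outcomeProj c := by
  obtain ⟨W, o⟩ := c
  have ho : ((o : ℤ) : ℂ) * ((o : ℤ) : ℂ) = 1 := by
    rcases Int.units_eq_one_or o with rfl | rfl <;> simp
  have h : (((o : ℤ) : ℂ) • W.mat) * (((o : ℤ) : ℂ) • W.mat) = 1 := by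
    rw [Matrix.smul_mul, Matrix.mul_smul, smul_smul, ho, measBasis_mat_sq, one_smul]
  simp only [outcomeProj]
  generalize ((o : ℤ) : ℂ) • W.mat = M at h
  simp only [Matrix.smul_mul, Matrix.mul_smul, add_mul, mul_add, one_mul, mul_one, h]
  module

lemma sum_outcomeProj :
    ∑ c : MeasBasis × ℤˣ, outcomeProj c = (3 : ℂ) • (1 : Matrix (Fin 2) (Fin 2) ℂ) := by
  have h : ∀ f : MeasBasis → Matrix (Fin 2) (Fin 2) ℂ, ∑ W, f W = f .X + f .Y + f .Z := by
    intro f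
    have : (Finset.univ : Finset MeasBasis) = {.X, .Y, .Z} := rfl
    rw [this]
    simp [add_assoc]
  rw [Fintype.sum_prod_type, h]
  ext i j
  fin_cases i <;> fin_cases j <;>
    simp [outcomeProj, MeasBasis.mat, Pauli.mat] <;> norm_num

lemma tensorOp_mul {V : Type} [Fintype V] [DecidableEq V] (A B : V → Matrix (Fin 2) (Fin 2) ℂ) :
    tensorOp A * tensorOp B = tensorOp fun v => A v * B v := by
  ext x y
  simp only [tensorOp, Matrix.mul_apply, Matrix.of_apply, ← Finset.prod_mul_distrib]
  rw [Finset.prod_univ_sum]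
  simp

lemma tensorOp_trace {V : Type} [Fintype V] [DecidableEq V] (A : V → Matrix (Fin 2) (Fin 2) ℂ) :
    (tensorOp A).trace = ∏ v, (A v).trace := by
  simp only [tensorOp, Matrix.trace, Matrix.diag_apply, Matrix.of_apply]
  rw [Finset.prod_univ_sum]
  simp

lemma roundProb_nonneg {V : Type} [Fintype V] [DecidableEq V] (ρ : DensityMatrix V)
    (r : Round V) : 0 ≤ roundProb ρ r := by
  refine mul_nonneg (by positivity) ?_
  set Q : Op V := tensorOp fun v => outcomeProj (r v) with hQ
  have h1 : Q * Q = Q := by simp only [hQ, tensorOp_mul, outcomeProj_mul_self]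
  have h2 : Q.conjTranspose = Q := by
    ext x y
    have := fun v => congrFun (congrFun (outcomeProj_conjTranspose (r v)) (x v)) (y v)
    simp only [Matrix.conjTranspose_apply] at this
    simp only [hQ, tensorOp, Matrix.conjTranspose_apply, Matrix.of_apply, star_prod, this]
  have h3 := (ρ.posSemidef.mul_mul_conjTranspose_same Q).trace_nonneg
  rw [h2, Matrix.trace_mul_comm, ← mul_assoc, h1] at h3
  exact (Complex.le_def.1 h3).1

lemma sum_roundProb {V : Type} [Fintype V] [DecidableEq V] (ρ : DensityMatrix V) :
    ∑ r, roundProb ρ r = 1 := by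
  have h : ∑ r : Round V, tensorOp (fun v => outcomeProj (r v)) =
      ((3 : ℂ) ^ Fintype.card V) • (1 : Op V) := by
    ext x y
    have h1 : ∏ v, (∑ c : MeasBasis × ℤˣ, outcomeProj c) (x v) (y v) =
        ∑ r : Round V, ∏ v, outcomeProj (r v) (x v) (y v) := by
      simp only [Matrix.sum_apply]
      rw [Finset.prod_univ_sum]
      simp
    rw [Matrix.sum_apply]
    simp only [tensorOp, Matrix.of_apply]
    rw [← h1, sum_outcomeProj]
    simp only [Matrix.smul_apply, smul_eq_mul, Finset.prod_mul_distrib, Finset.prod_const,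
      Finset.card_univ, Matrix.one_apply]
    congr 1
    by_cases hxy : x = y
    · simp [hxy]
    · obtain ⟨v, hv⟩ := Function.ne_iff.1 hxy
      simp only [hxy, if_false]
      exact Finset.prod_eq_zero (Finset.mem_univ v) (by simp [hv])
  simp only [roundProb, ← Finset.mul_sum, expVal]
  rw [← Complex.re_sum, ← Matrix.trace_sum, ← Finset.sum_mul, h, Matrix.smul_mul, one_mul,
    Matrix.trace_smul, ρ.trace_eq_one]
  have : ((3 : ℂ) ^ Fintype.card V • (1 : ℂ)).re = (3 : ℝ) ^ Fintype.card V := by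
    rw [smul_eq_mul, mul_one]
    exact_mod_cast Complex.ofReal_re ((3 : ℝ) ^ Fintype.card V)
  rw [this, ← mul_pow]
  norm_num

lemma shadowProb_nonneg {V : Type} [Fintype V] [DecidableEq V] {T : ℕ} (ρ : DensityMatrix V)
    (S : Shadow V T) : 0 ≤ shadowProb ρ S :=
  Finset.prod_nonneg fun _ _ => roundProb_nonneg ρ _

lemma sum_shadowProb {V : Type} [Fintype V] [DecidableEq V] (T : ℕ) (ρ : DensityMatrix V) :
    ∑ S : Shadow V T, shadowProb ρ S = 1 := by
  have h : ∏ _t : Fin T, ∑ r : Round V, roundProb ρ r =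
      ∑ S : Fin T → Round V, ∏ t, roundProb ρ (S t) := by
    rw [Finset.prod_univ_sum]
    simp
  simp only [sum_roundProb, Finset.prod_const_one] at h
  exact h.symm

lemma measurable_entry {V : Type} [Fintype V] [DecidableEq V] (x y : V → Fin 2) :
    Measurable fun ρ : DensityMatrix V => ρ.mat x y := by
  have h : Measurable
      (fun ρ : DensityMatrix V => fun xy : (V → Fin 2) × (V → Fin 2) => ρ.mat xy.1 xy.2) :=
    comap_measurable _
  exact (measurable_pi_apply (x, y)).comp h

lemma measurable_expVal {V : Type} [Fintype V] [DecidableEq V] (O : Op V) :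
    Measurable fun ρ : DensityMatrix V => expVal ρ O := by
  simp only [expVal, Matrix.trace, Matrix.diag_apply, Matrix.mul_apply]
  exact Finset.measurable_sum _ fun _ _ => Finset.measurable_sum _ fun _ _ =>
    (measurable_entry _ _).const_mul _

lemma measurable_shadowProb {V : Type} [Fintype V] [DecidableEq V] {T : ℕ} (S : Shadow V T) :
    Measurable fun ρ : DensityMatrix V => shadowProb ρ S :=
  Finset.measurable_prod _ fun _ _ =>
    (Complex.measurable_re.comp (measurable_expVal _)).const_mul _

lemma measurable_eval {V : Type} [Fintype V] [DecidableEq V] {p : ℕ} (g : PauliPolynomial V p) :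
    Measurable g.eval :=
  Finset.measurable_sum _ fun _ _ =>
    (Finset.measurable_prod _ fun _ _ =>
      Complex.measurable_re.comp (measurable_expVal _)).const_mul _

/-- The distribution `𝒟_ρ` of classical shadows of size `T` of the state `ρ`, as a kernel. -/
def shadowKernelLaw (V : Type) [Fintype V] [DecidableEq V] (T : ℕ) :
    Kernel (DensityMatrix V) (Shadow V T) where
  toFun ρ := ∑ S, ENNReal.ofReal (shadowProb ρ S) • Measure.dirac S
  measurable' := by
    refine Measure.measurable_of_measurable_coe _ fun s hs => ?_
    simp only [Measure.finsetSum_apply, Measure.smul_apply, smul_eq_mul]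
    exact Finset.measurable_sum _ fun S _ =>
      (measurable_shadowProb S).ennreal_ofReal.mul_const _

instance shadowKernelLaw_isMarkov (V : Type) [Fintype V] [DecidableEq V] (T : ℕ) :
    IsMarkovKernel (shadowKernelLaw V T) where
  isProbabilityMeasure ρ := ⟨by
    change (∑ S, ENNReal.ofReal (shadowProb ρ S) • Measure.dirac S : Measure (Shadow V T))
      Set.univ = 1
    simp only [Measure.finsetSum_apply, Measure.smul_apply, smul_eq_mul, measure_univ, mul_one]
    rw [← ENNReal.ofReal_sum_of_nonneg fun S _ => shadowProb_nonneg ρ S, sum_shadowProb,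
      ENNReal.ofReal_one]⟩

/-- The data distribution `𝒟_S`: the law of `(S_T(ρ), g(ρ))` when the state `ρ` has the law `μ` and
`S_T(ρ)` is then drawn from `𝒟_ρ`. -/
def dataLaw {V : Type} [Fintype V] [DecidableEq V] {p : ℕ} (T : ℕ)
    (μ : Measure (DensityMatrix V)) (g : PauliPolynomial V p) : Measure (Shadow V T × ℝ) :=
  (μ.compProd (shadowKernelLaw V T)).map fun q => (q.2, g.eval q.1)

instance dataLaw_isProbabilityMeasure {V : Type} [Fintype V] [DecidableEq V] {p : ℕ} (T : ℕ)
    (μ : Measure (DensityMatrix V)) [IsProbabilityMeasure μ] (g : PauliPolynomial V p) :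
    IsProbabilityMeasure (dataLaw T μ g) :=
  Measure.isProbabilityMeasure_map
    (measurable_snd.prodMk ((measurable_eval g).comp measurable_fst)).aemeasurable

/-! ### The shadow kernel and its feature space -/

/-- The shadow kernel with hyperparameters `τ` and `γ`. -/
def shadowKernel {V : Type} [Fintype V] [DecidableEq V] {T : ℕ} (τ γ : ℝ) (S S' : Shadow V T) : ℝ :=
  Real.exp (τ / (T : ℝ) ^ 2 * ∑ t, ∑ t',
    Real.exp (γ / (Fintype.card V : ℝ) * ∑ v, ((snapshot (S t v) * snapshot (S' t' v)).trace).re))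

/-- The estimate `σ_{(i_1, …, i_r)} = (1/T) ∑_t σ_{i_1}^{(t)} ⊗ ⋯ ⊗ σ_{i_r}^{(t)}` of a reduced density
matrix; the labels may be repeated. -/
def reducedShadow {V : Type} {T r : ℕ} (S : Shadow V T) (i : Fin r → V) : Op (Fin r) :=
  (1 / (T : ℂ)) • ∑ t, tensorOp fun l => snapshot (S t (i l))

/-- Indices of the components of `⨁_r ⨁_{i_1, …, i_r} vec(σ_{(i_1, …, i_r)})`: the labels and a Pauli
string on `r` qubits. -/
abbrev LocalIndex (V : Type) : Type := (r : ℕ) × (Fin r → V) × PauliString (Fin r)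

/-- The components of
`⨁_r √((1/r!) (γ/n)^r) ⨁_{i_1, …, i_r} vec(σ_{(i_1, …, i_r)})`, with `vec(σ)_P = tr(P σ)/√(2^r)`. -/
def localFeature {V : Type} [Fintype V] [DecidableEq V] {T : ℕ} (γ : ℝ) (S : Shadow V T) (a : LocalIndex V) : ℝ :=
  Real.sqrt (1 / (a.1.factorial : ℝ) * (γ / (Fintype.card V : ℝ)) ^ a.1) *
    (((PauliString.op a.2.2 * reducedShadow S a.2.1).trace).re / Real.sqrt (2 ^ a.1))

/-- Indices of the components of the feature vector: a tensor power `d` and `d` local indices. -/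
abbrev FeatureIndex (V : Type) : Type := (d : ℕ) × (Fin d → LocalIndex V)

/-- The components of `⨁_d √(τ^d/d!) (⨁_r ⋯)^{⊗ d}`. -/
def featureComponent {V : Type} [Fintype V] [DecidableEq V] {T : ℕ} (τ γ : ℝ) (S : Shadow V T)
    (a : FeatureIndex V) : ℝ :=
  Real.sqrt (τ ^ a.1 / (a.1.factorial : ℝ)) * ∏ k, localFeature γ S (a.2 k)

/-- The feature space of the shadow kernel: square-summable real families. -/
abbrev FeatureSpace (V : Type) : Type := lp (fun _ : FeatureIndex V => ℝ) 2

/-! The components are square-summable, and the feature map reproduces the kernel. -/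

/-- The real number `tr(Q σ)` for a one-qubit snapshot `σ`. -/
def snapshotExp (Q : Pauli) (c : MeasBasis × ℤˣ) : ℝ := ((Q.mat * snapshot c).trace).re

lemma trace_mul_two (M N : Matrix (Fin 2) (Fin 2) ℂ) :
    (M * N).trace = M 0 0 * N 0 0 + M 0 1 * N 1 0 + (M 1 0 * N 0 1 + M 1 1 * N 1 1) := by
  simp only [Matrix.trace_fin_two, Matrix.mul_apply, Fin.sum_univ_two]

lemma trace_pauli_snapshot (Q : Pauli) (c : MeasBasis × ℤˣ) :
    (Q.mat * snapshot c).trace = (snapshotExp Q c : ℂ) := by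
  obtain ⟨W, o⟩ := c
  refine (Complex.conj_eq_iff_re.1 ?_).symm
  rw [trace_mul_two]
  rcases Int.units_eq_one_or o with rfl | rfl <;> cases W <;> cases Q <;>
    simp [snapshot, MeasBasis.mat, Pauli.mat, Complex.conj_ofNat]

lemma sum_trace_pauli (M N : Matrix (Fin 2) (Fin 2) ℂ) :
    ∑ Q : Pauli, (Q.mat * M).trace * (Q.mat * N).trace / 2 = (M * N).trace := by
  have h : ∀ f : Pauli → ℂ, ∑ Q, f Q = f .I + f .X + f .Y + f .Z := by
    intro f
    have : (Finset.univ : Finset Pauli) = {.I, .X, .Y, .Z} := rfl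
    rw [this]
    simp [add_assoc]
  rw [h]
  simp only [trace_mul_two, Pauli.mat, Matrix.of_apply, Matrix.cons_val', Matrix.cons_val_zero,
    Matrix.cons_val_one, Matrix.cons_val_fin_one]
  linear_combination (M 1 0 * N 1 0 + M 0 1 * N 0 1 - M 0 1 * N 1 0 - M 1 0 * N 0 1) / 2 *
    Complex.I_sq

lemma sum_snapshotExp (c c' : MeasBasis × ℤˣ) :
    ∑ Q, snapshotExp Q c * snapshotExp Q c' / 2 = ((snapshot c * snapshot c').trace).re := by
  rw [← sum_trace_pauli, Complex.re_sum]
  refine Finset.sum_congr rfl fun Q _ => ?_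
  rw [trace_pauli_snapshot, trace_pauli_snapshot]
  exact_mod_cast (Complex.ofReal_re _).symm

lemma trace_pauli_reducedShadow {V : Type} {T r : ℕ} (S : Shadow V T) (i : Fin r → V)
    (P : PauliString (Fin r)) :
    ((PauliString.op P * reducedShadow S i).trace).re =
      1 / (T : ℝ) * ∑ t, ∏ l, snapshotExp (P l) (S t (i l)) := by
  have h : (PauliString.op P * reducedShadow S i).trace =
      ((1 / (T : ℝ) * ∑ t, ∏ l, snapshotExp (P l) (S t (i l)) : ℝ) : ℂ) := by
    simp only [reducedShadow, PauliString.op, Matrix.mul_smul, Matrix.mul_sum, tensorOp_mul,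
      Matrix.trace_smul, Matrix.trace_sum, tensorOp_trace, trace_pauli_snapshot, smul_eq_mul]
    push_cast
    rfl
  rw [h, Complex.ofReal_re]

/-- `tr(σ_v^{(t)} σ̃_v^{(t')})`, averaged over the qubits and scaled by `γ`. -/
def roundOverlap {V : Type} [Fintype V] [DecidableEq V] (γ : ℝ) (r r' : Round V) : ℝ :=
  γ / (Fintype.card V : ℝ) * ∑ v, ((snapshot (r v) * snapshot (r' v)).trace).re

lemma sum_localFeature {V : Type} [Fintype V] [DecidableEq V] {T : ℕ} {γ : ℝ} (hγ : 0 ≤ γ)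
    (S S' : Shadow V T) (r : ℕ) :
    ∑ b : (Fin r → V) × PauliString (Fin r),
        localFeature γ S ⟨r, b⟩ * localFeature γ S' ⟨r, b⟩ =
      1 / (T : ℝ) ^ 2 * ∑ t, ∑ t', roundOverlap γ (S t) (S' t') ^ r / (r.factorial : ℝ) := by
  set w : ℝ := 1 / (r.factorial : ℝ) * (γ / (Fintype.card V : ℝ)) ^ r with hw
  have hw0 : 0 ≤ w := by positivity
  have h1 : ∀ b : (Fin r → V) × PauliString (Fin r),
      localFeature γ S ⟨r, b⟩ * localFeature γ S' ⟨r, b⟩ =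
        w * (1 / (T : ℝ) ^ 2) * ∑ t, ∑ t', ∏ l,
          (snapshotExp (b.2 l) (S t (b.1 l)) * snapshotExp (b.2 l) (S' t' (b.1 l)) / 2) := by
    intro b
    simp only [localFeature, trace_pauli_reducedShadow, ← hw, Finset.prod_div_distrib,
      Finset.prod_mul_distrib, ← Finset.sum_div, ← Finset.mul_sum, ← Finset.sum_mul,
      Finset.prod_const, Finset.card_univ, Fintype.card_fin]
    have e1 : Real.sqrt w * Real.sqrt w = w := Real.mul_self_sqrt hw0
    have e2 : Real.sqrt ((2 : ℝ) ^ r) * Real.sqrt ((2 : ℝ) ^ r) = 2 ^ r :=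
      Real.mul_self_sqrt (by positivity)
    have e3 : ∀ a b x y q q' : ℝ, a * (x / q) * (a * (y / q)) = (a * a) * ((x * y) / (q * q)) := by
      intros; rw [← mul_div_assoc, ← mul_div_assoc, div_mul_div_comm, ← mul_div_assoc]; ring
    rw [e3 _ 0 _ _ _ 0, e1, e2]
    ring
  have h2 : ∀ t t' : Fin T, ∑ b : (Fin r → V) × PauliString (Fin r), ∏ l,
      (snapshotExp (b.2 l) (S t (b.1 l)) * snapshotExp (b.2 l) (S' t' (b.1 l)) / 2) =
      (∑ v, ((snapshot (S t v) * snapshot (S' t' v)).trace).re) ^ r := by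
    intro t t'
    rw [Fintype.sum_prod_type]
    have h3 : ∀ i : Fin r → V, ∑ P : PauliString (Fin r), ∏ l,
        (snapshotExp (P l) (S t (i l)) * snapshotExp (P l) (S' t' (i l)) / 2) =
        ∏ l, ((snapshot (S t (i l)) * snapshot (S' t' (i l))).trace).re := by
      intro i
      simp only [← sum_snapshotExp]
      rw [Finset.prod_univ_sum]
      simp
    simp only [h3]
    rw [← Fin.prod_const, Finset.prod_univ_sum]
    simp
  simp only [h1, ← Finset.mul_sum]
  rw [Finset.sum_comm]
  have h4 : ∀ t : Fin T, ∑ b : (Fin r → V) × PauliString (Fin r), ∑ t', ∏ l,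
      (snapshotExp (b.2 l) (S t (b.1 l)) * snapshotExp (b.2 l) (S' t' (b.1 l)) / 2) =
      ∑ t', (∑ v, ((snapshot (S t v) * snapshot (S' t' v)).trace).re) ^ r := by
    intro t
    rw [Finset.sum_comm]
    simp only [h2]
  simp only [h4]
  rw [Finset.mul_sum, Finset.mul_sum]
  refine Finset.sum_congr rfl fun t _ => ?_
  rw [Finset.mul_sum, Finset.mul_sum]
  refine Finset.sum_congr rfl fun t' _ => ?_
  rw [roundOverlap, mul_pow, hw]
  ring

lemma hasSum_sigma_mul {β : ℕ → Type} {u v : (Σ r, β r) → ℝ} {A B C : ℕ → ℝ} {c : ℝ}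
    (hu : ∀ r, HasSum (fun b => u ⟨r, b⟩ * u ⟨r, b⟩) (A r))
    (hv : ∀ r, HasSum (fun b => v ⟨r, b⟩ * v ⟨r, b⟩) (B r))
    (huv : ∀ r, HasSum (fun b => u ⟨r, b⟩ * v ⟨r, b⟩) (C r))
    (hA : Summable A) (hB : Summable B) (hC : HasSum C c) :
    HasSum (fun a => u a * v a) c := by
  have key : ∀ {w : (Σ r, β r) → ℝ} {E : ℕ → ℝ},
      (∀ r, HasSum (fun b => w ⟨r, b⟩ * w ⟨r, b⟩) (E r)) → Summable E →
        Summable fun a => w a * w a := by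
    intro w E hw hE
    rw [summable_sigma_of_nonneg fun a => mul_self_nonneg (w a)]
    refine ⟨fun r => (hw r).summable, ?_⟩
    have : (fun r => ∑' b, w ⟨r, b⟩ * w ⟨r, b⟩) = E := funext fun r => (hw r).tsum_eq
    rw [this]
    exact hE
  have hs : Summable fun a => u a * v a := by
    refine Summable.of_norm_bounded ((key hu hA).add (key hv hB)) fun a => ?_
    rw [Real.norm_eq_abs, abs_le]
    constructor <;> nlinarith [sq_nonneg (u a + v a), sq_nonneg (u a - v a), sq_nonneg (u a),
      sq_nonneg (v a)]
  exact HasSum.sigma_of_hasSum hC huv hs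

lemma hasSum_pi_pow {ι : Type} {f : ι → ℝ} {a : ℝ} (hf : HasSum f a) (d : ℕ) :
    HasSum (fun k : Fin d → ι => ∏ j, f (k j)) (a ^ d) := by
  induction d with
  | zero =>
    simp
  | succ d ih =>
    have hs : Summable fun x : ι × (Fin d → ι) => f x.1 * ∏ j, f (x.2 j) :=
      summable_mul_of_summable_norm (f := f) (g := fun k : Fin d → ι => ∏ j, f (k j))
        hf.summable.norm ih.summable.norm
    have h := hf.mul ih hs
    rw [← (Fin.consEquiv fun _ : Fin (d + 1) => ι).hasSum_iff, pow_succ']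
    have e : (fun k : Fin (d + 1) → ι => ∏ j, f (k j)) ∘ (Fin.consEquiv fun _ : Fin (d + 1) => ι) =
        fun x : ι × (Fin d → ι) => f x.1 * ∏ j, f (x.2 j) := by
      funext x
      simp only [Function.comp_apply, Fin.prod_univ_succ]
      rfl
    rw [e]
    exact h

/-- The kernel of the local features: `(1/T²) ∑_{t,t'} exp((γ/n) ∑_v tr(σ_v^{(t)} σ̃_v^{(t')}))`. -/
def localKernel {V : Type} [Fintype V] [DecidableEq V] {T : ℕ} (γ : ℝ) (S S' : Shadow V T) : ℝ :=
  1 / (T : ℝ) ^ 2 * ∑ t, ∑ t', Real.exp (roundOverlap γ (S t) (S' t'))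

lemma hasSum_exp_series (x : ℝ) : HasSum (fun r : ℕ => x ^ r / (r.factorial : ℝ)) (Real.exp x) := by
  rw [Real.exp_eq_exp_ℝ]
  exact NormedSpace.expSeries_div_hasSum_exp x

lemma hasSum_localFeature {V : Type} [Fintype V] [DecidableEq V] {T : ℕ} {γ : ℝ} (hγ : 0 ≤ γ)
    (S S' : Shadow V T) :
    HasSum (fun a => localFeature γ S a * localFeature γ S' a) (localKernel γ S S') := by
  have h1 : ∀ (S S' : Shadow V T) (r : ℕ),
      HasSum (fun b => localFeature γ S ⟨r, b⟩ * localFeature γ S' ⟨r, b⟩)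
        (1 / (T : ℝ) ^ 2 * ∑ t, ∑ t', roundOverlap γ (S t) (S' t') ^ r / (r.factorial : ℝ)) := by
    intro S S' r
    rw [← sum_localFeature hγ]
    exact hasSum_fintype _
  have h2 : ∀ S S' : Shadow V T,
      HasSum (fun r : ℕ =>
        1 / (T : ℝ) ^ 2 * ∑ t, ∑ t', roundOverlap γ (S t) (S' t') ^ r / (r.factorial : ℝ))
        (localKernel γ S S') := fun S S' =>
    (hasSum_sum fun t _ => hasSum_sum fun t' _ => hasSum_exp_series _).mul_left _
  exact hasSum_sigma_mul (h1 S S) (h1 S' S') (h1 S S') (h2 S S).summable (h2 S' S').summable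
    (h2 S S')

lemma hasSum_featureComponent {V : Type} [Fintype V] [DecidableEq V] {T : ℕ} {τ γ : ℝ}
    (hτ : 0 ≤ τ) (hγ : 0 ≤ γ) (S S' : Shadow V T) :
    HasSum (fun a => featureComponent τ γ S a * featureComponent τ γ S' a)
      (shadowKernel τ γ S S') := by
  have h1 : ∀ (S S' : Shadow V T) (d : ℕ),
      HasSum (fun b => featureComponent τ γ S ⟨d, b⟩ * featureComponent τ γ S' ⟨d, b⟩)
        ((τ * localKernel γ S S') ^ d / (d.factorial : ℝ)) := by
    intro S S' d
    have h := (hasSum_pi_pow (hasSum_localFeature hγ S S') d).mul_left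
      (τ ^ d / (d.factorial : ℝ))
    have e : (τ * localKernel γ S S') ^ d / (d.factorial : ℝ) =
        τ ^ d / (d.factorial : ℝ) * localKernel γ S S' ^ d := by rw [mul_pow]; ring
    rw [e]
    have e1 : Real.sqrt (τ ^ d / (d.factorial : ℝ)) * Real.sqrt (τ ^ d / (d.factorial : ℝ)) =
        τ ^ d / (d.factorial : ℝ) := Real.mul_self_sqrt (by positivity)
    have e2 : (fun b => featureComponent τ γ S ⟨d, b⟩ * featureComponent τ γ S' ⟨d, b⟩) =
        fun b : Fin d → LocalIndex V => τ ^ d / (d.factorial : ℝ) *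
          ∏ j, localFeature γ S (b j) * localFeature γ S' (b j) := by
      funext b
      simp only [featureComponent]
      rw [mul_mul_mul_comm, e1, Finset.prod_mul_distrib]
    rw [e2]
    exact h
  have h2 : ∀ S S' : Shadow V T,
      HasSum (fun d : ℕ => (τ * localKernel γ S S') ^ d / (d.factorial : ℝ))
        (Real.exp (τ * localKernel γ S S')) := fun S S' => hasSum_exp_series _
  have e : shadowKernel τ γ S S' = Real.exp (τ * localKernel γ S S') := by
    simp only [shadowKernel, localKernel, roundOverlap]
    congr 1
    ring
  rw [e]
  exact hasSum_sigma_mul (h1 S S) (h1 S' S') (h1 S S') (h2 S S).summable (h2 S' S').summable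
    (h2 S S')

lemma memlp_featureComponent {V : Type} [Fintype V] [DecidableEq V] {T : ℕ} {τ γ : ℝ}
    (hτ : 0 ≤ τ) (hγ : 0 ≤ γ) (S : Shadow V T) : Memℓp (featureComponent τ γ S) 2 := by
  refine memℓp_gen ?_
  have h := (hasSum_featureComponent hτ hγ S S).summable
  refine h.congr fun a => ?_
  rw [ENNReal.toReal_ofNat, Real.rpow_two, Real.norm_eq_abs, sq_abs, sq]

/-- The feature vector `φ_SK(S)` of the shadow kernel. -/
def shadowFeature {V : Type} [Fintype V] [DecidableEq V] {T : ℕ} {τ γ : ℝ} (hτ : 0 ≤ τ)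
    (hγ : 0 ≤ γ) (S : Shadow V T) : FeatureSpace V :=
  ⟨featureComponent τ γ S, memlp_featureComponent hτ hγ S⟩

/-- The feature vectors reproduce the shadow kernel. -/
theorem inner_shadowFeature {V : Type} [Fintype V] [DecidableEq V] {T : ℕ} {τ γ : ℝ}
    (hτ : 0 ≤ τ) (hγ : 0 ≤ γ) (S S' : Shadow V T) :
    inner ℝ (shadowFeature hτ hγ S) (shadowFeature hτ hγ S') = shadowKernel τ γ S S' := by
  have h := lp.hasSum_inner (𝕜 := ℝ) (shadowFeature hτ hγ S) (shadowFeature hτ hγ S')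
  refine h.unique ?_
  have e : (fun a => inner ℝ (shadowFeature hτ hγ S a) (shadowFeature hτ hγ S' a)) =
      fun a => featureComponent τ γ S a * featureComponent τ γ S' a :=
    funext fun a => mul_comm (featureComponent τ γ S' a) (featureComponent τ γ S a)
  rw [e]
  exact hasSum_featureComponent hτ hγ S S'

/-! ### Kernel ridge regression -/

/-- The loss `(y - ⟨w, φ(x)⟩)²/2` of a linear model in the feature space `H` on a sample `(x, y)`. -/
def sqLoss {X H : Type*} [NormedAddCommGroup H] [InnerProductSpace ℝ H] (φ : X → H) (w : H)
    (z : X × ℝ) : ℝ :=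
  (z.2 - inner ℝ w (φ z.1)) ^ 2 / 2

/-- The expected loss with respect to the data distribution `P`. -/
def expectedLoss {X H : Type*} [MeasurableSpace X] [NormedAddCommGroup H] [InnerProductSpace ℝ H]
    (φ : X → H) (P : Measure (X × ℝ)) (w : H) : ℝ :=
  ∫ z, sqLoss φ w z ∂P

/-- The empirical loss on a training dataset. -/
def empiricalLoss {X H : Type*} [NormedAddCommGroup H] [InnerProductSpace ℝ H] {N : ℕ}
    (φ : X → H) (Z : Fin N → X × ℝ) (w : H) : ℝ :=
  1 / (N : ℝ) * ∑ i, sqLoss φ w (Z i)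

/-- `w` is an output of kernel ridge regression: it minimizes `L_Z(w) + lam ‖w‖²` subject to
`‖w‖² ≤ Bsq`. -/
def IsRidgeMinimizer {X H : Type*} [NormedAddCommGroup H] [InnerProductSpace ℝ H] {N : ℕ}
    (φ : X → H) (Bsq lam : ℝ) (Z : Fin N → X × ℝ) (w : H) : Prop :=
  IsMinOn (fun v => empiricalLoss φ Z v + lam * ‖v‖ ^ 2) {v | ‖v‖ ^ 2 ≤ Bsq} w ∧ ‖w‖ ^ 2 ≤ Bsq

end ShadowLearning

end

/-! Ridge regression competes with every fixed vector of its ball, so the proof separates a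
statistical statement from an approximation statement.

Statistics. The objective is strongly convex, so replacing one of the N samples moves the minimizer
only slightly. For the squared loss this yields a relative bound: the losses at the exchanged
samples change by at most κ = Ksq/(lam N) times those losses themselves, where Ksq bounds ‖φ‖²
(`ridge_stability`). Exchanging a fresh sample with a training sample preserves the joint law
(`measurePreserving_exchange`), so the mean test loss exceeds the mean training loss by at most κ
times their sum. Comparing the training loss with that of a fixed w₀ gives (1 - κ) E ≤ (1 + κ)(L(w₀)
+ lam ‖w₀‖²), which is `ridge_generalization`.

Approximation (`exists_weight`). By exponential clustering each tr(Pρ) is close to the product of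
the expectations of its δ-clusters, and δ is chosen so that g changes by at most ε/2. Each cluster
expectation is estimated from the shadow, averaged over all n translates; translation symmetry makes
this unbiased. The average is not needed for the variance. It spreads the weight: a product of d
such estimators is ⟨w, φ_SK⟩ with w constant on n^d coordinates. If R is the total weight of the d
strings, then ‖w‖² is of order n^(R - d), so every cluster saves one factor n; this is where the
local-factor count enters (`norm_productWeight_sq_le`). A Hoeffding bound for each estimator and a
deterministic bound on the rare bad event control the mean squared error of the product
(`sum_shadowProb_sq_prod_sub_le`, `product_error_le`).

Budget: the squared cluster error contributes ε²/4, the shadow noise ε²/6 and the penalty lam ‖w₀‖²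
at most ε²/6, in total 7/12 ε². With κ ≤ 1/100 the factor (1 + κ)/(1 - κ) still leaves this below
ε². -/

noncomputable section

namespace ShadowLearning

/-! ### Kernel ridge regression: existence, uniqueness, generalization -/

section Ridge

variable {X H : Type*} [NormedAddCommGroup H] [InnerProductSpace ℝ H] {N : ℕ}

/-- The objective `L_Z(v) + lam ‖v‖²` of ridge regression. -/
def ridgeObjective (φ : X → H) (lam : ℝ) (Z : Fin N → X × ℝ) (v : H) : ℝ :=
  empiricalLoss φ Z v + lam * ‖v‖ ^ 2

lemma sqLoss_nonneg (φ : X → H) (w : H) (z : X × ℝ) : 0 ≤ sqLoss φ w z := by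
  unfold sqLoss; positivity

lemma norm_segment_sq (t : ℝ) (w w' : H) :
    ‖(1 - t) • w + t • w'‖ ^ 2 =
      (1 - t) * ‖w‖ ^ 2 + t * ‖w'‖ ^ 2 - t * (1 - t) * ‖w - w'‖ ^ 2 := by
  simp only [← real_inner_self_eq_norm_sq, inner_add_left, inner_add_right, inner_sub_left,
    inner_sub_right, inner_smul_left, inner_smul_right, real_inner_comm w' w, RCLike.conj_to_real]
  ring

lemma sqLoss_segment_le (φ : X → H) (z : X × ℝ) {t : ℝ} (ht0 : 0 ≤ t) (ht1 : t ≤ 1) (w w' : H) :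
    sqLoss φ ((1 - t) • w + t • w') z ≤ (1 - t) * sqLoss φ w z + t * sqLoss φ w' z := by
  simp only [sqLoss, inner_add_left, inner_smul_left, RCLike.conj_to_real]
  nlinarith [mul_nonneg (mul_nonneg ht0 (sub_nonneg.2 ht1))
    (sq_nonneg (inner ℝ w (φ z.1) - inner ℝ w' (φ z.1)))]

lemma empiricalLoss_segment_le (φ : X → H) (Z : Fin N → X × ℝ) {t : ℝ} (ht0 : 0 ≤ t)
    (ht1 : t ≤ 1) (w w' : H) :
    empiricalLoss φ Z ((1 - t) • w + t • w') ≤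
      (1 - t) * empiricalLoss φ Z w + t * empiricalLoss φ Z w' := by
  have h := Finset.sum_le_sum fun i (_ : i ∈ (Finset.univ : Finset (Fin N))) =>
    sqLoss_segment_le φ (Z i) ht0 ht1 w w'
  rw [Finset.sum_add_distrib, ← Finset.mul_sum, ← Finset.mul_sum] at h
  have h2 := mul_le_mul_of_nonneg_left h (by positivity : (0 : ℝ) ≤ 1 / N)
  simp only [empiricalLoss]
  linarith

lemma ridgeObjective_segment_le (φ : X → H) (lam : ℝ) (Z : Fin N → X × ℝ) {t : ℝ} (ht0 : 0 ≤ t)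
    (ht1 : t ≤ 1) (w w' : H) :
    ridgeObjective φ lam Z ((1 - t) • w + t • w') ≤
      (1 - t) * ridgeObjective φ lam Z w + t * ridgeObjective φ lam Z w' -
        t * (1 - t) * (lam * ‖w - w'‖ ^ 2) := by
  have h := empiricalLoss_segment_le φ Z ht0 ht1 w w'
  simp only [ridgeObjective, norm_segment_sq]
  linarith

lemma norm_segment_sq_le {t : ℝ} (ht0 : 0 ≤ t) (ht1 : t ≤ 1) {w w' : H} {Bsq : ℝ}
    (hw : ‖w‖ ^ 2 ≤ Bsq) (hw' : ‖w'‖ ^ 2 ≤ Bsq) : ‖(1 - t) • w + t • w'‖ ^ 2 ≤ Bsq := by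
  rw [norm_segment_sq]
  nlinarith [mul_nonneg (mul_nonneg ht0 (sub_nonneg.2 ht1)) (sq_nonneg ‖w - w'‖),
    mul_le_mul_of_nonneg_left hw (sub_nonneg.2 ht1), mul_le_mul_of_nonneg_left hw' ht0]

lemma IsRidgeMinimizer.le {φ : X → H} {Bsq lam : ℝ} {Z : Fin N → X × ℝ} {w v : H}
    (hw : IsRidgeMinimizer φ Bsq lam Z w) (hv : ‖v‖ ^ 2 ≤ Bsq) :
    ridgeObjective φ lam Z w ≤ ridgeObjective φ lam Z v :=
  hw.1 hv

/-- Strong convexity of the ridge objective at its minimizer. -/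
lemma IsRidgeMinimizer.strong {φ : X → H} {Bsq lam : ℝ} {Z : Fin N → X × ℝ} {w v : H}
    (hw : IsRidgeMinimizer φ Bsq lam Z w) (hv : ‖v‖ ^ 2 ≤ Bsq) :
    lam * ‖w - v‖ ^ 2 ≤ ridgeObjective φ lam Z v - ridgeObjective φ lam Z w := by
  have key : ∀ t : ℝ, 0 < t → t ≤ 1 →
      (1 - t) * (lam * ‖w - v‖ ^ 2) ≤ ridgeObjective φ lam Z v - ridgeObjective φ lam Z w := by
    intro t ht0 ht1
    have h1 := hw.le (norm_segment_sq_le ht0.le ht1 hw.2 hv)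
    have h2 := ridgeObjective_segment_le φ lam Z ht0.le ht1 w v
    refine le_of_mul_le_mul_left ?_ ht0
    linarith
  -- The inequality just proved carries a factor 1 - t from the segment; this lets t tend to 0, with
  -- t small enough that t q ≤ e.
  refine le_of_forall_pos_le_add fun e he => ?_
  set q := lam * ‖w - v‖ ^ 2 with hq
  have ht : 0 < min 1 (e / (|q| + 1)) := by positivity
  have h := key _ ht (min_le_left _ _)
  have h2 : min 1 (e / (|q| + 1)) * q ≤ e := by
    calc min 1 (e / (|q| + 1)) * q ≤ min 1 (e / (|q| + 1)) * |q| :=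
          mul_le_mul_of_nonneg_left (le_abs_self q) ht.le
      _ ≤ (e / (|q| + 1)) * (|q| + 1) :=
          mul_le_mul (min_le_right _ _) (by linarith) (abs_nonneg _) (by positivity)
      _ = e := by field_simp
  linarith

lemma IsRidgeMinimizer.unique {φ : X → H} {Bsq lam : ℝ} (hlam : 0 < lam) {Z : Fin N → X × ℝ}
    {w v : H} (hw : IsRidgeMinimizer φ Bsq lam Z w) (hv : IsRidgeMinimizer φ Bsq lam Z v) :
    w = v := by
  have h1 := hw.strong hv.2
  have h2 := hv.le hw.2
  have h3 : ‖w - v‖ ^ 2 ≤ 0 := by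
    by_contra h
    push Not at h
    have := mul_pos hlam h
    linarith
  have h4 : ‖w - v‖ = 0 := by
    have := sq_nonneg ‖w - v‖
    exact pow_eq_zero_iff (two_ne_zero) |>.1 (le_antisymm h3 this)
  exact sub_eq_zero.1 (norm_eq_zero.1 h4)

/-- Representer argument: orthogonal projection onto the span of the observed features keeps the
empirical loss and does not increase the norm. Minimizing over a compact ball of this
finite-dimensional subspace is therefore enough, although balls of `H` need not be compact. -/
lemma exists_isRidgeMinimizer (φ : X → H) {Bsq lam : ℝ} (hB : 0 ≤ Bsq)
    (hlam : 0 ≤ lam) (Z : Fin N → X × ℝ) : ∃ w, IsRidgeMinimizer φ Bsq lam Z w := by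
  let U : Submodule ℝ H := Submodule.span ℝ (Set.range fun i => φ (Z i).1)
  have : FiniteDimensional ℝ U := FiniteDimensional.span_of_finite ℝ (Set.finite_range _)
  have : ProperSpace U := FiniteDimensional.proper ℝ U
  have hmem : ∀ i, φ (Z i).1 ∈ U := fun i => Submodule.subset_span ⟨i, rfl⟩
  have hsq : ∀ r : ℝ, 0 ≤ r → (r ^ 2 ≤ Bsq ↔ r ≤ Real.sqrt Bsq) := fun r hr =>
    (Real.le_sqrt hr hB).symm
  have hcont : Continuous fun u : U => ridgeObjective φ lam Z (u : H) := by
    unfold ridgeObjective empiricalLoss sqLoss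
    fun_prop
  obtain ⟨w, hw, hmin⟩ := (isCompact_closedBall (0 : U) (Real.sqrt Bsq)).exists_isMinOn
    ⟨0, by simp [Real.sqrt_nonneg]⟩ hcont.continuousOn
  have hw' : ‖w‖ ≤ Real.sqrt Bsq := by simpa using hw
  refine ⟨w, ?_, (hsq _ (norm_nonneg _)).2 hw'⟩
  intro v hv
  have hv' : ‖v‖ ≤ Real.sqrt Bsq := (hsq _ (norm_nonneg _)).1 hv
  have hp : ‖U.orthogonalProjectionOnto v‖ ≤ ‖v‖ := U.norm_orthogonalProjectionOnto_apply_le v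
  have h1 := hmin (show U.orthogonalProjectionOnto v ∈ Metric.closedBall (0 : U) (Real.sqrt Bsq) by
    simpa using hp.trans hv')
  have h2 : ∀ i, inner ℝ (U.orthogonalProjectionOnto v : H) (φ (Z i).1) = inner ℝ v (φ (Z i).1) := by
    intro i
    have := U.inner_orthogonalProjectionOnto_eq_of_mem_left ⟨φ (Z i).1, hmem i⟩ v
    rw [real_inner_comm, real_inner_comm _ v]
    exact this
  have h3 : empiricalLoss φ Z (U.orthogonalProjectionOnto v : H) = empiricalLoss φ Z v := by
    simp only [empiricalLoss, sqLoss, h2]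
  have h4 : lam * ‖(U.orthogonalProjectionOnto v : H)‖ ^ 2 ≤ lam * ‖v‖ ^ 2 := by
    have : ‖(U.orthogonalProjectionOnto v : H)‖ ≤ ‖v‖ := hp
    gcongr
  change ridgeObjective φ lam Z w ≤ ridgeObjective φ lam Z v
  have h5 : ridgeObjective φ lam Z w ≤ ridgeObjective φ lam Z (U.orthogonalProjectionOnto v : H) := h1
  refine h5.trans ?_
  simp only [ridgeObjective, h3]
  linarith

lemma existsUnique_isRidgeMinimizer (φ : X → H) {Bsq lam : ℝ} (hB : 0 ≤ Bsq) (hlam : 0 < lam)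
    (Z : Fin N → X × ℝ) : ∃! w, IsRidgeMinimizer φ Bsq lam Z w := by
  obtain ⟨w, hw⟩ := exists_isRidgeMinimizer φ hB hlam.le Z
  exact ⟨w, hw, fun v hv => hv.unique hlam hw⟩

lemma norm_mul_sq_le {u q : H} {Kb : ℝ} (hK : ‖q‖ ≤ Kb) : |inner ℝ u q| ≤ Kb * ‖u‖ :=
  (abs_real_inner_le_norm u q).trans (by
    rw [mul_comm]; exact mul_le_mul_of_nonneg_right hK (norm_nonneg _))

/-- The minimizer depends on the labels in a Lipschitz way. -/
lemma IsRidgeMinimizer.norm_sub_le {φ : X → H} {Kb Bsq lam : ℝ} (hK : ∀ x, ‖φ x‖ ≤ Kb)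
    (hlam : 0 < lam) {x : Fin N → X} {y y' : Fin N → ℝ} {w w' : H}
    (hw : IsRidgeMinimizer φ Bsq lam (fun i => (x i, y i)) w)
    (hw' : IsRidgeMinimizer φ Bsq lam (fun i => (x i, y' i)) w') :
    ‖w - w'‖ ≤ Kb / (2 * lam) * ∑ i, |y i - y' i| / N := by
  have h1 := hw.strong hw'.2
  have h2 := hw'.strong hw.2
  rw [norm_sub_rev w' w] at h2
  -- In the sum of the two growth inequalities the penalties, the squares of the labels and the
  -- squares of the predictions cancel; only the cross terms between labels and predictions survive.
  have h3 : ridgeObjective φ lam (fun i => (x i, y i)) w' -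
      ridgeObjective φ lam (fun i => (x i, y i)) w +
      (ridgeObjective φ lam (fun i => (x i, y' i)) w -
      ridgeObjective φ lam (fun i => (x i, y' i)) w') =
      1 / (N : ℝ) * ∑ i, (y i - y' i) * inner ℝ (w - w') (φ (x i)) := by
    simp only [ridgeObjective, empiricalLoss, sqLoss]
    have : ∀ a b c d q : ℝ, ∀ (e f : ℝ), q * a + e - (q * b + f) + (q * c + f - (q * d + e)) =
        q * (a - b + (c - d)) := by intros; ring
    rw [this, ← Finset.sum_sub_distrib, ← Finset.sum_sub_distrib, ← Finset.sum_add_distrib]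
    congr 1
    refine Finset.sum_congr rfl fun i _ => ?_
    rw [inner_sub_left]
    ring
  have h4 : 1 / (N : ℝ) * ∑ i, (y i - y' i) * inner ℝ (w - w') (φ (x i)) ≤
      (Kb * ∑ i, |y i - y' i| / N) * ‖w - w'‖ := by
    rw [Finset.mul_sum, Finset.mul_sum, Finset.sum_mul]
    refine Finset.sum_le_sum fun i _ => ?_
    have := norm_mul_sq_le (u := w - w') (hK (x i))
    calc 1 / (N : ℝ) * ((y i - y' i) * inner ℝ (w - w') (φ (x i)))
        ≤ 1 / (N : ℝ) * (|y i - y' i| * (Kb * ‖w - w'‖)) := by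
          refine mul_le_mul_of_nonneg_left ?_ (by positivity)
          refine (le_abs_self _).trans ?_
          rw [abs_mul]
          gcongr
      _ = _ := by ring
  rcases (norm_nonneg (w - w')).eq_or_lt with h0 | h0
  · rw [← h0]
    rcases isEmpty_or_nonempty (Fin N) with hN | ⟨⟨i⟩⟩
    · simp
    · have : 0 ≤ Kb := (norm_nonneg _).trans (hK (x i))
      exact mul_nonneg (by positivity) (Finset.sum_nonneg fun i _ => by positivity)
  · have h5 : 2 * lam * ‖w - w'‖ ≤ Kb * ∑ i, |y i - y' i| / N := by
      refine le_of_mul_le_mul_right ?_ h0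
      nlinarith
    rw [div_mul_eq_mul_div, le_div_iff₀ (by positivity)]
    linarith

/-- The scalar core of stability: a, a' and b, b' are the residuals of two minimizers at the
exchanged samples and u is the distance of the minimizers. The difference of losses is at most k u s
/ 2, with s the sum of the absolute residuals. Quadratic growth then forces 4 c u ≤ k s, and
inserting this bound for u leaves a multiple of s², hence of the losses themselves. A uniform bound
on the loss would give a worse dependence on N. -/
lemma sq_diff_le_of_growth {a a' b b' k u c : ℝ} (hk : 0 ≤ k) (hu : 0 ≤ u) (hc : 0 < c)
    (e1 : |a' - a| ≤ k * u) (e2 : |b' - b| ≤ k * u)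
    (h : 2 * c * u ^ 2 ≤ a' ^ 2 / 2 + b ^ 2 / 2 - a ^ 2 / 2 - b' ^ 2 / 2) :
    a' ^ 2 / 2 + b ^ 2 / 2 - a ^ 2 / 2 - b' ^ 2 / 2 ≤
      k ^ 2 / c * (a' ^ 2 / 2 + b ^ 2 / 2 + a ^ 2 / 2 + b' ^ 2 / 2) := by
  set s := |a| + |a'| + |b| + |b'| with hs
  have hs0 : 0 ≤ s := by positivity
  have h5 : a' ^ 2 / 2 + b ^ 2 / 2 - a ^ 2 / 2 - b' ^ 2 / 2 ≤ k * u * s / 2 := by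
    have f1 : (a' - a) * (a' + a) ≤ (k * u) * (|a'| + |a|) := by
      refine (le_abs_self _).trans ?_
      rw [abs_mul]
      exact mul_le_mul e1 (abs_add_le _ _) (abs_nonneg _) (by positivity)
    have f2 : (b - b') * (b + b') ≤ (k * u) * (|b| + |b'|) := by
      refine (le_abs_self _).trans ?_
      rw [abs_mul, abs_sub_comm]
      exact mul_le_mul e2 (abs_add_le _ _) (abs_nonneg _) (by positivity)
    have f3 : k * u * s = (k * u) * (|a'| + |a|) + (k * u) * (|b| + |b'|) := by rw [hs]; ring
    have f4 : a' ^ 2 / 2 + b ^ 2 / 2 - a ^ 2 / 2 - b' ^ 2 / 2 =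
      ((a' - a) * (a' + a) + (b - b') * (b + b')) / 2 := by ring
    linarith
  have h6 : 4 * c * u ≤ k * s := by
    rcases hu.eq_or_lt with h0 | h0
    · rw [← h0, mul_zero]; positivity
    · refine le_of_mul_le_mul_right ?_ h0
      have := h.trans h5
      calc 4 * c * u * u = 2 * (2 * c * u ^ 2) := by ring
        _ ≤ 2 * (k * u * s / 2) := by linarith
        _ = k * s * u := by ring
  have h7 : s ^ 2 ≤ 4 * (a ^ 2 + a' ^ 2 + b ^ 2 + b' ^ 2) := by
    rw [← sq_abs a, ← sq_abs a', ← sq_abs b, ← sq_abs b', hs]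
    nlinarith [sq_nonneg (|a| - |a'|), sq_nonneg (|a| - |b|), sq_nonneg (|a| - |b'|),
      sq_nonneg (|a'| - |b|), sq_nonneg (|a'| - |b'|), sq_nonneg (|b| - |b'|)]
  refine h5.trans ?_
  rw [div_mul_eq_mul_div, le_div_iff₀ hc]
  calc k * u * s / 2 * c = (k * s) * (4 * c * u) / 8 := by ring
    _ ≤ (k * s) * (k * s) / 8 := by gcongr
    _ = k ^ 2 * s ^ 2 / 8 := by ring
    _ ≤ k ^ 2 * (4 * (a ^ 2 + a' ^ 2 + b ^ 2 + b' ^ 2)) / 8 := by gcongr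
    _ = _ := by ring

/-- Replacing one sample changes the losses at the replaced samples only a little. -/
lemma ridge_stability {φ : X → H} {Ksq Bsq lam : ℝ} (hK : ∀ x, ‖φ x‖ ^ 2 ≤ Ksq) (hlam : 0 < lam)
    (hN : 0 < N) {Z : Fin N → X × ℝ} {z : X × ℝ} {i : Fin N} {w w' : H}
    (hw : IsRidgeMinimizer φ Bsq lam Z w)
    (hw' : IsRidgeMinimizer φ Bsq lam (Function.update Z i z) w') :
    sqLoss φ w' (Z i) + sqLoss φ w z - sqLoss φ w (Z i) - sqLoss φ w' z ≤
      Ksq / (lam * N) *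
        (sqLoss φ w' (Z i) + sqLoss φ w z + sqLoss φ w (Z i) + sqLoss φ w' z) := by
  have hN' : (0 : ℝ) < N := by exact_mod_cast hN
  have h1 := hw.strong hw'.2
  have h2 := hw'.strong hw.2
  rw [norm_sub_rev w' w] at h2
  -- The two objectives differ only in the `i`-th summand, so adding the two growth inequalities
  -- cancels everything else. The factor 1/N in front of that summand turns the growth constant lam
  -- into c = lam N.
  have h3 : ∀ v, ridgeObjective φ lam (Function.update Z i z) v = ridgeObjective φ lam Z v +
      1 / (N : ℝ) * (sqLoss φ v z - sqLoss φ v (Z i)) := by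
    intro v
    have : ∑ j, sqLoss φ v (Function.update Z i z j) = ∑ j, sqLoss φ v (Z j) +
        (sqLoss φ v z - sqLoss φ v (Z i)) := by
      rw [← Finset.add_sum_erase _ _ (Finset.mem_univ i),
        ← Finset.add_sum_erase _ (fun j => sqLoss φ v (Z j)) (Finset.mem_univ i)]
      rw [Finset.sum_congr rfl fun j hj => by
        rw [Function.update_of_ne (Finset.ne_of_mem_erase hj)], Function.update_self]
      ring
    simp only [ridgeObjective, empiricalLoss, this]
    ring
  rw [h3, h3] at h2
  have h4 : 2 * lam * N * ‖w - w'‖ ^ 2 ≤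
      sqLoss φ w' (Z i) + sqLoss φ w z - sqLoss φ w (Z i) - sqLoss φ w' z := by
    have h5 : 2 * lam * ‖w - w'‖ ^ 2 ≤ (sqLoss φ w' (Z i) + sqLoss φ w z - sqLoss φ w (Z i) -
        sqLoss φ w' z) / N := by
      rw [div_eq_mul_one_div]
      linarith [add_le_add h1 h2]
    rw [le_div_iff₀ hN'] at h5
    linarith
  set k := Real.sqrt Ksq with hk
  have hk0 : 0 ≤ k := Real.sqrt_nonneg _
  have hkφ : ∀ x, ‖φ x‖ ≤ k := fun x => Real.le_sqrt_of_sq_le (hK x)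
  have hksq : k ^ 2 = Ksq := Real.sq_sqrt ((sq_nonneg _).trans (hK z.1))
  have e1 := norm_mul_sq_le (u := w - w') (hkφ (Z i).1)
  have e2 := norm_mul_sq_le (u := w - w') (hkφ z.1)
  rw [inner_sub_left] at e1 e2
  simp only [sqLoss] at h4 ⊢
  set a := (Z i).2 - inner ℝ w (φ (Z i).1)
  set a' := (Z i).2 - inner ℝ w' (φ (Z i).1)
  set b := z.2 - inner ℝ w (φ z.1)
  set b' := z.2 - inner ℝ w' (φ z.1)
  have e1' : |a' - a| ≤ k * ‖w - w'‖ := by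
    have : a' - a = inner ℝ w (φ (Z i).1) - inner ℝ w' (φ (Z i).1) := by ring
    rwa [this]
  have e2' : |b' - b| ≤ k * ‖w - w'‖ := by
    have : b' - b = inner ℝ w (φ z.1) - inner ℝ w' (φ z.1) := by ring
    rwa [this]
  rw [← hksq]
  exact sq_diff_le_of_growth hk0 (norm_nonneg _) (by positivity) e1' e2' (by linarith)

end Ridge

/-! ### Resampling, measurability of the learned predictor, and expected risk -/

/-- Exchanging a fresh sample with the `i`-th sample of a dataset preserves the product law. -/
lemma measurePreserving_exchange {S : Type*} [MeasurableSpace S] (P : Measure S)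
    [IsProbabilityMeasure P] {N : ℕ} (i : Fin N) :
    MeasurePreserving (fun q : S × (Fin N → S) => (q.2 i, Function.update q.2 i q.1))
      (P.prod (Measure.pi fun _ : Fin N => P)) (P.prod (Measure.pi fun _ : Fin N => P)) := by
  -- The fresh sample and the dataset together are N + 1 independent coordinates, and the exchange
  -- is the transposition of coordinates 0 and i + 1.
  have h0 := measurePreserving_piFinSuccAbove (fun _ : Fin (N + 1) => P) 0
  have h1 := measurePreserving_piCongrLeft (fun _ : Fin (N + 1) => P) (Equiv.swap 0 i.succ)
  have h2 := (h0.comp h1).comp (h0.symm _)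
  convert h2 using 1
  funext q
  have hq : (MeasurableEquiv.piFinSuccAbove (fun _ : Fin (N + 1) => S) 0).symm q =
      Fin.cons q.1 q.2 := by
    exact Fin.insertNth_zero' q.1 q.2
  simp only [Function.comp_apply]
  rw [hq]
  have hc : ∀ (Z : Fin (N + 1) → S) (j : Fin (N + 1)),
      MeasurableEquiv.piCongrLeft (fun _ => S) (Equiv.swap 0 i.succ) Z j =
        Z (Equiv.swap 0 i.succ j) := by
    intro Z j
    have := MeasurableEquiv.piCongrLeft_apply_apply (β := fun _ => S) (Equiv.swap 0 i.succ) Z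
      (Equiv.swap 0 i.succ j)
    rwa [Equiv.swap_apply_self] at this
  refine Prod.ext ?_ (funext fun j => ?_)
  · change q.2 i = MeasurableEquiv.piCongrLeft (fun _ => S) (Equiv.swap 0 i.succ) _ 0
    rw [hc, Equiv.swap_apply_left, Fin.cons_succ]
  · change Function.update q.2 i q.1 j =
      MeasurableEquiv.piCongrLeft (fun _ => S) (Equiv.swap 0 i.succ) _ (Fin.succAbove 0 j)
    rw [hc, Fin.succAbove_zero]
    rcases eq_or_ne j i with rfl | hj
    · rw [Equiv.swap_apply_right, Function.update_self, Fin.cons_zero]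
    · rw [Equiv.swap_apply_of_ne_of_ne (Fin.succ_ne_zero _) (by simpa using hj),
        Function.update_of_ne hj, Fin.cons_succ]

/-- The hypothesis rearranges to (1 - κ)(f₁ + f₂) ≤ (1 + κ)(f₃ + f₄), which integrates termwise. -/
lemma integral_four_le {Ω : Type*} [MeasurableSpace Ω] {Q : Measure Ω} {f₁ f₂ f₃ f₄ : Ω → ℝ}
    (h₁ : Integrable f₁ Q) (h₂ : Integrable f₂ Q) (h₃ : Integrable f₃ Q) (h₄ : Integrable f₄ Q)
    {κ : ℝ} (h : ∀ q, f₁ q + f₂ q - f₃ q - f₄ q ≤ κ * (f₁ q + f₂ q + f₃ q + f₄ q)) :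
    ∫ q, f₁ q ∂Q + ∫ q, f₂ q ∂Q - ∫ q, f₃ q ∂Q - ∫ q, f₄ q ∂Q ≤
      κ * (∫ q, f₁ q ∂Q + ∫ q, f₂ q ∂Q + ∫ q, f₃ q ∂Q + ∫ q, f₄ q ∂Q) := by
  have e₁ : ∫ q, f₁ q + f₂ q ∂Q = ∫ q, f₁ q ∂Q + ∫ q, f₂ q ∂Q := integral_add h₁ h₂
  have e₂ : ∫ q, f₃ q + f₄ q ∂Q = ∫ q, f₃ q ∂Q + ∫ q, f₄ q ∂Q := integral_add h₃ h₄
  have e₃ := integral_const_mul (μ := Q) (1 - κ) fun q => f₁ q + f₂ q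
  have e₄ := integral_const_mul (μ := Q) (1 + κ) fun q => f₃ q + f₄ q
  have := integral_mono ((h₁.add h₂).const_mul (1 - κ)) ((h₃.add h₄).const_mul (1 + κ)) fun q => by
    simp only [Pi.add_apply]
    linarith [h q]
  simp only [Pi.add_apply] at this
  rw [e₃, e₄, e₁, e₂] at this
  linarith

section Ridge

variable {X H : Type*} [NormedAddCommGroup H] [InnerProductSpace ℝ H] {N : ℕ}

lemma sqLoss_le_of_bounds {φ : X → H} {Kb B Y : ℝ} (hK : ∀ x, ‖φ x‖ ≤ Kb) {w : H} (hw : ‖w‖ ≤ B)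
    {z : X × ℝ} (hz : |z.2| ≤ Y) : sqLoss φ w z ≤ (Y + Kb * B) ^ 2 / 2 := by
  have h1 : |z.2 - inner ℝ w (φ z.1)| ≤ Y + Kb * B := by
    refine (abs_sub _ _).trans (add_le_add hz ((norm_mul_sq_le (hK z.1)).trans ?_))
    exact mul_le_mul_of_nonneg_left hw ((norm_nonneg _).trans (hK z.1))
  unfold sqLoss
  rw [← sq_abs]
  gcongr

variable [MeasurableSpace X] [Finite X] [DiscreteMeasurableSpace X]

lemma measurable_sqLoss (φ : X → H) (w : H) : Measurable (sqLoss φ w) := by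
  unfold sqLoss
  have : Measurable fun x => inner ℝ w (φ x) := measurable_of_finite _
  exact ((measurable_snd.sub (this.comp measurable_fst)).pow_const 2).div_const 2

/-- There are only finitely many inputs, so it suffices to fix them and vary the labels; in the
labels the minimizer is Lipschitz by `IsRidgeMinimizer.norm_sub_le`. -/
lemma measurable_inner_of_isRidgeMinimizer {φ : X → H} {Bsq lam : ℝ} (hlam : 0 < lam)
    {wstar : (Fin N → X × ℝ) → H} (hw : ∀ Z, IsRidgeMinimizer φ Bsq lam Z (wstar Z)) (x : X) :
    Measurable fun Z => inner ℝ (wstar Z) (φ x) := by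
  obtain ⟨Kb, hK⟩ : ∃ Kb, ∀ x, ‖φ x‖ ≤ Kb :=
    (Set.finite_range fun x => ‖φ x‖).bddAbove.imp fun _ h x => h ⟨x, rfl⟩
  let f : (Fin N → X) × (Fin N → ℝ) → ℝ :=
    fun q => inner ℝ (wstar fun i => (q.1 i, q.2 i)) (φ x)
  have hf : Measurable f := by
    refine measurable_from_prod_countable_right fun xs => Continuous.measurable ?_
    refine Continuous.inner ?_ continuous_const
    refine continuous_iff_continuousAt.2 fun y => tendsto_iff_norm_sub_tendsto_zero.2 ?_
    refine squeeze_zero (fun _ => norm_nonneg _)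
      (fun y' => IsRidgeMinimizer.norm_sub_le hK hlam (hw _) (hw _)) ?_
    have : Continuous fun y' : Fin N → ℝ => Kb / (2 * lam) * ∑ i, |y' i - y i| / N := by fun_prop
    have h := this.tendsto y
    simpa using h
  have hg : Measurable fun Z : Fin N → X × ℝ => ((fun i => (Z i).1, fun i => (Z i).2) :
      (Fin N → X) × (Fin N → ℝ)) :=
    (measurable_pi_lambda _ fun i => measurable_fst.comp (measurable_pi_apply i)).prodMk
      (measurable_pi_lambda _ fun i => measurable_snd.comp (measurable_pi_apply i))
  exact hf.comp hg

lemma measurable_sqLoss_ridge {φ : X → H} {Bsq lam : ℝ} (hlam : 0 < lam)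
    {wstar : (Fin N → X × ℝ) → H} (hw : ∀ Z, IsRidgeMinimizer φ Bsq lam Z (wstar Z)) :
    Measurable fun q : (X × ℝ) × (Fin N → X × ℝ) => sqLoss φ (wstar q.2) q.1 := by
  have h : Measurable fun q : X × (Fin N → X × ℝ) => inner ℝ (wstar q.2) (φ q.1) :=
    measurable_from_prod_countable_right fun x => measurable_inner_of_isRidgeMinimizer hlam hw x
  have h2 : Measurable fun q : (X × ℝ) × (Fin N → X × ℝ) => inner ℝ (wstar q.2) (φ q.1.1) :=
    h.comp ((measurable_fst.comp measurable_fst).prodMk measurable_snd)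
  exact (((measurable_snd.comp measurable_fst).sub h2).pow_const 2).div_const 2

/-- The expected risk of ridge regression: stability gives a multiplicative oracle inequality. -/
theorem ridge_generalization {φ : X → H} {Ksq Y Bsq lam : ℝ} (hK : ∀ x, ‖φ x‖ ^ 2 ≤ Ksq)
    (P : Measure (X × ℝ)) [IsProbabilityMeasure P] (hY : ∀ᵐ z ∂P, |z.2| ≤ Y)
    (hlam : 0 < lam) (hN : 0 < N) {wstar : (Fin N → X × ℝ) → H}
    (hw : ∀ Z, IsRidgeMinimizer φ Bsq lam Z (wstar Z)) {w₀ : H} (hw₀ : ‖w₀‖ ^ 2 ≤ Bsq) :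
    Integrable (fun Z => expectedLoss φ P (wstar Z)) (Measure.pi fun _ : Fin N => P) ∧
    (1 - Ksq / (lam * N)) *
        ∫ Z, expectedLoss φ P (wstar Z) ∂(Measure.pi fun _ : Fin N => P) ≤
      (1 + Ksq / (lam * N)) * (expectedLoss φ P w₀ + lam * ‖w₀‖ ^ 2) := by
  have hN' : (0 : ℝ) < N := by exact_mod_cast hN
  have hKb : ∀ x, ‖φ x‖ ≤ Real.sqrt Ksq := fun x => Real.le_sqrt_of_sq_le (hK x)
  have hnB : ∀ {v : H}, ‖v‖ ^ 2 ≤ Bsq → ‖v‖ ≤ Real.sqrt Bsq := fun h => Real.le_sqrt_of_sq_le h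
  set ν := Measure.pi fun _ : Fin N => P with hν
  set κ := Ksq / (lam * N) with hκ
  set C := (Y + Real.sqrt Ksq * Real.sqrt Bsq) ^ 2 / 2 with hC
  set G : (X × ℝ) × (Fin N → X × ℝ) → ℝ := fun q => sqLoss φ (wstar q.2) q.1 with hG
  have hGm : Measurable G := measurable_sqLoss_ridge hlam hw
  have hYν : ∀ i, ∀ᵐ Z ∂ν, |(Z i).2| ≤ Y := fun i =>
    (Measure.quasiMeasurePreserving_eval (fun _ : Fin N => P) i).ae hY
  have hbd : ∀ {Ω : Type _} [MeasurableSpace Ω] (Q : Measure Ω) [IsProbabilityMeasure Q]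
      {f : Ω → ℝ}, Measurable f → (∀ᵐ a ∂Q, 0 ≤ f a ∧ f a ≤ C) → Integrable f Q := by
    intro Ω _ Q _ f hf h
    refine Integrable.of_bound hf.aestronglyMeasurable C ?_
    filter_upwards [h] with a ha
    rw [Real.norm_of_nonneg ha.1]
    exact ha.2
  have hY1 : ∀ᵐ q ∂(P.prod ν), |q.1.2| ≤ Y :=
    (Measure.quasiMeasurePreserving_fst (μ := P) (ν := ν)).ae hY
  have hGi : Integrable G (P.prod ν) := by
    refine hbd _ hGm ?_
    filter_upwards [hY1] with q hq
    exact ⟨sqLoss_nonneg _ _ _, sqLoss_le_of_bounds hKb (hnB (hw _).2) hq⟩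
  -- the loss at the `i`-th training sample
  have hLm : ∀ i, Measurable fun Z : Fin N → X × ℝ => sqLoss φ (wstar Z) (Z i) := by
    intro i
    have h : Measurable fun Z : Fin N → X × ℝ => (Z i, Z) :=
      (measurable_pi_apply i).prodMk measurable_id
    have h' := hGm.comp h
    exact h'
  have hLi : ∀ i, Integrable (fun Z : Fin N → X × ℝ => sqLoss φ (wstar Z) (Z i)) ν := by
    intro i
    refine hbd _ (hLm i) ?_
    filter_upwards [hYν i] with Z hZ
    exact ⟨sqLoss_nonneg _ _ _, sqLoss_le_of_bounds hKb (hnB (hw _).2) hZ⟩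
  have hLi' : ∀ i, Integrable (fun q : (X × ℝ) × (Fin N → X × ℝ) =>
      sqLoss φ (wstar q.2) (q.2 i)) (P.prod ν) := fun i => (hLi i).comp_snd P
  have hLD : ∫ Z, expectedLoss φ P (wstar Z) ∂ν = ∫ q, G q ∂(P.prod ν) := by
    rw [integral_prod_symm _ hGi]
    rfl
  have hstab : ∀ i, ∫ q, G q ∂(P.prod ν) - ∫ Z, sqLoss φ (wstar Z) (Z i) ∂ν ≤
      κ * (∫ q, G q ∂(P.prod ν) + ∫ Z, sqLoss φ (wstar Z) (Z i) ∂ν) := by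
    intro i
    have hex := measurePreserving_exchange P i
    have hm := hex.measurable
    set E : (X × ℝ) × (Fin N → X × ℝ) → (X × ℝ) × (Fin N → X × ℝ) :=
      fun q => (q.2 i, Function.update q.2 i q.1) with hE
    have i2 : Integrable (fun q => G (E q)) (P.prod ν) := hex.integrable_comp_of_integrable hGi
    have i4 : Integrable (fun q => sqLoss φ (wstar (E q).2) ((E q).2 i)) (P.prod ν) :=
      hex.integrable_comp_of_integrable (hLi' i)
    have e2 : ∫ q, G (E q) ∂(P.prod ν) = ∫ q, G q ∂(P.prod ν) := by
      have := integral_map (μ := P.prod ν) hm.aemeasurable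
        (f := G) (by rw [hex.map_eq]; exact hGi.aestronglyMeasurable)
      rw [hex.map_eq] at this
      exact this.symm
    have e4 : ∫ q, sqLoss φ (wstar (E q).2) ((E q).2 i) ∂(P.prod ν) =
        ∫ q, sqLoss φ (wstar q.2) (q.2 i) ∂(P.prod ν) := by
      have := integral_map (μ := P.prod ν) hm.aemeasurable
        (f := fun q => sqLoss φ (wstar q.2) (q.2 i))
        (by rw [hex.map_eq]; exact (hLi' i).aestronglyMeasurable)
      rw [hex.map_eq] at this
      exact this.symm
    have e3 : ∫ q, sqLoss φ (wstar q.2) (q.2 i) ∂(P.prod ν) =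
        ∫ Z, sqLoss φ (wstar Z) (Z i) ∂ν := by
      rw [integral_fun_snd (μ := P) (ν := ν) (fun Z => sqLoss φ (wstar Z) (Z i))]
      simp
    -- Of the four losses in the stability bound, two are test losses and two are training losses,
    -- and `E` interchanges the members of each pair. After integration each pair collapses to twice
    -- one quantity, so the factor 2 divides out.
    have hpt : ∀ q, G (E q) + G q - sqLoss φ (wstar q.2) (q.2 i) -
        sqLoss φ (wstar (E q).2) ((E q).2 i) ≤
        κ * (G (E q) + G q + sqLoss φ (wstar q.2) (q.2 i) +
        sqLoss φ (wstar (E q).2) ((E q).2 i)) := by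
      intro q
      have := ridge_stability hK hlam hN (hw q.2) (hw (Function.update q.2 i q.1))
      simp only [hG, hE, Function.update_self]
      exact this
    have hint := integral_four_le i2 hGi (hLi' i) i4 hpt
    rw [e2, e4, e3] at hint
    linarith
  have hemp : ∫ Z, empiricalLoss φ Z (wstar Z) ∂ν =
      1 / (N : ℝ) * ∑ i, ∫ Z, sqLoss φ (wstar Z) (Z i) ∂ν := by
    simp only [empiricalLoss]
    rw [integral_const_mul, integral_finsetSum _ fun i _ => hLi i]
  have havg : ∫ q, G q ∂(P.prod ν) - ∫ Z, empiricalLoss φ Z (wstar Z) ∂ν ≤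
      κ * (∫ q, G q ∂(P.prod ν) + ∫ Z, empiricalLoss φ Z (wstar Z) ∂ν) := by
    have h := Finset.sum_le_sum fun i (_ : i ∈ (Finset.univ : Finset (Fin N))) => hstab i
    rw [Finset.sum_sub_distrib, ← Finset.mul_sum, Finset.sum_add_distrib] at h
    simp only [Finset.sum_const, Finset.card_univ, Fintype.card_fin, nsmul_eq_mul] at h
    rw [hemp]
    set s := ∑ i, ∫ Z, sqLoss φ (wstar Z) (Z i) ∂ν
    obtain ⟨e, he⟩ : ∃ e, e = 1 / (N : ℝ) * s := ⟨_, rfl⟩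
    have hs : s = N * e := by rw [he]; field_simp
    rw [← he]
    rw [hs] at h
    refine le_of_mul_le_mul_left ?_ hN'
    linarith
  -- comparison with `w₀`
  have hL0i : ∀ i, Integrable (fun Z : Fin N → X × ℝ => sqLoss φ w₀ (Z i)) ν := by
    intro i
    refine hbd _ ((measurable_sqLoss φ w₀).comp (measurable_pi_apply i)) ?_
    filter_upwards [hYν i] with Z hZ
    exact ⟨sqLoss_nonneg _ _ _, sqLoss_le_of_bounds hKb (hnB hw₀) hZ⟩
  have hE0 : ∫ Z, empiricalLoss φ Z w₀ ∂ν = expectedLoss φ P w₀ := by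
    simp only [empiricalLoss]
    rw [integral_const_mul, integral_finsetSum _ fun i _ => hL0i i]
    have : ∀ i, ∫ Z, sqLoss φ w₀ (Z i) ∂ν = expectedLoss φ P w₀ := fun i =>
      integral_comp_eval (μ := fun _ : Fin N => P) (i := i) (f := sqLoss φ w₀)
        (measurable_sqLoss φ w₀).aestronglyMeasurable
    simp only [this, Finset.sum_const, Finset.card_univ, Fintype.card_fin, nsmul_eq_mul]
    field_simp
  have hEi : Integrable (fun Z => empiricalLoss φ Z (wstar Z)) ν := by
    unfold empiricalLoss
    exact (integrable_finsetSum _ fun i _ => hLi i).const_mul _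
  have hE0i : Integrable (fun Z => empiricalLoss φ Z w₀) ν := by
    unfold empiricalLoss
    exact (integrable_finsetSum _ fun i _ => hL0i i).const_mul _
  -- Pointwise minimality against w₀, with the nonnegative penalty of the minimizer dropped. Since
  -- w₀ does not depend on the dataset, its mean empirical loss is its expected loss.
  have hcmp : ∫ Z, empiricalLoss φ Z (wstar Z) ∂ν ≤ expectedLoss φ P w₀ + lam * ‖w₀‖ ^ 2 := by
    have := integral_mono hEi (hE0i.add (integrable_const (lam * ‖w₀‖ ^ 2))) fun Z => by
      have h := (hw Z).le hw₀
      simp only [ridgeObjective] at h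
      have : 0 ≤ lam * ‖wstar Z‖ ^ 2 := by positivity
      simp only [Pi.add_apply]
      linarith
    simp only [Pi.add_apply] at this
    rw [integral_add hE0i (integrable_const _), hE0] at this
    simpa using this
  refine ⟨hGi.integral_prod_right, ?_⟩
  rw [hLD]
  have hκ0 : 0 ≤ κ := by
    obtain ⟨z⟩ := P.nonempty_of_neZero
    have := (sq_nonneg _).trans (hK z.1)
    positivity
  nlinarith

end Ridge

/-! ### Pauli strings -/

section Pauli

variable {V : Type} [Fintype V] [DecidableEq V]

lemma Pauli.conjTranspose_mat (Q : Pauli) : Q.mat.conjTranspose = Q.mat := by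
  cases Q <;> ext i j <;> fin_cases i <;> fin_cases j <;>
    simp [Pauli.mat, Matrix.conjTranspose_apply]

lemma Pauli.mat_I : Pauli.I.mat = 1 := by
  ext i j; fin_cases i <;> fin_cases j <;> simp [Pauli.mat]

lemma Pauli.mat_mul_self (Q : Pauli) : Q.mat * Q.mat = 1 := by
  cases Q <;> ext i j <;> fin_cases i <;> fin_cases j <;>
    simp [Pauli.mat, Matrix.mul_apply, Fin.sum_univ_two]

lemma PauliString.mem_supp {P : PauliString V} {v : V} : v ∈ P.supp ↔ P v ≠ Pauli.I := by
  simp [PauliString.supp]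

lemma tensorOp_one : tensorOp (fun _ : V => (1 : Matrix (Fin 2) (Fin 2) ℂ)) = 1 := by
  ext x y
  simp only [tensorOp, Matrix.of_apply, Matrix.one_apply]
  by_cases h : x = y
  · simp [h]
  · obtain ⟨v, hv⟩ := Function.ne_iff.1 h
    rw [if_neg h]
    exact Finset.prod_eq_zero (Finset.mem_univ v) (by simp [hv])

lemma tensorOp_conjTranspose (A : V → Matrix (Fin 2) (Fin 2) ℂ) :
    (tensorOp A).conjTranspose = tensorOp fun v => (A v).conjTranspose := by
  ext x y
  simp [tensorOp, Matrix.conjTranspose_apply]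

lemma PauliString.op_conjTranspose (P : PauliString V) : P.op.conjTranspose = P.op := by
  simp only [PauliString.op, tensorOp_conjTranspose, Pauli.conjTranspose_mat]

lemma PauliString.op_mul_self (P : PauliString V) : P.op * P.op = 1 := by
  simp only [PauliString.op, tensorOp_mul, Pauli.mat_mul_self, tensorOp_one]

lemma PauliString.op_one : PauliString.op (fun _ : V => Pauli.I) = 1 := by
  simp only [PauliString.op, Pauli.mat_I, tensorOp_one]

lemma expVal_one (ρ : DensityMatrix V) : expVal ρ 1 = 1 := by
  rw [expVal, one_mul, ρ.trace_eq_one]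

lemma expVal_add (ρ : DensityMatrix V) (O O' : Op V) :
    expVal ρ (O + O') = expVal ρ O + expVal ρ O' := by
  simp only [expVal, add_mul, Matrix.trace_add]

lemma expVal_smul (ρ : DensityMatrix V) (c : ℂ) (O : Op V) :
    expVal ρ (c • O) = c * expVal ρ O := by
  simp only [expVal, Matrix.smul_mul, Matrix.trace_smul, smul_eq_mul]

lemma expVal_sum {ι : Type*} (s : Finset ι) (ρ : DensityMatrix V) (O : ι → Op V) :
    expVal ρ (∑ i ∈ s, O i) = ∑ i ∈ s, expVal ρ (O i) := by
  simp only [expVal, Finset.sum_mul, Matrix.trace_sum]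

/-- For a projection, tr(Qρ) = tr(QρQ†), the trace of a positive semidefinite matrix. -/
lemma expVal_proj_nonneg (ρ : DensityMatrix V) {Q : Op V} (h1 : Q * Q = Q)
    (h2 : Q.conjTranspose = Q) : 0 ≤ (expVal ρ Q).re := by
  have h3 := (ρ.posSemidef.mul_mul_conjTranspose_same Q).trace_nonneg
  rw [h2, Matrix.trace_mul_comm, ← mul_assoc, h1] at h3
  exact (Complex.le_def.1 h3).1

lemma expVal_pauli (ρ : DensityMatrix V) (P : PauliString V) :
    expVal ρ P.op = (pauliExp ρ P : ℂ) := by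
  refine (Complex.conj_eq_iff_re.1 ?_).symm
  have h := Matrix.trace_conjTranspose (P.op * ρ.mat)
  rw [Matrix.conjTranspose_mul, P.op_conjTranspose, ρ.posSemidef.isHermitian.eq,
    Matrix.trace_mul_comm] at h
  exact h.symm

/-- Both (1 + P)/2 and (1 - P)/2 are projections because P is a Hermitian involution. -/
lemma abs_pauliExp_le_one (ρ : DensityMatrix V) (P : PauliString V) : |pauliExp ρ P| ≤ 1 := by
  have key : ∀ s : ℂ, s * s = 1 → star s = s →
      0 ≤ ((1 / 2 : ℂ) * (1 + s * (pauliExp ρ P : ℂ))).re := by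
    intro s hs hs'
    have h := expVal_proj_nonneg ρ (Q := (1 / 2 : ℂ) • (1 + s • P.op)) ?_ ?_
    · rwa [expVal_smul, expVal_add, expVal_one, expVal_smul, expVal_pauli] at h
    · have h1 : (s • P.op) * (s • P.op) = 1 := by
        rw [Matrix.smul_mul, Matrix.mul_smul, smul_smul, hs, P.op_mul_self, one_smul]
      generalize s • P.op = M at h1
      simp only [Matrix.smul_mul, Matrix.mul_smul, add_mul, mul_add, one_mul, mul_one, h1]
      module
    · rw [Matrix.conjTranspose_smul, Matrix.conjTranspose_add, Matrix.conjTranspose_one,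
        Matrix.conjTranspose_smul, P.op_conjTranspose, hs']
      simp
  have h1 := key 1 (by norm_num) (by simp)
  have h2 := key (-1) (by norm_num) (by simp)
  simp at h1 h2
  exact abs_le.2 ⟨by linarith, by linarith⟩

lemma specNorm_pauli_le_one (P : PauliString V) : specNorm P.op ≤ 1 := by
  unfold specNorm
  set U := Matrix.toEuclideanCLM (n := V → Fin 2) (𝕜 := ℂ) P.op with hU
  have h1 : star U * U = 1 := by
    rw [hU, ← map_star, Matrix.star_eq_conjTranspose, P.op_conjTranspose, ← map_mul,
      P.op_mul_self, map_one]
  have h2 := CStarRing.norm_star_mul_self (x := U)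
  rw [h1, norm_one] at h2
  nlinarith [norm_nonneg U]

lemma PauliString.actsOn (P : PauliString V) {A : Finset V} (h : P.supp ⊆ A) :
    ActsOn A P.op := by
  have hI : ∀ v, v ∉ A → P v = Pauli.I := by
    intro v hv
    by_contra hne
    exact hv (h (by simp [PauliString.supp, hne]))
  refine ⟨tensorOp fun v : A => (P v).mat, fun x y hxy => ?_, fun x y hxy => ?_⟩
  · simp only [PauliString.op, tensorOp, Matrix.of_apply]
    rw [← Finset.prod_subset (Finset.subset_univ A)]
    · exact (Finset.prod_coe_sort A fun v => (P v).mat (x v) (y v)).symm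
    · intro v _ hv
      rw [hI v hv, hxy v hv, Pauli.mat_I, Matrix.one_apply_eq]
  · push Not at hxy
    obtain ⟨v, hv, hne⟩ := hxy
    simp only [PauliString.op, tensorOp, Matrix.of_apply]
    exact Finset.prod_eq_zero (Finset.mem_univ v) (by
      rw [hI v hv, Pauli.mat_I, Matrix.one_apply_ne hne])

end Pauli

/-! ### Clusters -/

section Cluster

variable {D : ℕ} {L : Fin D → ℕ} [∀ μ, NeZero (L μ)]

open Classical in
/-- The part of `P` on the union of the clusters in `s`. -/
def clusterUnion (δ : ℝ) (P : PauliString (Site L))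
    (s : Finset (clusterGraph δ P).ConnectedComponent) : PauliString (Site L) :=
  fun a => if ∃ h : a ∈ P.supp, (clusterGraph δ P).connectedComponentMk ⟨a, h⟩ ∈ s
    then P a else Pauli.I

lemma mem_supp_clusterUnion {δ : ℝ} {P : PauliString (Site L)}
    {s : Finset (clusterGraph δ P).ConnectedComponent} {a : Site L} :
    a ∈ (clusterUnion δ P s).supp ↔
      ∃ h : a ∈ P.supp, (clusterGraph δ P).connectedComponentMk ⟨a, h⟩ ∈ s := by
  rw [PauliString.mem_supp, clusterUnion]
  split_ifs with h
  · exact ⟨fun _ => h, fun _ => PauliString.mem_supp.1 h.1⟩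
  · exact ⟨fun h1 => absurd rfl h1, fun h1 => absurd h1 h⟩

lemma clusterString_eq_clusterUnion (δ : ℝ) (P : PauliString (Site L))
    (Q : (clusterGraph δ P).ConnectedComponent) :
    clusterString δ P Q = clusterUnion δ P {Q} := by
  classical
  funext a
  exact if_congr (exists_congr fun h => Finset.mem_singleton.symm) rfl rfl

lemma mem_supp_clusterString {δ : ℝ} {P : PauliString (Site L)}
    {Q : (clusterGraph δ P).ConnectedComponent} {a : Site L} :
    a ∈ (clusterString δ P Q).supp ↔
      ∃ h : a ∈ P.supp, (clusterGraph δ P).connectedComponentMk ⟨a, h⟩ = Q := by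
  rw [clusterString_eq_clusterUnion, mem_supp_clusterUnion]
  simp only [Finset.mem_singleton]

lemma clusterUnion_empty (δ : ℝ) (P : PauliString (Site L)) :
    clusterUnion δ P ∅ = fun _ => Pauli.I := by
  funext a
  simp [clusterUnion]

lemma clusterUnion_univ (δ : ℝ) (P : PauliString (Site L))
    [Fintype (clusterGraph δ P).ConnectedComponent] :
    clusterUnion δ P Finset.univ = P := by
  funext a
  simp only [clusterUnion, Finset.mem_univ, exists_prop, and_true]
  split_ifs with h
  · rfl
  · simp only [PauliString.supp, Finset.mem_filter, Finset.mem_univ, true_and, not_not] at h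
    exact h.symm

open Classical in
lemma op_clusterUnion_insert (δ : ℝ) (P : PauliString (Site L))
    {Q : (clusterGraph δ P).ConnectedComponent}
    {s : Finset (clusterGraph δ P).ConnectedComponent} (hQ : Q ∉ s) :
    (clusterUnion δ P (insert Q s)).op = (clusterString δ P Q).op * (clusterUnion δ P s).op := by
  simp only [PauliString.op, tensorOp_mul]
  congr 1
  funext a
  simp only [clusterUnion, clusterString, Finset.mem_insert]
  by_cases ha : a ∈ P.supp
  · simp only [ha, exists_true_left]
    by_cases h1 : (clusterGraph δ P).connectedComponentMk ⟨a, ha⟩ = Q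
    · have h2 : (clusterGraph δ P).connectedComponentMk ⟨a, ha⟩ ∉ s := h1 ▸ hQ
      simp [h1, hQ, Pauli.mat_I]
    · simp [h1, Pauli.mat_I]
  · simp [ha, Pauli.mat_I]

/-- Two sites of the support within distance δ are equal or adjacent, so they lie in the same
component. -/
lemma le_setDist_cluster {δ : ℝ} {P : PauliString (Site L)}
    {Q : (clusterGraph δ P).ConnectedComponent}
    {s : Finset (clusterGraph δ P).ConnectedComponent} (hQ : Q ∉ s) (hs : s.Nonempty) :
    δ ≤ setDist (clusterString δ P Q).supp (clusterUnion δ P s).supp := by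
  obtain ⟨Q', hQ'⟩ := hs
  -- The infimum of an empty set of naturals is 0, so the distance is meaningful only when both
  -- supports are nonempty; this is where `hs` is needed.
  have hne : {d | ∃ a ∈ (clusterString δ P Q).supp, ∃ b ∈ (clusterUnion δ P s).supp,
      d = siteDist a b}.Nonempty := by
    obtain ⟨a, rfl⟩ := Q.exists_rep
    obtain ⟨b, rfl⟩ := Q'.exists_rep
    exact ⟨_, a.1, mem_supp_clusterString.2 ⟨a.2, rfl⟩, b.1, mem_supp_clusterUnion.2 ⟨b.2, hQ'⟩,
      rfl⟩
  obtain ⟨a, ha, b, hb, hd⟩ := Nat.sInf_mem hne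
  rw [setDist, hd]
  obtain ⟨ha1, ha2⟩ := mem_supp_clusterString.1 ha
  obtain ⟨hb1, hb2⟩ := mem_supp_clusterUnion.1 hb
  by_contra hlt
  push Not at hlt
  refine hQ ?_
  rw [← ha2]
  by_cases hab : a = b
  · subst hab; exact hb2
  · have hadj : (clusterGraph δ P).Adj ⟨a, ha1⟩ ⟨b, hb1⟩ :=
      ⟨fun h => hab (Subtype.ext_iff.1 h), hlt.le⟩
    rwa [SimpleGraph.ConnectedComponent.connectedComponentMk_eq_of_adj hadj]

/-- Clusters are split off one at a time. Each split costs one correlation between regions at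
distance at least δ, and the remaining error is multiplied by an expectation of absolute value at
most 1. -/
lemma abs_pauliExp_clusterUnion_sub_le {ξ δ : ℝ} (hξ : 0 < ξ) {ρ : DensityMatrix (Site L)}
    (hρ : ExpClustering ξ ρ) (P : PauliString (Site L))
    (s : Finset (clusterGraph δ P).ConnectedComponent) :
    |pauliExp ρ (clusterUnion δ P s) - ∏ Q ∈ s, pauliExp ρ (clusterString δ P Q)| ≤
      s.card * Real.exp (-δ / ξ) := by
  classical
  induction s using Finset.induction_on with
  | empty =>
    rw [clusterUnion_empty, pauliExp, PauliString.op_one, expVal_one]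
    simp
  | insert Q s hQ ih =>
    rw [Finset.prod_insert hQ, Finset.card_insert_of_notMem hQ]
    obtain ⟨A, hA⟩ : ∃ A, A = clusterString δ P Q := ⟨_, rfl⟩
    obtain ⟨B, hB⟩ : ∃ B, B = clusterUnion δ P s := ⟨_, rfl⟩
    rw [← hA]
    rw [← hB] at ih
    have h1 : |pauliExp ρ (clusterUnion δ P (insert Q s)) - pauliExp ρ A * pauliExp ρ B| ≤
        Real.exp (-δ / ξ) := by
      have hop : (clusterUnion δ P (insert Q s)).op = A.op * B.op := by
        rw [hA, hB, op_clusterUnion_insert δ P hQ]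
      -- For the first cluster nothing is split off and the factorization is exact;
      -- `le_setDist_cluster` would not apply.
      rcases s.eq_empty_or_nonempty with rfl | hs
      · have hB1 : B.op = 1 := by
          rw [hB, clusterUnion_empty, PauliString.op_one]
        have e1 : pauliExp ρ B = 1 := by rw [pauliExp, hB1, expVal_one, Complex.one_re]
        have e2 : pauliExp ρ (clusterUnion δ P (insert Q ∅)) = pauliExp ρ A := by
          rw [pauliExp, hop, hB1, mul_one]; rfl
        rw [e1, e2, mul_one, sub_self, abs_zero]
        exact (Real.exp_pos _).le
      · have h2 := hρ A.supp B.supp A.op B.op A.op_conjTranspose B.op_conjTranspose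
          (A.actsOn subset_rfl) (B.actsOn subset_rfl)
        rw [← hop, expVal_pauli, expVal_pauli, expVal_pauli] at h2
        rw [← Complex.ofReal_mul, ← Complex.ofReal_sub, Complex.norm_real, Real.norm_eq_abs] at h2
        refine h2.trans ?_
        have h3 : Real.exp (-(setDist A.supp B.supp : ℝ) / ξ) ≤ Real.exp (-δ / ξ) := by
          refine Real.exp_le_exp.2 (div_le_div_of_nonneg_right ?_ hξ.le)
          rw [hA, hB]
          exact neg_le_neg (le_setDist_cluster hQ hs)
        refine (mul_le_mul (mul_le_one₀ (specNorm_pauli_le_one A) (norm_nonneg _)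
          (specNorm_pauli_le_one B)) h3 (Real.exp_pos _).le zero_le_one).trans ?_
        rw [one_mul]
    have h4 : |pauliExp ρ A * pauliExp ρ B -
        pauliExp ρ A * ∏ Q ∈ s, pauliExp ρ (clusterString δ P Q)| ≤ s.card * Real.exp (-δ / ξ) := by
      rw [← mul_sub, abs_mul]
      exact (mul_le_of_le_one_left (abs_nonneg _) (abs_pauliExp_le_one ρ A)).trans ih
    calc _ ≤ _ := abs_sub_le _ (pauliExp ρ A * pauliExp ρ B) _
      _ ≤ _ := add_le_add h1 h4
      _ = _ := by push_cast; ring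

open Classical in
lemma abs_pauliExp_sub_prod_le {ξ δ : ℝ} (hξ : 0 < ξ) {ρ : DensityMatrix (Site L)}
    (hρ : ExpClustering ξ ρ) (P : PauliString (Site L)) :
    |pauliExp ρ P - ∏ Q, pauliExp ρ (clusterString δ P Q)| ≤
      Fintype.card (clusterGraph δ P).ConnectedComponent * Real.exp (-δ / ξ) := by
  have h := abs_pauliExp_clusterUnion_sub_le (δ := δ) hξ hρ P Finset.univ
  rwa [clusterUnion_univ, Finset.card_univ] at h

open Classical in
lemma sum_card_supp_clusterString (δ : ℝ) (P : PauliString (Site L)) :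
    ∑ Q, (clusterString δ P Q).supp.card = P.supp.card := by
  have h : ∀ Q : (clusterGraph δ P).ConnectedComponent, (clusterString δ P Q).supp.card =
      (Finset.univ.filter fun a : P.supp => (clusterGraph δ P).connectedComponentMk a = Q).card := by
    intro Q
    refine (Finset.card_bij (fun a _ => a.1) ?_ ?_ ?_).symm
    · intro a ha
      exact mem_supp_clusterString.2 ⟨a.2, (Finset.mem_filter.1 ha).2⟩
    · intro a _ b _ hab
      exact Subtype.ext hab
    · intro b hb
      obtain ⟨h1, h2⟩ := mem_supp_clusterString.1 hb
      exact ⟨⟨b, h1⟩, by simp [h2], rfl⟩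
  simp only [h]
  rw [← Fintype.card_coe P.supp, ← Finset.card_univ]
  exact (Finset.card_eq_sum_card_fiberwise fun _ _ => Finset.mem_coe.2 (Finset.mem_univ _)).symm

lemma card_supp_clusterString_pos (δ : ℝ) (P : PauliString (Site L))
    (Q : (clusterGraph δ P).ConnectedComponent) : 0 < (clusterString δ P Q).supp.card := by
  obtain ⟨a, ha⟩ := Q.exists_rep
  exact Finset.card_pos.2 ⟨a.1, mem_supp_clusterString.2 ⟨a.2, ha⟩⟩

lemma card_supp_clusterString_le (δ : ℝ) (P : PauliString (Site L))
    (Q : (clusterGraph δ P).ConnectedComponent) :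
    (clusterString δ P Q).supp.card ≤ P.supp.card :=
  Finset.card_le_card fun _ ha => (mem_supp_clusterString.1 ha).1

open Classical in
lemma card_component_le (δ : ℝ) (P : PauliString (Site L)) :
    Fintype.card (clusterGraph δ P).ConnectedComponent ≤ P.supp.card := by
  rw [← sum_card_supp_clusterString δ P, ← Finset.card_univ, Finset.card_eq_sum_ones]
  exact Finset.sum_le_sum fun Q _ => card_supp_clusterString_pos δ P Q

open Classical in
-- A nontrivial string has at least one cluster, while the identity string has weight 0 < m. Summed
-- over the p factors of a term this gives R + p ≤ m p + d, the case β = p of the exponent bound.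
lemma card_supp_add_one_le (δ : ℝ) {m : ℕ} (hm : 1 ≤ m) (P : PauliString (Site L))
    (hP : P.supp.card ≤ m) :
    P.supp.card + 1 ≤ m + Fintype.card (clusterGraph δ P).ConnectedComponent := by
  rcases P.supp.eq_empty_or_nonempty with h | ⟨a, ha⟩
  · have := Finset.card_eq_zero.2 h
    omega
  · have : 0 < Fintype.card (clusterGraph δ P).ConnectedComponent :=
      Fintype.card_pos_iff.2 ⟨(clusterGraph δ P).connectedComponentMk ⟨a, ha⟩⟩
    omega

end Cluster

/-! ### Translations -/

section Translation

variable {D : ℕ} {L : Fin D → ℕ} [∀ μ, NeZero (L μ)]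

lemma TranslationSymmetric.mat_unit {ρ : DensityMatrix (Site L)} (hρ : TranslationSymmetric ρ)
    (μ : Fin D) (x y : Site L → Fin 2) :
    ρ.mat (fun a => x (a + Pi.single μ 1)) (fun a => y (a + Pi.single μ 1)) = ρ.mat x y := by
  have h := congrFun (congrFun (hρ μ) x) y
  have e : ∀ x z : Site L → Fin 2, (x = fun a => z (a - Pi.single μ 1)) ↔
      z = fun a => x (a + Pi.single μ 1) := by
    intro x z
    constructor
    · rintro rfl; funext a; simp
    · rintro rfl; funext a; simp
  rw [← h]
  simp only [Matrix.mul_apply, Matrix.conjTranspose_apply, translationOp, Matrix.of_apply, e]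
  simp

/-- The shifts that leave ρ invariant form a submonoid containing the unit vectors, and the
representatives `(b μ).val` write every site as a nonnegative combination of these. -/
lemma TranslationSymmetric.mat_shift {ρ : DensityMatrix (Site L)} (hρ : TranslationSymmetric ρ)
    (b : Site L) (x y : Site L → Fin 2) :
    ρ.mat (fun a => x (a + b)) (fun a => y (a + b)) = ρ.mat x y := by
  let M : AddSubmonoid (Site L) :=
    { carrier := {b | ∀ x y : Site L → Fin 2,
        ρ.mat (fun a => x (a + b)) (fun a => y (a + b)) = ρ.mat x y}
      zero_mem' := fun x y => by simp
      add_mem' := fun {b c} hb hc x y => by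
        have h := hb (fun a => x (a + c)) (fun a => y (a + c))
        rw [hc] at h
        simpa only [add_assoc] using h }
  have hb : b = ∑ μ, (b μ).val • (Pi.single μ 1 : Site L) := by
    funext ν
    rw [Finset.sum_apply, Finset.sum_eq_single ν]
    · simp
    · intro μ _ hμ
      simp [Pi.single_eq_of_ne hμ.symm]
    · simp
  have hmem : b ∈ M := by
    rw [hb]
    exact M.sum_mem fun μ _ => M.nsmul_mem (fun x y => hρ.mat_unit μ x y) _
  exact hmem x y

lemma TranslationSymmetric.pauliExp_shift {ρ : DensityMatrix (Site L)}
    (hρ : TranslationSymmetric ρ) (b : Site L) (P : PauliString (Site L)) :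
    pauliExp ρ (fun v => P (v - b)) = pauliExp ρ P := by
  have hop : ∀ x y, PauliString.op (fun v => P (v - b)) x y =
      P.op (fun a => x (a + b)) (fun a => y (a + b)) := by
    intro x y
    simp only [PauliString.op, tensorOp, Matrix.of_apply]
    exact (Fintype.prod_equiv (Equiv.addRight b) _ _ fun v => by simp).symm
  simp only [pauliExp, expVal, Matrix.trace, Matrix.diag_apply, Matrix.mul_apply, hop]
  congr 1
  let e : (Site L → Fin 2) ≃ (Site L → Fin 2) := (Equiv.addRight b).symm.arrowCongr (Equiv.refl _)
  have he : ∀ x : Site L → Fin 2, e x = fun a => x (a + b) := fun x => by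
    funext a; simp [e, Equiv.arrowCongr]
  refine Fintype.sum_equiv e _ _ fun x => Fintype.sum_equiv e _ _ fun y => ?_
  rw [he, he, hρ.mat_shift b y x]

end Translation

/-! ### Expectations over classical shadows -/

section Shadow

variable {V : Type} [Fintype V] [DecidableEq V]

lemma snapshotExp_I (c : MeasBasis × ℤˣ) : snapshotExp Pauli.I c = 1 := by
  obtain ⟨W, o⟩ := c
  rw [snapshotExp, trace_mul_two]
  rcases Int.units_eq_one_or o with rfl | rfl <;> cases W <;>
    simp [snapshot, MeasBasis.mat, Pauli.mat] <;> norm_num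

lemma abs_snapshotExp_le (Q : Pauli) (c : MeasBasis × ℤˣ) : |snapshotExp Q c| ≤ 3 := by
  obtain ⟨W, o⟩ := c
  rw [snapshotExp, trace_mul_two]
  rcases Int.units_eq_one_or o with rfl | rfl <;> cases W <;> cases Q <;>
    simp [snapshot, MeasBasis.mat, Pauli.mat] <;> norm_num

lemma sum_measBasis_units {M : Type*} [AddCommMonoid M] (f : MeasBasis × ℤˣ → M) :
    ∑ c, f c = (f (.X, 1) + f (.X, -1)) + ((f (.Y, 1) + f (.Y, -1)) +
      (f (.Z, 1) + f (.Z, -1))) := by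
  have h : ∀ f : MeasBasis → M, ∑ W, f W = f .X + (f .Y + f .Z) := by
    intro f
    have : (Finset.univ : Finset MeasBasis) = {.X, .Y, .Z} := rfl
    rw [this]
    simp
  have h2 : ∀ f : ℤˣ → M, ∑ o, f o = f 1 + f (-1) := by
    intro f
    have : (Finset.univ : Finset ℤˣ) = {1, -1} := rfl
    rw [this, Finset.sum_pair (by decide)]
  rw [Fintype.sum_prod_type, h]
  simp only [h2]

/-- Inversion of the one-qubit measurement channel: the 3 on the right cancels the probability 1/3
of each basis. -/
lemma sum_snapshotExp_smul_outcomeProj (Q : Pauli) :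
    ∑ c, (snapshotExp Q c : ℂ) • outcomeProj c = (3 : ℂ) • Q.mat := by
  simp only [← trace_pauli_snapshot, trace_mul_two]
  rw [sum_measBasis_units]
  cases Q <;> ext i j <;> fin_cases i <;> fin_cases j <;>
    simp [outcomeProj, snapshot, MeasBasis.mat, Pauli.mat] <;> ring_nf <;> simp

/-- Unbiasedness of the shadow estimator. The sum over rounds factorizes over qubits, and on each
qubit the channel inversion reproduces the Pauli matrix. -/
lemma sum_roundProb_mul_prod (ρ : DensityMatrix V) (P : PauliString V) :
    ∑ r : Round V, roundProb ρ r * ∏ v, snapshotExp (P v) (r v) = pauliExp ρ P := by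
  have h : ∑ r : Round V, ((∏ v, snapshotExp (P v) (r v) : ℝ) : ℂ) •
      tensorOp (fun v => outcomeProj (r v)) = ((3 : ℂ) ^ Fintype.card V) • P.op := by
    ext x y
    have h1 : ∏ v, (∑ c : MeasBasis × ℤˣ, (snapshotExp (P v) c : ℂ) • outcomeProj c) (x v) (y v) =
        ∑ r : Round V, ∏ v, (snapshotExp (P v) (r v) : ℂ) * outcomeProj (r v) (x v) (y v) := by
      simp only [Matrix.sum_apply, Matrix.smul_apply, smul_eq_mul]
      rw [Finset.prod_univ_sum]
      simp
    rw [Matrix.sum_apply]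
    simp only [tensorOp, Matrix.smul_apply, Matrix.of_apply, smul_eq_mul, Complex.ofReal_prod,
      ← Finset.prod_mul_distrib]
    rw [← h1]
    simp only [sum_snapshotExp_smul_outcomeProj, Matrix.smul_apply, smul_eq_mul,
      Finset.prod_mul_distrib, Finset.prod_const, Finset.card_univ, PauliString.op, tensorOp,
      Matrix.of_apply]
  have h2 := congrArg (fun O => (expVal ρ O).re) h
  simp only [expVal_sum, expVal_smul, expVal_pauli, Complex.re_sum, Complex.re_ofReal_mul] at h2
  have h3 : ((3 : ℂ) ^ Fintype.card V * (pauliExp ρ P : ℂ)).re =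
      (3 : ℝ) ^ Fintype.card V * pauliExp ρ P := by
    rw [show ((3 : ℂ) ^ Fintype.card V) = (((3 : ℝ) ^ Fintype.card V : ℝ) : ℂ) by push_cast; rfl,
      ← Complex.ofReal_mul, Complex.ofReal_re]
  rw [h3] at h2
  calc ∑ r : Round V, roundProb ρ r * ∏ v, snapshotExp (P v) (r v)
      = (1 / 3 : ℝ) ^ Fintype.card V * ∑ r : Round V, (∏ v, snapshotExp (P v) (r v)) *
          (expVal ρ (tensorOp fun v => outcomeProj (r v))).re := by
        rw [Finset.mul_sum]
        refine Finset.sum_congr rfl fun r _ => ?_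
        rw [roundProb]; ring
    _ = pauliExp ρ P := by
        rw [h2, ← mul_assoc, ← mul_pow]
        norm_num

lemma abs_prod_snapshotExp_le (P : PauliString V) (r : Round V) :
    |∏ v, snapshotExp (P v) (r v)| ≤ 3 ^ P.supp.card := by
  rw [Finset.abs_prod, ← Finset.prod_subset (Finset.subset_univ P.supp)]
  · exact (Finset.prod_le_prod (fun _ _ => abs_nonneg _) fun v _ => abs_snapshotExp_le _ _).trans
      (by rw [Finset.prod_const])
  · intro v _ hv
    have : P v = Pauli.I := by
      by_contra h
      exact hv (PauliString.mem_supp.2 h)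
    rw [this, snapshotExp_I, abs_one]

lemma sum_shadowProb_mul_prod {T : ℕ} (ρ : DensityMatrix V) (f : Round V → ℝ) :
    ∑ S : Shadow V T, shadowProb ρ S * ∏ t, f (S t) = (∑ r, roundProb ρ r * f r) ^ T := by
  have h : ∏ _t : Fin T, ∑ r : Round V, roundProb ρ r * f r =
      ∑ S : Fin T → Round V, ∏ t, (roundProb ρ (S t) * f (S t)) := by
    rw [Finset.prod_univ_sum]
    simp
  rw [Finset.prod_const, Finset.card_univ, Fintype.card_fin] at h
  rw [h]
  refine Finset.sum_congr rfl fun S _ => ?_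
  rw [shadowProb, Finset.prod_mul_distrib]

/-- The convex exponential lies below its chord over [-b, b]. The bound is affine in x, so for a
centred variable its expectation is cosh(s b). -/
lemma exp_mul_le_of_abs_le {b s x : ℝ} (hb : 0 < b) (hx : |x| ≤ b) :
    Real.exp (s * x) ≤ Real.cosh (s * b) + x / b * Real.sinh (s * b) := by
  obtain ⟨h1, h2⟩ := abs_le.1 hx
  have w1 : 0 ≤ (b + x) / (2 * b) := div_nonneg (by linarith) (by linarith)
  have w2 : 0 ≤ (b - x) / (2 * b) := div_nonneg (by linarith) (by linarith)
  have w3 : (b + x) / (2 * b) + (b - x) / (2 * b) = 1 := by field_simp; ring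
  have h := convexOn_exp.2 (Set.mem_univ (s * b)) (Set.mem_univ (-(s * b))) w1 w2 w3
  have e : ((b + x) / (2 * b)) • (s * b) + ((b - x) / (2 * b)) • (-(s * b)) = s * x := by
    simp only [smul_eq_mul]; field_simp; ring
  rw [e] at h
  refine h.trans (le_of_eq ?_)
  rw [Real.cosh_eq, Real.sinh_eq, smul_eq_mul, smul_eq_mul]
  field_simp
  ring

lemma sum_roundProb_exp_le (ρ : DensityMatrix V) {h : Round V → ℝ} {b : ℝ} (hb : 0 < b)
    (hh : ∀ r, |h r| ≤ b) (h0 : ∑ r, roundProb ρ r * h r = 0) (s : ℝ) :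
    ∑ r, roundProb ρ r * Real.exp (s * h r) ≤ Real.exp ((s * b) ^ 2 / 2) := by
  calc ∑ r, roundProb ρ r * Real.exp (s * h r)
      ≤ ∑ r, roundProb ρ r * (Real.cosh (s * b) + h r / b * Real.sinh (s * b)) :=
        Finset.sum_le_sum fun r _ =>
          mul_le_mul_of_nonneg_left (exp_mul_le_of_abs_le hb (hh r)) (roundProb_nonneg ρ r)
    _ = Real.cosh (s * b) * ∑ r, roundProb ρ r +
          Real.sinh (s * b) / b * ∑ r, roundProb ρ r * h r := by
        rw [Finset.mul_sum, Finset.mul_sum, ← Finset.sum_add_distrib]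
        refine Finset.sum_congr rfl fun r _ => ?_
        ring
    _ = Real.cosh (s * b) := by rw [sum_roundProb, h0]; ring
    _ ≤ _ := Real.cosh_le_exp_half_sq _

/-- An exponential moment bound of Hoeffding type for sums over the rounds of a shadow. -/
lemma sum_shadowProb_exp_le {T : ℕ} (ρ : DensityMatrix V) {h : Round V → ℝ} {b : ℝ} (hb : 0 < b)
    (hh : ∀ r, |h r| ≤ b) (h0 : ∑ r, roundProb ρ r * h r = 0) (η : ℝ) :
    ∑ S : Shadow V T, shadowProb ρ S * Real.exp (η / b ^ 2 * ∑ t, (h (S t) - η)) ≤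
      Real.exp (-(T * η ^ 2 / (2 * b ^ 2))) := by
  have e1 : ∀ S : Shadow V T, Real.exp (η / b ^ 2 * ∑ t, (h (S t) - η)) =
      Real.exp (-(T * η ^ 2 / b ^ 2)) * ∏ t, Real.exp (η / b ^ 2 * h (S t)) := by
    intro S
    rw [← Real.exp_sum, ← Real.exp_add, Finset.sum_sub_distrib, ← Finset.mul_sum]
    simp only [Finset.sum_const, Finset.card_univ, Fintype.card_fin, nsmul_eq_mul]
    congr 1
    ring
  have e2 : ∑ S : Shadow V T, shadowProb ρ S * Real.exp (η / b ^ 2 * ∑ t, (h (S t) - η)) =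
      Real.exp (-(T * η ^ 2 / b ^ 2)) *
        (∑ r, roundProb ρ r * Real.exp (η / b ^ 2 * h r)) ^ T := by
    rw [← sum_shadowProb_mul_prod, Finset.mul_sum]
    refine Finset.sum_congr rfl fun S _ => ?_
    rw [e1]; ring
  rw [e2]
  have e3 := sum_roundProb_exp_le ρ hb hh h0 (η / b ^ 2)
  have e4 : 0 ≤ ∑ r, roundProb ρ r * Real.exp (η / b ^ 2 * h r) :=
    Finset.sum_nonneg fun r _ => mul_nonneg (roundProb_nonneg ρ r) (Real.exp_pos _).le
  -- The parameter s = η/b² minimizes the Chernoff exponent T (s² b²/2 - s η), whose minimum is -T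
  -- η²/(2 b²).
  calc _ ≤ Real.exp (-(T * η ^ 2 / b ^ 2)) * Real.exp ((η / b ^ 2 * b) ^ 2 / 2) ^ T := by gcongr
    _ = _ := by
      rw [← Real.exp_nat_mul, ← Real.exp_add]
      congr 1
      field_simp
      ring

end Shadow

lemma abs_prod_sub_prod_le {d : ℕ} {F f : Fin d → ℝ} {η : ℝ} (hη : 0 ≤ η)
    (hf : ∀ k, |f k| ≤ 1) (hF : ∀ k, |F k - f k| ≤ η) :
    |∏ k, F k - ∏ k, f k| ≤ (1 + η) ^ d - 1 := by
  induction d with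
  | zero => simp
  | succ d ih =>
    rw [Fin.prod_univ_succ, Fin.prod_univ_succ]
    have h1 := ih (fun k => hf k.succ) (fun k => hF k.succ)
    have h2 : |F 0| ≤ 1 + η := by
      calc |F 0| = |f 0 + (F 0 - f 0)| := by ring_nf
        _ ≤ _ := (abs_add_le _ _).trans (add_le_add (hf 0) (hF 0))
    have h3 : |∏ k : Fin d, f k.succ| ≤ 1 := by
      rw [Finset.abs_prod]
      exact Finset.prod_le_one (fun _ _ => abs_nonneg _) fun k _ => hf _
    calc |F 0 * ∏ k : Fin d, F k.succ - f 0 * ∏ k : Fin d, f k.succ|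
        = |F 0 * (∏ k : Fin d, F k.succ - ∏ k : Fin d, f k.succ) +
            (F 0 - f 0) * ∏ k : Fin d, f k.succ| := by ring_nf
      _ ≤ |F 0| * |∏ k : Fin d, F k.succ - ∏ k : Fin d, f k.succ| +
            |F 0 - f 0| * |∏ k : Fin d, f k.succ| := by
          rw [← abs_mul, ← abs_mul]; exact abs_add_le _ _
      _ ≤ (1 + η) * ((1 + η) ^ d - 1) + η * 1 := by
          gcongr
          exact hF 0
      _ = _ := by ring

/-! ### The translation-averaged estimators -/

section Estimate

variable {D : ℕ} {L : Fin D → ℕ} [∀ μ, NeZero (L μ)] {T : ℕ}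

/-- The translation-averaged estimate of `tr(P ρ)` from one round. -/
def roundEstimate (P : PauliString (Site L)) (r : Round (Site L)) : ℝ :=
  1 / (Fintype.card (Site L) : ℝ) * ∑ a : Site L, ∏ v, snapshotExp (P v) (r (v + a))

/-- The translation-averaged estimate of `tr(P ρ)` from a shadow. -/
def shadowEstimate (P : PauliString (Site L)) (S : Shadow (Site L) T) : ℝ :=
  1 / (T : ℝ) * ∑ t, roundEstimate P (S t)

lemma prod_snapshotExp_shift (P : PauliString (Site L)) (r : Round (Site L)) (a : Site L) :
    ∏ v, snapshotExp (P v) (r (v + a)) = ∏ v, snapshotExp (P (v - a)) (r v) :=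
  Fintype.prod_equiv (Equiv.addRight a) _ _ fun v => by simp

/-- Each summand estimates a translate of `P` without bias, and all translates have the same
expectation in a translation-invariant state. -/
lemma sum_roundProb_roundEstimate {ρ : DensityMatrix (Site L)} (hρ : TranslationSymmetric ρ)
    (P : PauliString (Site L)) : ∑ r, roundProb ρ r * roundEstimate P r = pauliExp ρ P := by
  have h : ∀ r, roundProb ρ r * roundEstimate P r = 1 / (Fintype.card (Site L) : ℝ) *
      ∑ a : Site L, roundProb ρ r * ∏ v, snapshotExp (P (v - a)) (r v) := by
    intro r
    simp only [roundEstimate, prod_snapshotExp_shift, Finset.mul_sum]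
    refine Finset.sum_congr rfl fun a _ => ?_
    ring
  simp only [h]
  rw [← Finset.mul_sum, Finset.sum_comm]
  have h2 : ∀ a : Site L, ∑ r : Round (Site L),
      roundProb ρ r * ∏ v, snapshotExp (P (v - a)) (r v) = pauliExp ρ P := fun a => by
    rw [sum_roundProb_mul_prod ρ fun v => P (v - a), hρ.pauliExp_shift]
  simp only [h2, Finset.sum_const, Finset.card_univ, nsmul_eq_mul]
  have : (Fintype.card (Site L) : ℝ) ≠ 0 := by exact_mod_cast Fintype.card_ne_zero
  field_simp

lemma card_supp_shift (P : PauliString (Site L)) (a : Site L) :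
    (PauliString.supp fun v => P (v - a)).card = P.supp.card := by
  refine Finset.card_bij (fun v _ => v - a) ?_ ?_ ?_
  · intro v hv
    have h : P (v - a) ≠ Pauli.I := (PauliString.mem_supp (P := fun v => P (v - a))).1 hv
    exact PauliString.mem_supp.2 h
  · intro v _ w _ h
    exact sub_left_injective h
  · intro v hv
    exact ⟨v + a, PauliString.mem_supp.2 (by simpa using PauliString.mem_supp.1 hv), by simp⟩

lemma abs_average_le {ι : Type*} [Fintype ι] {f : ι → ℝ} {b : ℝ} (hb : 0 ≤ b)
    (hf : ∀ i, |f i| ≤ b) : |1 / (Fintype.card ι : ℝ) * ∑ i, f i| ≤ b := by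
  rw [abs_mul, abs_of_nonneg (by positivity : (0 : ℝ) ≤ 1 / (Fintype.card ι : ℝ))]
  have h : |∑ i, f i| ≤ Fintype.card ι * b := by
    refine (Finset.abs_sum_le_sum_abs _ _).trans ((Finset.sum_le_sum fun i _ => hf i).trans ?_)
    simp
  rcases (Nat.zero_le (Fintype.card ι)).eq_or_lt with h0 | h0
  · rw [← h0]; simpa using hb
  · have : (0 : ℝ) < Fintype.card ι := by exact_mod_cast h0
    rw [div_mul_eq_mul_div, one_mul, div_le_iff₀ this]
    linarith

lemma abs_roundEstimate_le (P : PauliString (Site L)) (r : Round (Site L)) :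
    |roundEstimate P r| ≤ 3 ^ P.supp.card := by
  refine abs_average_le (by positivity) fun a => ?_
  rw [prod_snapshotExp_shift, ← card_supp_shift P a]
  exact abs_prod_snapshotExp_le (fun v => P (v - a)) r

lemma abs_shadowEstimate_le (P : PauliString (Site L)) (S : Shadow (Site L) T) :
    |shadowEstimate P S| ≤ 3 ^ P.supp.card := by
  have h := abs_average_le (by positivity) fun t : Fin T => abs_roundEstimate_le P (S t)
  rwa [Fintype.card_fin] at h

/-- The tail of the estimator, in the form of an exponential moment. -/
lemma sum_shadowProb_tail_le {ρ : DensityMatrix (Site L)} (hρ : TranslationSymmetric ρ) {m : ℕ}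
    (P : PauliString (Site L)) (hP : P.supp.card ≤ m) {s : ℝ} (hs : |s| = 1) (η : ℝ) :
    ∑ S : Shadow (Site L) T, shadowProb ρ S * Real.exp (η / (3 ^ m + 1) ^ 2 *
        ∑ t, (s * (roundEstimate P (S t) - pauliExp ρ P) - η)) ≤
      Real.exp (-(T * η ^ 2 / (2 * (3 ^ m + 1) ^ 2))) := by
  refine sum_shadowProb_exp_le ρ (h := fun r => s * (roundEstimate P r - pauliExp ρ P))
    (by positivity) (fun r => ?_) ?_ η
  · rw [abs_mul, hs, one_mul]
    refine (abs_sub _ _).trans (add_le_add ((abs_roundEstimate_le P r).trans ?_)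
      (abs_pauliExp_le_one ρ P))
    exact pow_le_pow_right₀ (by norm_num) hP
  · have : ∀ r, roundProb ρ r * (s * (roundEstimate P r - pauliExp ρ P)) =
        s * (roundProb ρ r * roundEstimate P r) - s * pauliExp ρ P * roundProb ρ r := by
      intro r; ring
    simp only [this]
    rw [Finset.sum_sub_distrib, ← Finset.mul_sum, ← Finset.mul_sum,
      sum_roundProb_roundEstimate hρ, sum_roundProb]
    ring

/-- The mean squared error of a product of estimators. -/
lemma sum_shadowProb_sq_prod_sub_le {ρ : DensityMatrix (Site L)} (hρ : TranslationSymmetric ρ)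
    {m R d : ℕ} (q : Fin d → PauliString (Site L)) (hm : ∀ k, (q k).supp.card ≤ m)
    (hR : ∑ k, (q k).supp.card ≤ R) (hT : 0 < T) {η : ℝ} (hη : 0 < η) :
    ∑ S : Shadow (Site L) T, shadowProb ρ S *
        (∏ k, shadowEstimate (q k) S - ∏ k, pauliExp ρ (q k)) ^ 2 ≤
      ((1 + η) ^ d - 1) ^ 2 +
        (3 ^ R + 1) ^ 2 * (2 * d * Real.exp (-(T * η ^ 2 / (2 * (3 ^ m + 1) ^ 2)))) := by
  set c : ℝ := η / (3 ^ m + 1) ^ 2 with hc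
  have hc0 : 0 < c := by positivity
  have hT' : (0 : ℝ) < T := by exact_mod_cast hT
  let U : ℝ → Fin d → Shadow (Site L) T → ℝ := fun s k S =>
    Real.exp (c * ∑ t, (s * (roundEstimate (q k) (S t) - pauliExp ρ (q k)) - η))
  have hU : ∀ s k S, U s k S = Real.exp (c * T *
      (s * (shadowEstimate (q k) S - pauliExp ρ (q k)) - η)) := by
    intro s k S
    simp only [U, shadowEstimate]
    rw [Finset.sum_sub_distrib, ← Finset.mul_sum, Finset.sum_sub_distrib]
    simp only [Finset.sum_const, Finset.card_univ, Fintype.card_fin, nsmul_eq_mul]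
    congr 1
    field_simp
  -- The exponentials replace a union bound: if some estimator is off by more than η, one of the 2d
  -- exponentials is at least 1, so their sum dominates the indicator of the bad event. There the
  -- crude bound 3^R + 1 on the error suffices, because its weight is exponentially small in T.
  have hpt : ∀ S : Shadow (Site L) T,
      (∏ k, shadowEstimate (q k) S - ∏ k, pauliExp ρ (q k)) ^ 2 ≤
        ((1 + η) ^ d - 1) ^ 2 + (3 ^ R + 1) ^ 2 * ∑ k, (U 1 k S + U (-1) k S) := by
    intro S
    have hU0 : ∀ k, 0 ≤ U 1 k S + U (-1) k S := fun k =>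
      add_nonneg (Real.exp_pos _).le (Real.exp_pos _).le
    by_cases hgood : ∀ k, |shadowEstimate (q k) S - pauliExp ρ (q k)| ≤ η
    · have h1 := abs_prod_sub_prod_le hη.le (fun k => abs_pauliExp_le_one ρ (q k)) hgood
      have h2 : (∏ k, shadowEstimate (q k) S - ∏ k, pauliExp ρ (q k)) ^ 2 ≤
          ((1 + η) ^ d - 1) ^ 2 := by
        rw [← sq_abs]
        gcongr
      have h3 : 0 ≤ (3 ^ R + 1 : ℝ) ^ 2 * ∑ k, (U 1 k S + U (-1) k S) :=
        mul_nonneg (by positivity) (Finset.sum_nonneg fun k _ => hU0 k)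
      linarith
    · push Not at hgood
      obtain ⟨k, hk⟩ := hgood
      have h1 : 1 ≤ U 1 k S + U (-1) k S := by
        rcases lt_abs.1 hk with h | h
        · have : 1 ≤ U 1 k S := by
            rw [hU]
            exact Real.one_le_exp (mul_nonneg (by positivity) (by linarith))
          exact this.trans (le_add_of_nonneg_right (Real.exp_pos _).le)
        · have : 1 ≤ U (-1) k S := by
            rw [hU]
            exact Real.one_le_exp (mul_nonneg (by positivity) (by linarith))
          exact this.trans (le_add_of_nonneg_left (Real.exp_pos _).le)
      have h2 : 1 ≤ ∑ k, (U 1 k S + U (-1) k S) :=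
        h1.trans (Finset.single_le_sum (fun k _ => hU0 k) (Finset.mem_univ k))
      have h3 : |∏ k, shadowEstimate (q k) S - ∏ k, pauliExp ρ (q k)| ≤ 3 ^ R + 1 := by
        refine (abs_sub _ _).trans (add_le_add ?_ ?_)
        · rw [Finset.abs_prod]
          refine (Finset.prod_le_prod (fun _ _ => abs_nonneg _)
            fun k _ => abs_shadowEstimate_le (q k) S).trans ?_
          rw [Finset.prod_pow_eq_pow_sum]
          exact pow_le_pow_right₀ (by norm_num) hR
        · rw [Finset.abs_prod]
          exact Finset.prod_le_one (fun _ _ => abs_nonneg _) fun k _ => abs_pauliExp_le_one _ _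
      have h4 : (∏ k, shadowEstimate (q k) S - ∏ k, pauliExp ρ (q k)) ^ 2 ≤
          (3 ^ R + 1) ^ 2 := by
        rw [← sq_abs]
        gcongr
      have h5 : (3 ^ R + 1 : ℝ) ^ 2 * 1 ≤ (3 ^ R + 1) ^ 2 * ∑ k, (U 1 k S + U (-1) k S) := by
        gcongr
      nlinarith [sq_nonneg ((1 + η) ^ d - 1)]
  have htail : ∀ s : ℝ, |s| = 1 → ∀ k, ∑ S : Shadow (Site L) T, shadowProb ρ S * U s k S ≤
      Real.exp (-(T * η ^ 2 / (2 * (3 ^ m + 1) ^ 2))) := fun s hs k =>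
    sum_shadowProb_tail_le hρ (q k) (hm k) hs η
  calc _ ≤ ∑ S : Shadow (Site L) T, shadowProb ρ S *
        (((1 + η) ^ d - 1) ^ 2 + (3 ^ R + 1) ^ 2 * ∑ k, (U 1 k S + U (-1) k S)) :=
        Finset.sum_le_sum fun S _ => mul_le_mul_of_nonneg_left (hpt S) (shadowProb_nonneg ρ S)
    _ = ((1 + η) ^ d - 1) ^ 2 + (3 ^ R + 1) ^ 2 * ∑ k,
        (∑ S : Shadow (Site L) T, shadowProb ρ S * U 1 k S +
          ∑ S : Shadow (Site L) T, shadowProb ρ S * U (-1) k S) := by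
      have e : ∀ S : Shadow (Site L) T, shadowProb ρ S *
          (((1 + η) ^ d - 1) ^ 2 + (3 ^ R + 1) ^ 2 * ∑ k, (U 1 k S + U (-1) k S)) =
          ((1 + η) ^ d - 1) ^ 2 * shadowProb ρ S + (3 ^ R + 1) ^ 2 *
            ∑ k, (shadowProb ρ S * U 1 k S + shadowProb ρ S * U (-1) k S) := by
        intro S
        simp only [← mul_add]
        rw [← Finset.mul_sum]
        ring
      simp only [e]
      rw [Finset.sum_add_distrib, ← Finset.mul_sum, ← Finset.mul_sum, sum_shadowProb, mul_one,
        Finset.sum_comm]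
      simp only [Finset.sum_add_distrib]
    _ ≤ ((1 + η) ^ d - 1) ^ 2 + (3 ^ R + 1) ^ 2 * ∑ _k : Fin d,
        (Real.exp (-(T * η ^ 2 / (2 * (3 ^ m + 1) ^ 2))) +
          Real.exp (-(T * η ^ 2 / (2 * (3 ^ m + 1) ^ 2)))) := by
      gcongr with k _
      · exact htail 1 (by simp) k
      · exact htail (-1) (by simp) k
    _ = _ := by
      simp only [Finset.sum_const, Finset.card_univ, Fintype.card_fin, nsmul_eq_mul]
      ring

end Estimate

/-! ### The weight vector of a product of estimators -/

section Weight

variable {D : ℕ} {L : Fin D → ℕ} [∀ μ, NeZero (L μ)] {d : ℕ}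

/-- The feature index of the translates by `a k` of the Pauli strings `q k`. -/
def translateIndex (q : Fin d → PauliString (Site L)) (a : Fin d → Site L) :
    FeatureIndex (Site L) :=
  ⟨d, fun k => ⟨(q k).supp.card, fun l => ((q k).supp.equivFin.symm l).1 + a k,
    fun l => q k ((q k).supp.equivFin.symm l).1⟩⟩

/-- A nonempty support has a first site, whose position in the index reveals the shift; the identity
string would lose it. -/
lemma translateIndex_injective {q : Fin d → PauliString (Site L)}
    (hq : ∀ k, 0 < (q k).supp.card) : Function.Injective (translateIndex q) := by
  intro a b hab
  funext k
  have h1 := congrFun (eq_of_heq (Sigma.mk.inj hab).2) k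
  have h2 := congrFun (congrArg Prod.fst (eq_of_heq (Sigma.mk.inj h1).2)) ⟨0, hq k⟩
  exact add_left_cancel h2

/-- The factor between a component of the feature vector and a product of estimates. -/
def featureScale (τ γ : ℝ) (q : Fin d → PauliString (Site L)) : ℝ :=
  Real.sqrt (τ ^ d / (d.factorial : ℝ)) *
    ∏ k, (Real.sqrt (1 / ((q k).supp.card.factorial : ℝ) *
      (γ / (Fintype.card (Site L) : ℝ)) ^ (q k).supp.card) / Real.sqrt (2 ^ (q k).supp.card))

lemma featureScale_pos {τ γ : ℝ} (hτ : 0 < τ) (hγ : 0 < γ) (q : Fin d → PauliString (Site L)) :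
    0 < featureScale τ γ q := by
  have hn : (0 : ℝ) < Fintype.card (Site L) := by exact_mod_cast Fintype.card_pos
  refine mul_pos (Real.sqrt_pos.2 (by positivity)) (Finset.prod_pos fun k _ => ?_)
  exact div_pos (Real.sqrt_pos.2 (by positivity)) (Real.sqrt_pos.2 (by positivity))

lemma featureScale_sq {τ γ : ℝ} (hτ : 0 < τ) (hγ : 0 < γ) (q : Fin d → PauliString (Site L)) :
    featureScale τ γ q ^ 2 = τ ^ d / (d.factorial : ℝ) *
      ∏ k, (1 / ((q k).supp.card.factorial : ℝ) *
        (γ / (Fintype.card (Site L) : ℝ)) ^ (q k).supp.card / 2 ^ (q k).supp.card) := by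
  have hn : (0 : ℝ) < Fintype.card (Site L) := by exact_mod_cast Fintype.card_pos
  rw [featureScale, mul_pow, Real.sq_sqrt (by positivity), ← Finset.prod_pow]
  congr 1
  refine Finset.prod_congr rfl fun k _ => ?_
  rw [div_pow, Real.sq_sqrt (by positivity), Real.sq_sqrt (by positivity)]

lemma prod_equivFin_supp {M : Type*} [CommMonoid M] (P : PauliString (Site L)) (f : Site L → M)
    (hf : ∀ v, P v = Pauli.I → f v = 1) :
    ∏ l, f (P.supp.equivFin.symm l).1 = ∏ v, f v := by
  rw [Fintype.prod_equiv P.supp.equivFin.symm (fun l => f (P.supp.equivFin.symm l).1)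
    (fun v : P.supp => f v) (fun _ => rfl), Finset.prod_coe_sort P.supp f]
  refine Finset.prod_subset (Finset.subset_univ _) fun v _ hv => hf v ?_
  by_contra h
  exact hv (PauliString.mem_supp.2 h)

/-- Sites outside the support contribute tr(σ) = 1, so the product over the support extends to all
sites. The prefactor does not depend on `a`, so one scale serves all translates. -/
lemma localFeature_translate {T : ℕ} (γ : ℝ) (P : PauliString (Site L)) (a : Site L)
    (S : Shadow (Site L) T) :
    localFeature γ S ⟨P.supp.card, fun l => (P.supp.equivFin.symm l).1 + a,
        fun l => P (P.supp.equivFin.symm l).1⟩ =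
      Real.sqrt (1 / (P.supp.card.factorial : ℝ) *
        (γ / (Fintype.card (Site L) : ℝ)) ^ P.supp.card) / Real.sqrt (2 ^ P.supp.card) *
      (1 / (T : ℝ) * ∑ t, ∏ v, snapshotExp (P v) (S t (v + a))) := by
  have h : ∀ t, ∏ l, snapshotExp (P (P.supp.equivFin.symm l).1)
      (S t ((P.supp.equivFin.symm l).1 + a)) = ∏ v, snapshotExp (P v) (S t (v + a)) := fun t =>
    prod_equivFin_supp P (fun v => snapshotExp (P v) (S t (v + a))) fun v hv => by
      rw [hv, snapshotExp_I]
  simp only [localFeature, trace_pauli_reducedShadow, h]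
  ring

lemma featureComponent_translateIndex {T : ℕ} (τ γ : ℝ) (q : Fin d → PauliString (Site L))
    (a : Fin d → Site L) (S : Shadow (Site L) T) :
    featureComponent τ γ S (translateIndex q a) = featureScale τ γ q *
      ∏ k, (1 / (T : ℝ) * ∑ t, ∏ v, snapshotExp (q k v) (S t (v + a k))) := by
  rw [featureScale, mul_assoc, ← Finset.prod_mul_distrib]
  refine congrArg (Real.sqrt (τ ^ d / (d.factorial : ℝ)) * ·) ?_
  exact Finset.prod_congr rfl fun k _ => localFeature_translate γ (q k) (a k) S

open Classical in
/-- The vector of the feature space that computes the product of the estimates of the Pauli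
strings `q k`. -/
def productWeight (τ γ : ℝ) (q : Fin d → PauliString (Site L)) : FeatureSpace (Site L) :=
  ((featureScale τ γ q)⁻¹ * (1 / (Fintype.card (Site L) : ℝ)) ^ d) •
    ∑ a : Fin d → Site L, lp.single 2 (translateIndex q a) (1 : ℝ)

lemma shadowEstimate_eq {T : ℕ} (P : PauliString (Site L)) (S : Shadow (Site L) T) :
    shadowEstimate P S = 1 / (Fintype.card (Site L) : ℝ) * ∑ a : Site L,
      (1 / (T : ℝ) * ∑ t, ∏ v, snapshotExp (P v) (S t (v + a))) := by
  simp only [shadowEstimate, roundEstimate]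
  rw [← Finset.mul_sum, ← Finset.mul_sum, Finset.sum_comm]
  ring

open Classical in
lemma inner_productWeight {T : ℕ} {τ γ : ℝ} (hτ : 0 < τ) (hγ : 0 < γ)
    (q : Fin d → PauliString (Site L)) (S : Shadow (Site L) T) :
    inner ℝ (productWeight τ γ q) (shadowFeature hτ.le hγ.le S) = ∏ k, shadowEstimate (q k) S := by
  have h1 : ∀ a : Fin d → Site L,
      inner ℝ (lp.single 2 (translateIndex q a) (1 : ℝ)) (shadowFeature hτ.le hγ.le S) =
        featureComponent τ γ S (translateIndex q a) := by
    intro a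
    rw [lp.inner_single_left]
    simp [shadowFeature]
  rw [productWeight, inner_smul_left, sum_inner]
  -- A product of d averages over shifts is one average over d-tuples of shifts, and each tuple is a
  -- coordinate of the d-th tensor power.
  have h2 : ∏ k, shadowEstimate (q k) S = (1 / (Fintype.card (Site L) : ℝ)) ^ d *
      ∑ a : Fin d → Site L,
        ∏ k, (1 / (T : ℝ) * ∑ t, ∏ v, snapshotExp (q k v) (S t (v + a k))) := by
    simp only [shadowEstimate_eq]
    rw [Finset.prod_mul_distrib, Finset.prod_const, Finset.card_univ, Fintype.card_fin,
      Finset.prod_univ_sum, Fintype.piFinset_univ]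
  rw [h2, Finset.sum_congr rfl fun a _ => (h1 a).trans
    (featureComponent_translateIndex τ γ q a S), ← Finset.mul_sum, RCLike.conj_to_real]
  have h3 := (featureScale_pos hτ hγ q).ne'
  field_simp

open Classical in
-- The n^d coordinates involved are distinct, so their unit vectors are orthonormal.
lemma norm_productWeight_sq {τ γ : ℝ}
    {q : Fin d → PauliString (Site L)} (hq : ∀ k, 0 < (q k).supp.card) :
    ‖productWeight τ γ q‖ ^ 2 =
      ((featureScale τ γ q) ^ 2)⁻¹ * (1 / (Fintype.card (Site L) : ℝ)) ^ d := by
  have hn : (0 : ℝ) < Fintype.card (Site L) := by exact_mod_cast Fintype.card_pos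
  have h1 : ‖∑ a : Fin d → Site L, lp.single (E := fun _ : FeatureIndex (Site L) => ℝ) 2
      (translateIndex q a) (1 : ℝ)‖ ^ 2 = (Fintype.card (Site L) : ℝ) ^ d := by
    have h := lp.norm_sum_single (E := fun _ : FeatureIndex (Site L) => ℝ) (p := 2) (by norm_num)
      (fun _ => (1 : ℝ)) (Finset.univ.image (translateIndex q))
    rw [Finset.sum_image (translateIndex_injective hq).injOn, ENNReal.toReal_ofNat,
      Real.rpow_two] at h
    rw [h, Finset.sum_image (translateIndex_injective hq).injOn]
    simp
  rw [productWeight, norm_smul, mul_pow, h1, Real.norm_eq_abs, sq_abs, mul_pow, inv_pow, mul_assoc]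
  congr 1
  rw [← pow_mul, mul_comm d 2, pow_mul, ← mul_pow]
  congr 1
  field_simp

lemma norm_productWeight_sq_le {τ γ : ℝ} (hτ : 0 < τ) (hγ : 0 < γ) {K β : ℕ}
    {q : Fin d → PauliString (Site L)} (hq : ∀ k, 0 < (q k).supp.card)
    (hK : ∑ k, (q k).supp.card ≤ K) (hβ : ∑ k, (q k).supp.card + β ≤ K + d) (hβK : β ≤ K)
    (hγ2 : 1 ≤ 2 / γ) (hτ2 : 1 ≤ (K : ℝ) / τ) :
    ‖productWeight τ γ q‖ ^ 2 ≤ ((K : ℝ) / τ * K * (2 / γ)) ^ K *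
      (Fintype.card (Site L) : ℝ) ^ (K - β) := by
  set n : ℝ := (Fintype.card (Site L) : ℝ) with hn'
  have hn : (0 : ℝ) < n := by rw [hn']; exact_mod_cast Fintype.card_pos
  have hn1 : 1 ≤ n := by rw [hn']; exact_mod_cast Fintype.card_pos (α := Site L)
  set R := ∑ k, (q k).supp.card with hR
  have hdR : d ≤ R := by
    calc d = ∑ _k : Fin d, 1 := by simp
      _ ≤ R := Finset.sum_le_sum fun k _ => hq k
  have hK0 : (0 : ℝ) < K := by
    by_contra h
    have : (K : ℝ) = 0 := le_antisymm (not_lt.1 h) (by positivity)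
    rw [this, zero_div] at hτ2
    linarith
  have hK1 : (1 : ℝ) ≤ K := by exact_mod_cast Nat.one_le_iff_ne_zero.2 (by rintro rfl; simp at hK0)
  rw [norm_productWeight_sq hq, featureScale_sq hτ hγ]
  have e1 : ∏ k, (1 / ((q k).supp.card.factorial : ℝ) * (γ / n) ^ (q k).supp.card /
      2 ^ (q k).supp.card) = (∏ k, ((q k).supp.card.factorial : ℝ))⁻¹ * (γ / n / 2) ^ R := by
    rw [hR, ← Finset.prod_pow_eq_pow_sum, ← Finset.prod_inv_distrib, ← Finset.prod_mul_distrib]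
    refine Finset.prod_congr rfl fun k _ => ?_
    rw [div_pow (γ / n)]
    ring
  rw [e1]
  have f1 : ((d.factorial : ℕ) : ℝ) ≤ (K : ℝ) ^ d := by
    have : d.factorial ≤ d ^ d := Nat.factorial_le_pow d
    calc ((d.factorial : ℕ) : ℝ) ≤ (d : ℝ) ^ d := by exact_mod_cast this
      _ ≤ _ := by gcongr; exact hdR.trans hK
  have f2 : ∏ k, ((q k).supp.card.factorial : ℝ) ≤ (K : ℝ) ^ R := by
    rw [hR, ← Finset.prod_pow_eq_pow_sum]
    refine Finset.prod_le_prod (fun _ _ => by positivity) fun k _ => ?_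
    have h1 : (q k).supp.card.factorial ≤ (q k).supp.card ^ (q k).supp.card :=
      Nat.factorial_le_pow _
    have h2 : (q k).supp.card ≤ K :=
      (Finset.single_le_sum (f := fun k => (q k).supp.card) (fun _ _ => Nat.zero_le _)
        (Finset.mem_univ k)).trans hK
    calc (((q k).supp.card.factorial : ℕ) : ℝ) ≤ ((q k).supp.card : ℝ) ^ (q k).supp.card := by
          exact_mod_cast h1
      _ ≤ _ := by gcongr
  -- The inverse squared scale contributes n^R through (γ/n)^R, and averaging over n^d coordinates
  -- contributes n^(-d).
  have e2 : (τ ^ d / (d.factorial : ℝ) * ((∏ k, ((q k).supp.card.factorial : ℝ))⁻¹ *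
      (γ / n / 2) ^ R))⁻¹ * (1 / n) ^ d =
      ((d.factorial : ℝ) / τ ^ d) * (∏ k, ((q k).supp.card.factorial : ℝ)) * (2 / γ) ^ R *
        n ^ (R - d) := by
    rw [mul_inv, mul_inv, inv_inv, inv_div, ← inv_pow, pow_sub₀ _ hn.ne' hdR,
      show (γ / n / 2)⁻¹ = 2 / γ * n by field_simp, mul_pow, one_div, inv_pow]
    ring
  rw [e2]
  calc _ ≤ ((K : ℝ) ^ d / τ ^ d) * (K : ℝ) ^ R * (2 / γ) ^ R * n ^ (K - β) := by
        -- `hβ` states R + β ≤ K + d, that is R - d ≤ K - β, since d ≤ R and β ≤ K make both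
        -- subtractions genuine.
        refine mul_le_mul ?_ (pow_le_pow_right₀ hn1 (by omega)) (by positivity) (by positivity)
        gcongr
    _ = ((K : ℝ) / τ) ^ d * (K : ℝ) ^ R * (2 / γ) ^ R * n ^ (K - β) := by rw [div_pow (K : ℝ) τ]
    -- The bases K/τ, K and 2/γ are all at least 1, so the exponents d and R may be raised to K.
    _ ≤ ((K : ℝ) / τ) ^ K * (K : ℝ) ^ K * (2 / γ) ^ K * n ^ (K - β) := by
        gcongr
        exact hdR.trans hK
    _ = _ := by rw [mul_pow, mul_pow]

end Weight

lemma multiset_exists_eq_map_univ {α : Type*} (M : Multiset α) :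
    ∃ q : Fin (Multiset.card M) → α, M = Finset.univ.val.map q := by
  obtain ⟨l, rfl⟩ : ∃ l : List α, M = l := ⟨M.toList, M.coe_toList.symm⟩
  have h : (l : Multiset α) = Finset.univ.val.map l.get := by
    rw [Fin.univ_val_map, List.ofFn_get]
  exact ⟨l.get, h⟩

/-! ### The cluster approximation of a polynomial -/

section ClusterApproximation

variable {D : ℕ} {L : Fin D → ℕ} [∀ μ, NeZero (L μ)] {p : ℕ}

open Classical in
lemma prod_map_clusterFactors {M : Type*} [CommMonoid M] (δ : ℝ)
    (g : PauliPolynomial (Site L) p) (i : Fin g.numTerms) (f : PauliString (Site L) → M) :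
    ((clusterFactors δ g i).map f).prod = ∏ j, ∏ Q, f (clusterString δ (g.str i j) Q) := by
  have h : (clusterFactors δ g i).map f = ∑ j, (Finset.univ : Finset
      (clusterGraph δ (g.str i j)).ConnectedComponent).val.map
        fun Q => f (clusterString δ (g.str i j) Q) := by
    rw [clusterFactors, ← Multiset.coe_mapAddMonoidHom, map_sum]
    simp only [Multiset.coe_mapAddMonoidHom, Multiset.map_map, Function.comp_def]
  rw [h, Multiset.prod_sum]
  rfl

open Classical in
lemma sum_map_clusterFactors {M : Type*} [AddCommMonoid M] (δ : ℝ)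
    (g : PauliPolynomial (Site L) p) (i : Fin g.numTerms) (f : PauliString (Site L) → M) :
    ((clusterFactors δ g i).map f).sum = ∑ j, ∑ Q, f (clusterString δ (g.str i j) Q) :=
  prod_map_clusterFactors (M := Multiplicative M) δ g i f

open Classical in
lemma card_clusterFactors (δ : ℝ) (g : PauliPolynomial (Site L) p) (i : Fin g.numTerms) :
    Multiset.card (clusterFactors δ g i) =
      ∑ j, Fintype.card (clusterGraph δ (g.str i j)).ConnectedComponent := by
  have h := sum_map_clusterFactors δ g i fun _ => 1
  rw [Multiset.map_const', Multiset.sum_replicate] at h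
  simpa using h

lemma mem_clusterFactors {δ : ℝ} {g : PauliPolynomial (Site L) p} {i : Fin g.numTerms}
    {P : PauliString (Site L)} (h : P ∈ clusterFactors δ g i) :
    ∃ j Q, P = clusterString δ (g.str i j) Q := by
  rw [clusterFactors, Multiset.mem_sum] at h
  obtain ⟨j, _, hj⟩ := h
  obtain ⟨Q, _, hQ⟩ := Multiset.mem_map.1 hj
  exact ⟨j, Q, hQ.symm⟩

lemma abs_prod_sub_prod_le_sum {ι : Type*} (s : Finset ι) {a b : ι → ℝ} (ha : ∀ i, |a i| ≤ 1)
    (hb : ∀ i, |b i| ≤ 1) : |∏ i ∈ s, a i - ∏ i ∈ s, b i| ≤ ∑ i ∈ s, |a i - b i| := by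
  classical
  induction s using Finset.induction_on with
  | empty => simp
  | insert j s hj ih =>
    rw [Finset.prod_insert hj, Finset.prod_insert hj, Finset.sum_insert hj]
    have h1 : |∏ i ∈ s, b i| ≤ 1 := by
      rw [Finset.abs_prod]
      exact Finset.prod_le_one (fun _ _ => abs_nonneg _) fun i _ => hb i
    calc |a j * ∏ i ∈ s, a i - b j * ∏ i ∈ s, b i|
        = |(a j - b j) * ∏ i ∈ s, b i + a j * (∏ i ∈ s, a i - ∏ i ∈ s, b i)| := by ring_nf
      _ ≤ |a j - b j| * |∏ i ∈ s, b i| + |a j| * |∏ i ∈ s, a i - ∏ i ∈ s, b i| := by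
          rw [← abs_mul, ← abs_mul]; exact abs_add_le _ _
      _ ≤ |a j - b j| * 1 + 1 * ∑ i ∈ s, |a i - b i| := by
          gcongr
          exact ha j
      _ = _ := by ring

/-- An enumeration of the factors of the `i`-th term of the cluster approximation. -/
lemma exists_factors (δ : ℝ) {m : ℕ} (hm : 1 ≤ m) {g : PauliPolynomial (Site L) p}
    (hg : g.IsBody m) (i : Fin g.numTerms) :
    ∃ q : Fin (Multiset.card (clusterFactors δ g i)) → PauliString (Site L),
      (∀ k, 0 < (q k).supp.card) ∧ (∀ k, (q k).supp.card ≤ m) ∧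
      ∑ k, (q k).supp.card ≤ m * p ∧
      ∑ k, (q k).supp.card + p ≤ m * p + Multiset.card (clusterFactors δ g i) ∧
      Multiset.card (clusterFactors δ g i) ≤ m * p ∧
      ∀ {ξ : ℝ} {ρ : DensityMatrix (Site L)}, 0 < ξ → ExpClustering ξ ρ →
        |∏ j, pauliExp ρ (g.str i j) - ∏ k, pauliExp ρ (q k)| ≤
          (m * p : ℕ) * Real.exp (-δ / ξ) := by
  classical
  obtain ⟨q, hq⟩ := multiset_exists_eq_map_univ (clusterFactors δ g i)
  have hmem : ∀ k, q k ∈ clusterFactors δ g i := by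
    intro k
    have : q k ∈ Finset.univ.val.map q := Multiset.mem_map.2 ⟨k, Finset.mem_univ k, rfl⟩
    rw [hq]
    exact this
  have hsum : ∑ k, (q k).supp.card = ∑ j, (g.str i j).supp.card := by
    have h1 : ((Finset.univ.val.map q).map fun P => P.supp.card).sum =
        ∑ k, (q k).supp.card := by
      rw [Multiset.map_map]; rfl
    rw [← h1, ← hq, sum_map_clusterFactors]
    exact Finset.sum_congr rfl fun j _ => sum_card_supp_clusterString δ _
  have hprod : ∀ ρ, ∏ k, pauliExp ρ (q k) =
      ∏ j, ∏ Q, pauliExp ρ (clusterString δ (g.str i j) Q) := by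
    intro ρ
    have h1 : ((Finset.univ.val.map q).map fun P => pauliExp ρ P).prod =
        ∏ k, pauliExp ρ (q k) := by
      rw [Multiset.map_map]; rfl
    rw [← h1, ← hq, prod_map_clusterFactors]
  have hcard : Multiset.card (clusterFactors δ g i) ≤ m * p := by
    rw [card_clusterFactors]
    calc _ ≤ ∑ _j : Fin p, m :=
          Finset.sum_le_sum fun j _ => (card_component_le δ _).trans (hg i j)
      _ = m * p := by simp [mul_comm]
  refine ⟨q, fun k => ?_, fun k => ?_, ?_, ?_, hcard, ?_⟩
  · obtain ⟨j, Q, h⟩ := mem_clusterFactors (hmem k)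
    rw [h]
    exact card_supp_clusterString_pos δ _ Q
  · obtain ⟨j, Q, h⟩ := mem_clusterFactors (hmem k)
    rw [h]
    exact (card_supp_clusterString_le δ _ Q).trans (hg i j)
  · rw [hsum]
    calc _ ≤ ∑ _j : Fin p, m := Finset.sum_le_sum fun j _ => hg i j
      _ = m * p := by simp [mul_comm]
  · rw [hsum, card_clusterFactors]
    have h := Finset.sum_le_sum fun j (_ : j ∈ (Finset.univ : Finset (Fin p))) =>
      card_supp_add_one_le δ hm (g.str i j) (hg i j)
    rw [Finset.sum_add_distrib, Finset.sum_add_distrib] at h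
    simpa [mul_comm] using h
  · intro ξ ρ hξ hρ
    rw [hprod]
    refine (abs_prod_sub_prod_le_sum _ (fun j => abs_pauliExp_le_one ρ _) fun j => ?_).trans ?_
    · rw [Finset.abs_prod]
      exact Finset.prod_le_one (fun _ _ => abs_nonneg _) fun Q _ => abs_pauliExp_le_one ρ _
    · refine (Finset.sum_le_sum fun j _ => abs_pauliExp_sub_prod_le hξ hρ (g.str i j)).trans ?_
      rw [← Finset.sum_mul]
      refine mul_le_mul_of_nonneg_right ?_ (Real.exp_pos _).le
      rw [card_clusterFactors] at hcard
      exact_mod_cast hcard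

lemma abs_eval_le_norm1 {V : Type} [Fintype V] [DecidableEq V] (g : PauliPolynomial V p)
    (ρ : DensityMatrix V) : |g.eval ρ| ≤ g.norm1 := by
  refine (Finset.abs_sum_le_sum_abs _ _).trans (Finset.sum_le_sum fun i _ => ?_)
  rw [abs_mul, Finset.abs_prod]
  exact mul_le_of_le_one_right (abs_nonneg _)
    (Finset.prod_le_one (fun _ _ => abs_nonneg _) fun _ _ => abs_pauliExp_le_one ρ _)

end ClusterApproximation

/-! ### The data distribution -/

section Data

variable {V : Type} [Fintype V] [DecidableEq V] {p T : ℕ}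

lemma ae_dataLaw_abs_le (μ : Measure (DensityMatrix V)) [IsProbabilityMeasure μ]
    (g : PauliPolynomial V p) : ∀ᵐ z ∂(dataLaw T μ g), |z.2| ≤ g.norm1 := by
  have hm : Measurable fun q : DensityMatrix V × Shadow V T => (q.2, g.eval q.1) :=
    measurable_snd.prodMk ((measurable_eval g).comp measurable_fst)
  rw [dataLaw, ae_map_iff hm.aemeasurable]
  · exact Filter.Eventually.of_forall fun q => abs_eval_le_norm1 g q.1
  · exact measurableSet_le measurable_snd.abs measurable_const

lemma integral_dataLaw (μ : Measure (DensityMatrix V)) [IsProbabilityMeasure μ]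
    (g : PauliPolynomial V p) {f : Shadow V T × ℝ → ℝ} (hf : Integrable f (dataLaw T μ g)) :
    ∫ z, f z ∂(dataLaw T μ g) =
      ∫ ρ, ∑ S : Shadow V T, shadowProb ρ S * f (S, g.eval ρ) ∂μ := by
  have hm : Measurable fun q : DensityMatrix V × Shadow V T => (q.2, g.eval q.1) :=
    measurable_snd.prodMk ((measurable_eval g).comp measurable_fst)
  have hf' : Integrable (fun q : DensityMatrix V × Shadow V T => f (q.2, g.eval q.1))
      (μ.compProd (shadowKernelLaw V T)) := (integrable_map_measure hf.aestronglyMeasurable hm.aemeasurable).1 hf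
  rw [dataLaw, integral_map hm.aemeasurable hf.aestronglyMeasurable]
  rw [Measure.integral_compProd hf']
  refine integral_congr_ae (Filter.Eventually.of_forall fun ρ => ?_)
  change ∫ S, f (S, g.eval ρ) ∂(∑ S, ENNReal.ofReal (shadowProb ρ S) • Measure.dirac S :
    Measure (Shadow V T)) = _
  rw [integral_finsetSum_measure fun S _ =>
    Integrable.of_finite.smul_measure ENNReal.ofReal_ne_top]
  refine Finset.sum_congr rfl fun S _ => ?_
  rw [integral_smul_measure, integral_dirac, ENNReal.toReal_ofReal (shadowProb_nonneg ρ S),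
    smul_eq_mul]

lemma integrable_sqLoss_dataLaw {H : Type*} [NormedAddCommGroup H] [InnerProductSpace ℝ H]
    (μ : Measure (DensityMatrix V)) [IsProbabilityMeasure μ] (g : PauliPolynomial V p)
    (φ : Shadow V T → H) (w : H) : Integrable (sqLoss φ w) (dataLaw T μ g) := by
  obtain ⟨Kb, hK⟩ : ∃ Kb, ∀ x, ‖φ x‖ ≤ Kb :=
    (Set.finite_range fun x => ‖φ x‖).bddAbove.imp fun _ h x => h ⟨x, rfl⟩
  refine Integrable.of_bound (measurable_sqLoss φ w).aestronglyMeasurable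
    ((g.norm1 + Kb * ‖w‖) ^ 2 / 2) ?_
  filter_upwards [ae_dataLaw_abs_le μ g] with z hz
  rw [Real.norm_of_nonneg (sqLoss_nonneg φ w z)]
  exact sqLoss_le_of_bounds hK le_rfl hz

lemma expectedLoss_dataLaw_le {H : Type*} [NormedAddCommGroup H] [InnerProductSpace ℝ H]
    (μ : Measure (DensityMatrix V)) [IsProbabilityMeasure μ] (g : PauliPolynomial V p)
    (φ : Shadow V T → H) (w : H) {c : ℝ}
    (h : ∀ᵐ ρ ∂μ, ∑ S : Shadow V T, shadowProb ρ S * sqLoss φ w (S, g.eval ρ) ≤ c) :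
    expectedLoss φ (dataLaw T μ g) w ≤ c := by
  rw [expectedLoss, integral_dataLaw μ g (integrable_sqLoss_dataLaw μ g φ w)]
  have := integral_mono_of_nonneg (μ := μ) (Filter.Eventually.of_forall fun ρ =>
    Finset.sum_nonneg fun S _ => mul_nonneg (shadowProb_nonneg ρ S) (sqLoss_nonneg φ w _))
    (integrable_const c) h
  simpa using this

/-- The maximum (9 + 1)/2 = 5 occurs for equal bases and equal outcomes. -/
lemma trace_snapshot_mul_le (c c' : MeasBasis × ℤˣ) :
    ((snapshot c * snapshot c').trace).re ≤ 5 := by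
  obtain ⟨W, o⟩ := c
  obtain ⟨W', o'⟩ := c'
  rw [trace_mul_two]
  rcases Int.units_eq_one_or o with rfl | rfl <;> rcases Int.units_eq_one_or o' with rfl | rfl <;>
    cases W <;> cases W' <;> simp [snapshot, MeasBasis.mat, Pauli.mat] <;> norm_num

lemma shadowKernel_le {τ γ : ℝ} (hτ : 0 ≤ τ) (hγ : 0 ≤ γ) (S S' : Shadow V T) :
    shadowKernel τ γ S S' ≤ Real.exp (τ * Real.exp (5 * γ)) := by
  refine Real.exp_le_exp.2 ?_
  have h1 : ∀ t t', Real.exp (γ / (Fintype.card V : ℝ) *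
      ∑ v, ((snapshot (S t v) * snapshot (S' t' v)).trace).re) ≤ Real.exp (5 * γ) := by
    intro t t'
    refine Real.exp_le_exp.2 ?_
    have h2 : ∑ v, ((snapshot (S t v) * snapshot (S' t' v)).trace).re ≤
        Fintype.card V * 5 := by
      refine (Finset.sum_le_sum fun v _ => trace_snapshot_mul_le _ _).trans ?_
      simp
    calc _ ≤ γ / (Fintype.card V : ℝ) * (Fintype.card V * 5) := by gcongr
      _ = ((Fintype.card V : ℝ) / Fintype.card V) * (5 * γ) := by ring
      -- The form x / x ≤ 1 also covers an empty set of qubits, where the quotient is 0; the same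
      -- device handles T = 0 below.
      _ ≤ 1 * (5 * γ) := mul_le_mul_of_nonneg_right (div_self_le_one _) (by positivity)
      _ = 5 * γ := one_mul _
  have h3 : ∑ t, ∑ t', Real.exp (γ / (Fintype.card V : ℝ) *
      ∑ v, ((snapshot (S t v) * snapshot (S' t' v)).trace).re) ≤ (T : ℝ) ^ 2 * Real.exp (5 * γ) := by
    refine (Finset.sum_le_sum fun t _ => Finset.sum_le_sum fun t' _ => h1 t t').trans ?_
    simp [sq, mul_assoc]
  calc _ ≤ τ / (T : ℝ) ^ 2 * ((T : ℝ) ^ 2 * Real.exp (5 * γ)) := by gcongr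
    _ = ((T : ℝ) ^ 2 / (T : ℝ) ^ 2) * (τ * Real.exp (5 * γ)) := by ring
    _ ≤ 1 * (τ * Real.exp (5 * γ)) := mul_le_mul_of_nonneg_right (div_self_le_one _) (by positivity)
    _ = _ := one_mul _

lemma norm_shadowFeature_sq_le {τ γ : ℝ} (hτ : 0 ≤ τ) (hγ : 0 ≤ γ) (S : Shadow V T) :
    ‖shadowFeature hτ hγ S‖ ^ 2 ≤ Real.exp (τ * Real.exp (5 * γ)) := by
  rw [← real_inner_self_eq_norm_sq, inner_shadowFeature]
  exact shadowKernel_le hτ hγ S S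

end Data

/-! ### A weight vector of bounded norm and small expected loss -/

section Approximation

/-- With enough rounds, the error bound for a product of `d ≤ m p` estimators is small. -/
lemma product_error_le {G ε : ℝ} (hε : 0 < ε) (hεG : ε < G) {m p d T : ℕ} (hp : 1 ≤ p)
    (hm : 1 ≤ m) (hd : d ≤ m * p)
    (hT : 256 / (3 * ε ^ 2) * G ^ 2 * 12 ^ m * ((m * p : ℕ) : ℝ) ^ 2 *
      Real.log (G ^ 2 * 2 ^ (m + 5) * ((m * p : ℕ) : ℝ) * (3 ^ (m ^ 2 * p) + 1) ^ 2 / ε ^ 2)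
        ≤ (T : ℝ)) {η : ℝ} (hη : η = ε / (4 * G * ((m * p : ℕ) : ℝ))) :
    ((1 + η) ^ d - 1) ^ 2 +
        (3 ^ (m * p) + 1) ^ 2 * (2 * d * Real.exp (-(T * η ^ 2 / (2 * (3 ^ m + 1) ^ 2)))) ≤
      ε ^ 2 / (6 * G ^ 2) := by
  have hG : 0 < G := hε.trans hεG
  set K : ℝ := ((m * p : ℕ) : ℝ) with hK
  have hK1 : 1 ≤ K := by rw [hK]; exact_mod_cast Nat.mul_pos hm hp
  have hK0 : 0 < K := by linarith
  have hdK : (d : ℝ) ≤ K := by rw [hK]; exact_mod_cast hd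
  have hη0 : 0 < η := by rw [hη]; positivity
  set x : ℝ := ε / (4 * G) with hx
  have hx0 : 0 < x := by positivity
  have hx1 : x ≤ 1 / 4 := by
    rw [hx, div_le_iff₀ (by positivity)]
    linarith
  have hdη : d * η ≤ x := by
    calc d * η ≤ K * η := by gcongr
      _ = x := by rw [hη, hx]; field_simp
  -- the good event
  have h1 : (1 + η) ^ d - 1 ≤ 5 / 4 * x := by
    have e1 : (1 + η) ^ d ≤ Real.exp x := by
      calc (1 + η) ^ d ≤ Real.exp η ^ d := by
            gcongr
            linarith [Real.add_one_le_exp η]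
        _ = Real.exp (d * η) := (Real.exp_nat_mul _ _).symm
        _ ≤ _ := Real.exp_le_exp.2 hdη
    have e2 := Real.abs_exp_sub_one_sub_id_le (x := x) (by rw [abs_of_pos hx0]; linarith)
    have e3 := (abs_le.1 e2).2
    nlinarith
  have h1' : 0 ≤ (1 + η) ^ d - 1 := sub_nonneg.2 (one_le_pow₀ (by linarith))
  have h2 : ((1 + η) ^ d - 1) ^ 2 ≤ 25 / 256 * (ε ^ 2 / G ^ 2) := by
    calc ((1 + η) ^ d - 1) ^ 2 ≤ (5 / 4 * x) ^ 2 := by gcongr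
      _ = _ := by rw [hx]; field_simp; norm_num
  -- the bad event
  set M : ℝ := 3 ^ (m * p) + 1 with hM
  set A : ℝ := G ^ 2 * 2 ^ (m + 5) * K * (3 ^ (m ^ 2 * p) + 1) ^ 2 / ε ^ 2 with hA
  have hM0 : 0 < M := by positivity
  have hMM : M ≤ 3 ^ (m ^ 2 * p) + 1 := by
    have : m * p ≤ m ^ 2 * p := by
      rw [sq]
      exact Nat.mul_le_mul_right p (Nat.le_mul_of_pos_left m hm)
    have h3 : (3 : ℝ) ^ (m * p) ≤ 3 ^ (m ^ 2 * p) := pow_le_pow_right₀ (by norm_num) this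
    rw [hM]; linarith
  have hA1 : 32 * (G ^ 2 / ε ^ 2) * K * M ^ 2 ≤ A := by
    have h32 : (32 : ℝ) ≤ 2 ^ (m + 5) := by
      calc (32 : ℝ) = 2 ^ 5 := by norm_num
        _ ≤ _ := pow_le_pow_right₀ (by norm_num) (by omega)
    calc 32 * (G ^ 2 / ε ^ 2) * K * M ^ 2
        ≤ 2 ^ (m + 5) * (G ^ 2 / ε ^ 2) * K * (3 ^ (m ^ 2 * p) + 1) ^ 2 := by gcongr
      _ = A := by rw [hA]; ring
  have hGε : 1 ≤ G ^ 2 / ε ^ 2 := by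
    rw [le_div_iff₀ (by positivity), one_mul]
    gcongr
  have hM1 : 1 ≤ M := by
    have : (0 : ℝ) ≤ 3 ^ (m * p) := by positivity
    rw [hM]; linarith
  have hA2 : 1 ≤ A := by
    refine le_trans ?_ hA1
    have := one_le_mul_of_one_le_of_one_le
      (one_le_mul_of_one_le_of_one_le hGε hK1) (one_le_pow₀ hM1 (n := 2))
    nlinarith
  have hA0 : 0 < A := by linarith
  have hlog : 0 ≤ Real.log A := Real.log_nonneg hA2
  -- The range 3^m + 1 of a centred estimator enters Hoeffding's exponent squared; this absorbs it
  -- into the 12^m of the assumption on T.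
  have hpow : 3 * ((3 : ℝ) ^ m + 1) ^ 2 ≤ 8 * 12 ^ m := by
    have h3 : (3 : ℝ) ≤ 3 ^ m := by
      calc (3 : ℝ) = 3 ^ 1 := by norm_num
        _ ≤ _ := pow_le_pow_right₀ (by norm_num) hm
    have h9 : ((3 : ℝ) ^ m) ^ 2 ≤ 12 ^ m := by
      rw [← pow_mul, mul_comm, pow_mul]
      gcongr
      norm_num
    nlinarith
  have hE : Real.log A ≤ T * η ^ 2 / (2 * (3 ^ m + 1) ^ 2) := by
    rw [le_div_iff₀ (by positivity)]
    calc Real.log A * (2 * (3 ^ m + 1) ^ 2)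
        = 2 / 3 * Real.log A * (3 * (3 ^ m + 1) ^ 2) := by ring
      _ ≤ 2 / 3 * Real.log A * (8 * 12 ^ m) := by gcongr
      _ = 256 / (3 * ε ^ 2) * G ^ 2 * 12 ^ m * K ^ 2 * Real.log A * η ^ 2 := by
          rw [hη]; field_simp; ring
      _ ≤ T * η ^ 2 := by gcongr
  have hexp : Real.exp (-(T * η ^ 2 / (2 * (3 ^ m + 1) ^ 2))) ≤ 1 / A := by
    rw [one_div, ← Real.exp_log (inv_pos.2 hA0), Real.log_inv]
    exact Real.exp_le_exp.2 (neg_le_neg hE)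
  have h3 : M ^ 2 * (2 * d * Real.exp (-(T * η ^ 2 / (2 * (3 ^ m + 1) ^ 2)))) ≤
      1 / 16 * (ε ^ 2 / G ^ 2) := by
    calc _ ≤ M ^ 2 * (2 * K * (1 / A)) := by gcongr
      _ ≤ M ^ 2 * (2 * K * (1 / (32 * (G ^ 2 / ε ^ 2) * K * M ^ 2))) := by gcongr
      _ = _ := by field_simp; norm_num
  have h4 : ε ^ 2 / (6 * G ^ 2) = 1 / 6 * (ε ^ 2 / G ^ 2) := by ring
  rw [h4]
  have : 0 ≤ ε ^ 2 / G ^ 2 := by positivity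
  linarith

/-- Cauchy–Schwarz with weights |c i|: the error grows with ‖g‖₁ and not with the number of terms.
-/
lemma sq_sum_mul_le {ι : Type*} (s : Finset ι) (c D : ι → ℝ) :
    (∑ i ∈ s, c i * D i) ^ 2 ≤ (∑ i ∈ s, |c i|) * ∑ i ∈ s, |c i| * D i ^ 2 := by
  have h := Finset.sum_mul_sq_le_sq_mul_sq s (fun i => Real.sqrt |c i|)
    fun i => Real.sqrt |c i| * |D i|
  have e1 : ∀ i, Real.sqrt |c i| * (Real.sqrt |c i| * |D i|) = |c i * D i| := fun i => by
    rw [← mul_assoc, Real.mul_self_sqrt (abs_nonneg _), abs_mul]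
  simp only [e1, mul_pow, Real.sq_sqrt (abs_nonneg _), sq_abs] at h
  refine le_trans ?_ h
  rw [← sq_abs]
  gcongr
  exact Finset.abs_sum_le_sum_abs _ _

variable {D : ℕ} {L : Fin D → ℕ} [∀ μ, NeZero (L μ)] {p : ℕ}

/-- A weight vector in the ball of the ridge regression with small expected loss. -/
lemma exists_weight {m : ℕ} (hm : 1 ≤ m) (hp : 1 ≤ p)
    {g : PauliPolynomial (Site L) p} (hg : g.IsBody m) {ξ : ℝ} (hξ : 0 < ξ) {τ γ : ℝ}
    (hτ : 0 < τ) (hγ : 0 < γ) (hγ2 : 1 ≤ 2 / γ) (hτ2 : 1 ≤ ((m * p : ℕ) : ℝ) / τ)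
    (μ : Measure (DensityMatrix (Site L))) [IsProbabilityMeasure μ]
    (hμ : ∀ᵐ ρ ∂μ, TranslationSymmetric ρ ∧ ExpClustering ξ ρ)
    {ε : ℝ} (hε : 0 < ε) (hεg : ε < g.norm1) {δ : ℝ}
    (hδ : δ = ξ * Real.log (2 * g.norm1 * ((m * p : ℕ) : ℝ) / ε)) {T : ℕ} (hT0 : 0 < T)
    (hT : 256 / (3 * ε ^ 2) * g.norm1 ^ 2 * 12 ^ m * ((m * p : ℕ) : ℝ) ^ 2 *
      Real.log (g.norm1 ^ 2 * 2 ^ (m + 5) * ((m * p : ℕ) : ℝ) * (3 ^ (m ^ 2 * p) + 1) ^ 2 / ε ^ 2)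
        ≤ (T : ℝ)) :
    ∃ w : FeatureSpace (Site L),
      ‖w‖ ^ 2 ≤ g.norm1 ^ 2 * (2 * (m : ℝ) ^ 2 * (p : ℝ) ^ 2 / (τ * γ)) ^ (m * p) *
        (Fintype.card (Site L) : ℝ) ^ (m * p - localFactorCount δ g) ∧
      expectedLoss (shadowFeature hτ.le hγ.le) (dataLaw T μ g) w ≤ 5 / 12 * ε ^ 2 := by
  classical
  set G := g.norm1 with hG
  have hG0 : 0 < G := hε.trans hεg
  set K : ℝ := ((m * p : ℕ) : ℝ) with hK
  have hK1 : 1 ≤ K := by rw [hK]; exact_mod_cast Nat.mul_pos hm hp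
  have hK0 : 0 < K := by linarith
  choose q hq0 hqm hqR hqp hqd hqc using fun i => exists_factors δ hm hg i
  have hβ : ∀ i, localFactorCount δ g ≤ max p (Multiset.card (clusterFactors δ g i)) := fun i =>
    max_le_max_left p (ciInf_le (OrderBot.bddBelow _) i)
  -- The choice of δ: each term has at most K = m p clusters, so after weighting by the coefficients
  -- the total cluster error is at most ε/2.
  have hexp : K * Real.exp (-δ / ξ) = ε / (2 * G) := by
    have hy : 0 < 2 * G * K / ε := by positivity
    have : -δ / ξ = Real.log (2 * G * K / ε)⁻¹ := by
      rw [hδ, Real.log_inv]; field_simp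
    rw [this, Real.exp_log (inv_pos.2 hy)]
    field_simp
  set W : ℝ := (2 * (m : ℝ) ^ 2 * (p : ℝ) ^ 2 / (τ * γ)) ^ (m * p) *
    (Fintype.card (Site L) : ℝ) ^ (m * p - localFactorCount δ g) with hW
  have hW0 : 0 ≤ W := by positivity
  have hnorm : ∀ i, ‖productWeight τ γ (q i)‖ ≤ Real.sqrt W := by
    intro i
    have h1 : localFactorCount δ g ≤ m * p :=
      (hβ i).trans (max_le (Nat.le_mul_of_pos_left p hm) (hqd i))
    -- The count is at most p or at most the number d of clusters of this term. In the first case R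
    -- + p ≤ m p + d is used, in the second R ≤ m p.
    have h2 : ∑ k, (q i k).supp.card + localFactorCount δ g ≤
        m * p + Multiset.card (clusterFactors δ g i) := by
      have := hβ i
      have := hqR i
      have := hqp i
      rcases le_max_iff.1 (hβ i) with h | h <;> omega
    refine Real.le_sqrt_of_sq_le ((norm_productWeight_sq_le hτ hγ (hq0 i) (hqR i) h2 h1 hγ2
      hτ2).trans (le_of_eq ?_))
    rw [hW]
    congr 2
    push_cast
    field_simp
  refine ⟨∑ i, g.coeff i • productWeight τ γ (q i), ?_, ?_⟩
  · have h1 : ‖∑ i, g.coeff i • productWeight τ γ (q i)‖ ≤ G * Real.sqrt W := by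
      refine (norm_sum_le _ _).trans ?_
      rw [hG, PauliPolynomial.norm1, Finset.sum_mul]
      refine Finset.sum_le_sum fun i _ => ?_
      rw [norm_smul, Real.norm_eq_abs]
      exact mul_le_mul_of_nonneg_left (hnorm i) (abs_nonneg _)
    calc _ ≤ (G * Real.sqrt W) ^ 2 := by gcongr
      _ = G ^ 2 * W := by rw [mul_pow, Real.sq_sqrt hW0]
      _ = _ := by rw [hW, ← mul_assoc]
  · refine expectedLoss_dataLaw_le μ g _ _ ?_
    filter_upwards [hμ] with ρ hρ
    obtain ⟨hρt, hρc⟩ := hρ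
    set F : Fin g.numTerms → Shadow (Site L) T → ℝ := fun i S =>
      ∏ k, shadowEstimate (q i k) S - ∏ k, pauliExp ρ (q i k) with hF
    set a : ℝ := g.eval ρ - ∑ i, g.coeff i * ∏ k, pauliExp ρ (q i k) with ha
    have ha1 : |a| ≤ ε / 2 := by
      have e : a = ∑ i, g.coeff i *
          (∏ j, pauliExp ρ (g.str i j) - ∏ k, pauliExp ρ (q i k)) := by
        rw [ha, PauliPolynomial.eval, ← Finset.sum_sub_distrib]
        exact Finset.sum_congr rfl fun i _ => by ring
      rw [e]
      refine (Finset.abs_sum_le_sum_abs _ _).trans ?_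
      calc _ ≤ ∑ i, |g.coeff i| * (ε / (2 * G)) := by
            refine Finset.sum_le_sum fun i _ => ?_
            rw [abs_mul, ← hexp]
            exact mul_le_mul_of_nonneg_left (hqc i hξ hρc) (abs_nonneg _)
        _ = G * (ε / (2 * G)) := by rw [← Finset.sum_mul, hG, PauliPolynomial.norm1]
        _ = ε / 2 := by field_simp
    have ha2 : a ^ 2 ≤ ε ^ 2 / 4 := by
      rw [← sq_abs]
      calc |a| ^ 2 ≤ (ε / 2) ^ 2 := by gcongr
        _ = _ := by ring
    have hmse : ∀ i, ∑ S : Shadow (Site L) T, shadowProb ρ S * F i S ^ 2 ≤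
        ε ^ 2 / (6 * G ^ 2) := fun i =>
      (sum_shadowProb_sq_prod_sub_le hρt (q i) (hqm i) (hqR i) hT0
        (η := ε / (4 * G * K)) (by positivity)).trans
        (product_error_le hε hεg hp hm (hqd i) hT rfl)
    -- The residual is the deterministic cluster error minus the shadow noise, and the factor 1/2 in
    -- the loss absorbs the 2 of (a - b)² ≤ 2a² + 2b².
    have hloss : ∀ S : Shadow (Site L) T,
        sqLoss (shadowFeature hτ.le hγ.le) (∑ i, g.coeff i • productWeight τ γ (q i))
          (S, g.eval ρ) ≤ a ^ 2 + G * ∑ i, |g.coeff i| * F i S ^ 2 := by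
      intro S
      have e : g.eval ρ - inner ℝ (∑ i, g.coeff i • productWeight τ γ (q i))
          (shadowFeature hτ.le hγ.le S) = a - ∑ i, g.coeff i * F i S := by
        have e1 : ∀ i, inner ℝ (g.coeff i • productWeight τ γ (q i))
            (shadowFeature hτ.le hγ.le S) = g.coeff i * ∏ k, shadowEstimate (q i k) S := fun i => by
          rw [real_inner_smul_left, inner_productWeight hτ hγ (q i) S]
        rw [sum_inner, Finset.sum_congr rfl fun i _ => e1 i]
        simp only [hF, ha, mul_sub, Finset.sum_sub_distrib]
        ring
      have h2 := sq_sum_mul_le Finset.univ g.coeff fun i => F i S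
      rw [← PauliPolynomial.norm1, ← hG] at h2
      rw [sqLoss, e]
      nlinarith [sq_nonneg (a + ∑ i, g.coeff i * F i S)]
    calc _ ≤ ∑ S : Shadow (Site L) T, shadowProb ρ S *
          (a ^ 2 + G * ∑ i, |g.coeff i| * F i S ^ 2) :=
          Finset.sum_le_sum fun S _ =>
            mul_le_mul_of_nonneg_left (hloss S) (shadowProb_nonneg ρ S)
      _ = a ^ 2 + G * ∑ i, |g.coeff i| * ∑ S : Shadow (Site L) T, shadowProb ρ S * F i S ^ 2 := by
          have e : ∀ S : Shadow (Site L) T, shadowProb ρ S *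
              (a ^ 2 + G * ∑ i, |g.coeff i| * F i S ^ 2) = a ^ 2 * shadowProb ρ S +
              G * ∑ i, |g.coeff i| * (shadowProb ρ S * F i S ^ 2) := by
            intro S
            rw [mul_add, mul_left_comm, Finset.mul_sum]
            congr 1
            · ring
            · congr 1
              exact Finset.sum_congr rfl fun i _ => by ring
          simp only [e]
          rw [Finset.sum_add_distrib, ← Finset.mul_sum, sum_shadowProb, mul_one, ← Finset.mul_sum,
            Finset.sum_comm]
          simp only [Finset.mul_sum]
      _ ≤ ε ^ 2 / 4 + G * ∑ i, |g.coeff i| * (ε ^ 2 / (6 * G ^ 2)) := by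
          gcongr with i _
          exact hmse i
      _ = ε ^ 2 / 4 + G * (G * (ε ^ 2 / (6 * G ^ 2))) := by
          rw [← Finset.sum_mul, hG, PauliPolynomial.norm1]
      _ = 5 / 12 * ε ^ 2 := by field_simp; norm_num

end Approximation

lemma localFactorCount_le {D : ℕ} {L : Fin D → ℕ} [∀ μ, NeZero (L μ)] {m p : ℕ} (hm : 1 ≤ m)
    {g : PauliPolynomial (Site L) p} (hg : g.IsBody m) (hg0 : 0 < g.norm1) (δ : ℝ) :
    localFactorCount δ g ≤ m * p := by
  have hne : Nonempty (Fin g.numTerms) := by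
    by_contra h
    rw [not_nonempty_iff] at h
    simp [PauliPolynomial.norm1] at hg0
  obtain ⟨i⟩ := hne
  obtain ⟨q, -, -, -, -, h, -⟩ := exists_factors δ hm hg i
  exact max_le (Nat.le_mul_of_pos_left p hm) ((ciInf_le (OrderBot.bddBelow _) i).trans h)

end ShadowLearning

end

/-! ### The main theorem -/

theorem mainTheorem5 {D : ℕ} (L : Fin D → ℕ) [∀ μ, NeZero (L μ)]
    (m p : ℕ) (hm : 1 ≤ m) (hp : 1 ≤ p)
    (g : ShadowLearning.PauliPolynomial (ShadowLearning.Site L) p) (hg : g.IsBody m)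
    (ξ : ℝ) (hξ : 0 < ξ) (τ γ : ℝ) (hτ : 0 < τ) (hγ : 0 < γ)
    (hγ2 : 1 ≤ 2 / γ) (hτ2 : 1 ≤ ((m * p : ℕ) : ℝ) / τ)
    (μ : MeasureTheory.Measure (ShadowLearning.DensityMatrix (ShadowLearning.Site L)))
    [MeasureTheory.IsProbabilityMeasure μ]
    (hμ : ∀ᵐ ρ ∂μ, ShadowLearning.TranslationSymmetric ρ ∧ ShadowLearning.ExpClustering ξ ρ)
    (ε : ℝ) (hε : 0 < ε) (hεg : ε < g.norm1)
    (δ : ℝ) (hδ : δ = ξ * Real.log (2 * g.norm1 * ((m * p : ℕ) : ℝ) / ε))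
    (n β : ℕ) (hn : n = Fintype.card (ShadowLearning.Site L))
    (hβ : β = ShadowLearning.localFactorCount δ g)
    (Bsq lam : ℝ)
    (hB : Bsq = g.norm1 ^ 2 * (2 * (m : ℝ) ^ 2 * (p : ℝ) ^ 2 / (τ * γ)) ^ (m * p) *
      (n : ℝ) ^ (m * p - β))
    (hlam : lam = ε ^ 2 / (6 * Bsq))
    (N T : ℕ)
    (hN : 600 / ε ^ 4 * g.norm1 ^ 4 * Real.exp (τ * Real.exp (5 * γ)) *
      (2 * (m : ℝ) ^ 2 * (p : ℝ) ^ 2 / (τ * γ)) ^ (m * p) * (n : ℝ) ^ (m * p - β) ≤ (N : ℝ))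
    (hT : 256 / (3 * ε ^ 2) * g.norm1 ^ 2 * 12 ^ m * ((m * p : ℕ) : ℝ) ^ 2 *
      Real.log (g.norm1 ^ 2 * 2 ^ (m + 5) * ((m * p : ℕ) : ℝ) * (3 ^ (m ^ 2 * p) + 1) ^ 2 / ε ^ 2)
        ≤ (T : ℝ)) :
    (p ≤ β ∧ β ≤ m * p) ∧
    (∀ Z : Fin N → ShadowLearning.Shadow (ShadowLearning.Site L) T × ℝ,
      ∃! w, ShadowLearning.IsRidgeMinimizer
        (ShadowLearning.shadowFeature hτ.le hγ.le) Bsq lam Z w) ∧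
    (∀ w, MeasureTheory.Integrable
      (ShadowLearning.sqLoss (ShadowLearning.shadowFeature hτ.le hγ.le) w)
      (ShadowLearning.dataLaw T μ g)) ∧
    ∀ wstar : (Fin N → ShadowLearning.Shadow (ShadowLearning.Site L) T × ℝ) →
        ShadowLearning.FeatureSpace (ShadowLearning.Site L),
      (∀ Z, ShadowLearning.IsRidgeMinimizer
        (ShadowLearning.shadowFeature hτ.le hγ.le) Bsq lam Z (wstar Z)) →
      MeasureTheory.Integrable
        (fun Z => ShadowLearning.expectedLoss (ShadowLearning.shadowFeature hτ.le hγ.le)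
          (ShadowLearning.dataLaw T μ g) (wstar Z))
        (MeasureTheory.Measure.pi fun _ : Fin N => ShadowLearning.dataLaw T μ g) ∧
      ∫ Z, ShadowLearning.expectedLoss (ShadowLearning.shadowFeature hτ.le hγ.le)
          (ShadowLearning.dataLaw T μ g) (wstar Z)
        ∂(MeasureTheory.Measure.pi fun _ : Fin N => ShadowLearning.dataLaw T μ g) ≤ ε ^ 2 := by
  have hG0 : 0 < g.norm1 := hε.trans hεg
  have hK1 : (1 : ℝ) ≤ ((m * p : ℕ) : ℝ) := by exact_mod_cast Nat.mul_pos hm hp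
  have hm0 : (0 : ℝ) < m := by exact_mod_cast hm
  have hp0 : (0 : ℝ) < p := by exact_mod_cast hp
  have hn0 : (0 : ℝ) < n := by rw [hn]; exact_mod_cast Fintype.card_pos
  obtain ⟨W, hW⟩ : ∃ W, W = (2 * (m : ℝ) ^ 2 * (p : ℝ) ^ 2 / (τ * γ)) ^ (m * p) *
      (n : ℝ) ^ (m * p - β) := ⟨_, rfl⟩
  have hW0 : 0 < W := by rw [hW]; positivity
  have hBW : Bsq = g.norm1 ^ 2 * W := by rw [hB, hW, mul_assoc]
  have hB0 : 0 < Bsq := by rw [hBW]; positivity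
  have hlam0 : 0 < lam := by rw [hlam]; positivity
  obtain ⟨Ksq, hKsq⟩ : ∃ Ksq, Ksq = Real.exp (τ * Real.exp (5 * γ)) := ⟨_, rfl⟩
  have hKsq0 : 0 < Ksq := by rw [hKsq]; exact Real.exp_pos _
  have hNW : 600 / ε ^ 4 * g.norm1 ^ 4 * Ksq * W ≤ N := by
    rw [hKsq, hW, ← mul_assoc]
    exact hN
  have hN0 : 0 < N := by
    have : (0 : ℝ) < N := lt_of_lt_of_le (by positivity) hNW
    exact_mod_cast this
  -- The logarithm in the bound on T is strictly positive, since its argument is at least 2^(m+5).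
  have hT0 : 0 < T := by
    have hGε : 1 ≤ g.norm1 ^ 2 / ε ^ 2 := by
      rw [le_div_iff₀ (by positivity), one_mul]
      gcongr
    have h3 : (1 : ℝ) ≤ (3 ^ (m ^ 2 * p) + 1) ^ 2 :=
      one_le_pow₀ (by linarith [pow_pos (three_pos : (0 : ℝ) < 3) (m ^ 2 * p)])
    have h2 : (1 : ℝ) < 2 ^ (m + 5) := one_lt_pow₀ (by norm_num) (by omega)
    have hA : 1 < g.norm1 ^ 2 * 2 ^ (m + 5) * ((m * p : ℕ) : ℝ) * (3 ^ (m ^ 2 * p) + 1) ^ 2 /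
        ε ^ 2 := by
      calc (1 : ℝ) < 2 ^ (m + 5) := h2
        _ ≤ 2 ^ (m + 5) * (g.norm1 ^ 2 / ε ^ 2 * ((m * p : ℕ) : ℝ) *
            (3 ^ (m ^ 2 * p) + 1) ^ 2) :=
          le_mul_of_one_le_right (by positivity) (one_le_mul_of_one_le_of_one_le
            (one_le_mul_of_one_le_of_one_le hGε hK1) h3)
        _ = _ := by ring
    have hlog := Real.log_pos hA
    have : (0 : ℝ) < T := lt_of_lt_of_le (by positivity) hT
    exact_mod_cast this
  refine ⟨⟨?_, ?_⟩, fun Z => ?_, fun w => ?_, fun wstar hw => ?_⟩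
  · rw [hβ]
    exact le_max_left _ _
  · rw [hβ]
    exact ShadowLearning.localFactorCount_le hm hg hG0 δ
  · exact ShadowLearning.existsUnique_isRidgeMinimizer _ hB0.le hlam0 Z
  · exact ShadowLearning.integrable_sqLoss_dataLaw μ g _ w
  · obtain ⟨w₀, hw₀, hloss⟩ := ShadowLearning.exists_weight hm hp hg hξ hτ hγ hγ2 hτ2 μ hμ hε hεg
      hδ hT0 hT
    rw [← hβ, ← hn, ← hB] at hw₀
    obtain ⟨hint, hgen⟩ := ShadowLearning.ridge_generalization (Ksq := Ksq)
      (fun S => (ShadowLearning.norm_shadowFeature_sq_le hτ.le hγ.le S).trans hKsq.ge)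
      (ShadowLearning.dataLaw T μ g) (ShadowLearning.ae_dataLaw_abs_le μ g) hlam0 hN0 hw hw₀
    refine ⟨hint, ?_⟩
    have hreg : lam * ‖w₀‖ ^ 2 ≤ ε ^ 2 / 6 := by
      calc lam * ‖w₀‖ ^ 2 ≤ lam * Bsq := by gcongr
        _ = ε ^ 2 / 6 := by rw [hlam]; field_simp
    -- With lam = ε²/(6 G² W) the assumption on N gives lam N ≥ 100 Ksq G²/ε², and G²/ε² ≥ 1.
    have hκ : Ksq / (lam * N) ≤ 1 / 100 := by
      rw [div_le_div_iff₀ (by positivity) (by norm_num)]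
      have hGε : ε ^ 2 ≤ g.norm1 ^ 2 := by gcongr
      calc Ksq * 100 = 100 * Ksq * (ε ^ 2 / ε ^ 2) := by field_simp
        _ ≤ 100 * Ksq * (g.norm1 ^ 2 / ε ^ 2) := by gcongr
        _ = lam * (600 / ε ^ 4 * g.norm1 ^ 4 * Ksq * W) := by
            rw [hlam, hBW]; field_simp; norm_num
        _ ≤ lam * N := by gcongr
        _ = 1 * (lam * N) := (one_mul _).symm
    have hκ0 : 0 ≤ Ksq / (lam * N) := by positivity
    generalize Ksq / (lam * N) = κ at hgen hκ hκ0
    set E := ∫ Z, ShadowLearning.expectedLoss (ShadowLearning.shadowFeature hτ.le hγ.le)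
      (ShadowLearning.dataLaw T μ g) (wstar Z)
      ∂(MeasureTheory.Measure.pi fun _ : Fin N => ShadowLearning.dataLaw T μ g)
    -- 5/12 from the expected loss of w₀ and 1/6 from its penalty. The conclusion follows because
    -- 101/99 · 7/12 < 1.
    have h1 : (1 - κ) * E ≤ 101 / 100 * (7 / 12 * ε ^ 2) := by
      refine hgen.trans ?_
      have : 0 ≤ ε ^ 2 := sq_nonneg ε
      calc _ ≤ (1 + κ) * (7 / 12 * ε ^ 2) :=
            mul_le_mul_of_nonneg_left (by linarith) (by linarith)
        _ ≤ _ := mul_le_mul_of_nonneg_right (by linarith) (by linarith)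
    by_contra hE
    push Not at hE
    nlinarith [sq_pos_of_pos hε]
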